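/- **Setting.** Let $d\ge 1$. Let $(\chi,\rho)$ be a dyadic partition of unity on $\mathbb{R}^d$: smooth, nonnegative, radial functions with $\operatorname{supp}\chi$ in a ball and $\operatorname{supp}\rho$ in an annulus, $\chi(z)+\sum_{j\ge 0}\rho(2^{-j}z)=1$ for all $z$, $\operatorname{supp}\chi\cap\operatorname{supp}\rho(2^{-j}\cdot)=\emptyset$ for $j\ge1$, and $\operatorname{supp}\rho(2^{-i}\cdot)\cap\operatorname{supp}\rho(2^{-j}\cdot)=\emptyset$ for $|i-j|>1$. Put $\rho_{-1}=\chi$ and $\rho_j=\rho(2^{-j}\cdot)$ for $j\ge 0$, let $K_j(z)=(2\pi)^{-d}\int e^{\mathrm{i}\langle z,\xi\rangle}\rho_j(\xi)\,d\xi$, and let $K_{<i}=\sum_{-1\le j<i}K_j$. For a function $V$ write $V_x(y)=V(x-y)$, and for a test function $\varphi$ write $\varphi_x^\lambda(y)=\lambda^{-d}\varphi((y-x)/\lambda)$. A *regularity structure* $(A,T,G)$ consists of a set $A\subset\mathbb{R}$ that is bounded below, has no accumulation points and contains $0$; a vector space $T=\bigoplus_{\alpha\in A}T_\alpha$ with real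 Banach spaces $T_\alpha$ and $T_0\simeq\mathbb{R}$; and a group $G$ of continuous linear operators on $T$ that leave $T_0$ invariant and satisfy $\Gamma\tau-\tau\in\bigoplus_{\beta<\alpha}T_\beta$ for $\tau\in T_\alpha$, $\Gamma\in G$. We write $\|\tau\|_\alpha$ for the norm of the component of $\tau$ in $T_\alpha$. For $s>0$, a *unit test function of order $s$* is a smooth function $\varphi$ supported in the closed unit ball with $\|\varphi\|_{C^s_b}\le 1$. Given $r>|\min A|$, a *model* consists of continuous linear maps $\Pi_x:T\to\mathscr{S}'(\mathbb{R}^d)$ and operators $\Gamma_{x,y}\in G$ ($x,y\in\mathbb{R}^d$) with $\Gamma_{x,y}\Gamma_{y,z}=\Gamma_{x,z}$ and $\Pi_x\Gamma_{x,y}=\Pi_y$, such that for every $\gamma_0>0$ there is a constant $C$ with $$|(\Pi_x\tau)(\varphi_x^\lambda)|\le C\lambda^\alpha\|\tau\|_\alpha,\qquad \|\Gamma_{x,y}\tau\|_\beta\le C|x-y|^{\alpha-\beta}\|\tau\|_\alpha$$ for all $x,y\in\mathbb{R}^d$, $0<\lambda\le1$, $\tau\in T_\alpha$ with $\alpha\le\gamma_0$,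 $\beta\in A$ with $\beta<\alpha$, and unit test functions $\varphi$ of order $r$. For $\gamma\in\mathbb{R}$, the space $\mathcal{D}^\gamma$ consists of all $f:\mathbb{R}^d\to\bigoplus_{\alpha<\gamma}T_\alpha$ such that for every $\alpha<\gamma$ there is $C$ with $\|f_x-\Gamma_{x,y}f_y\|_\alpha\le C|x-y|^{\gamma-\alpha}$ and $\|f_x\|_\alpha\le C$ for all $x,y$. For a number $q$ with $q>|\min A|$ and $q+\gamma>|\min A|$, a *reconstruction* of $f\in\mathcal{D}^\gamma$ is a tempered distribution $u$ for which there is a constant $C$ with $$|u(\varphi_x^\lambda)-(\Pi_xf_x)(\varphi_x^\lambda)|\le C\lambda^\gamma$$ for all $x\in\mathbb{R}^d$, $0<\lambda\le1$ and unit test functions $\varphi$ of order $q+\gamma$. **Theorem.** Let $\gamma\in\mathbb{R}\setminus\{0\}$, let $(\Pi,\Gamma)$ be a model, with bounds over unit test functions of some order $r>|\min A|$, and let $q>|\min A|$ be such that $q+\gamma>|\min A|$ (automatic if $\gamma>0$). Then for every $f\in\mathcal{D}^\gamma$ the integrals $$P_if(x)=\int K_{<i-1,x}(z)\,(\Pi_zf_z)(K_{i,x})\,dz,\qquad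 i\ge0,$$ converge absolutely, the functions $P_if$ define tempered distributions, and $Pf=\sum_{i\ge0}P_if$ converges to a tempered distribution, the generalized paraproduct. The map $P$ is linear in $f$. Moreover: 1. If $\gamma<0$, then $\mathcal{R}f=Pf$ is a reconstruction of $f$, for every $f\in\mathcal{D}^\gamma$. 2. If $\gamma>0$, then for every $f\in\mathcal{D}^\gamma$ the series $$Tf(x)=\sum_{i\ge-1}\bigl[(Pf)(K_{i,x})-(\Pi_xf_x)(K_{i,x})\bigr]$$ converges for every $x$ to a function that defines a tempered distribution, $T$ is linear in $f$, and $\mathcal{R}f=Pf-Tf$ is a reconstruction of $f$. It is the only one. -/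

import Mathlib

open scoped SchwartzMap FourierTransform ContDiff DirectSum ENNReal
open MeasureTheory

universe u

noncomputable section

/-- The Euclidean space `ℝ^d`. -/
abbrev Euc (d : ℕ) : Type := EuclideanSpace ℝ (Fin d)

/-! ### Operations on test functions -/

/-- The dilated function `y ↦ φ (c y)`, for `c ≠ 0`. -/
def dilate {d : ℕ} (c : ℝ) (φ : 𝓢(Euc d, ℂ)) : 𝓢(Euc d, ℂ) :=
  if h : c ≠ 0 then
    SchwartzMap.compCLMOfContinuousLinearEquiv ℂ
      (ContinuousLinearEquiv.smulLeft (Units.mk0 c h) : Euc d ≃L[ℝ] Euc d) φ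
  else 0

theorem dilate_apply {d : ℕ} {c : ℝ} (hc : c ≠ 0) (φ : 𝓢(Euc d, ℂ)) (y : Euc d) :
    dilate c φ y = φ (c • y) := by
  simp only [dilate, dif_pos hc]
  rfl

/-- The rescaled and recentred test function `φ_x^λ (y) = λ^{-d} φ ((y - x) / λ)`. -/
def rescale {d : ℕ} (φ : 𝓢(Euc d, ℂ)) (x : Euc d) (lam : ℝ) : 𝓢(Euc d, ℂ) :=
  (((lam ^ d)⁻¹ : ℝ) : ℂ) • (dilate lam⁻¹ φ).compSubConstCLM ℂ x

theorem rescale_apply {d : ℕ} (φ : 𝓢(Euc d, ℂ)) (x : Euc d) {lam : ℝ} (h : 0 < lam)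
    (y : Euc d) :
    rescale φ x lam y = (((lam ^ d)⁻¹ : ℝ) : ℂ) * φ (lam⁻¹ • (y - x)) := by
  simp [rescale, dilate_apply (inv_ne_zero h.ne')]

/-- For a kernel `V`, the function `V_x (y) = V (x - y)`. -/
def kernelAt {d : ℕ} (V : 𝓢(Euc d, ℂ)) (x : Euc d) : 𝓢(Euc d, ℂ) :=
  (SchwartzMap.compCLMOfContinuousLinearEquiv ℂ
    (ContinuousLinearEquiv.neg ℝ : Euc d ≃L[ℝ] Euc d) V).compSubConstCLM ℂ x

theorem kernelAt_apply {d : ℕ} (V : 𝓢(Euc d, ℂ)) (x y : Euc d) :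
    kernelAt V x y = V (x - y) := by
  simp [kernelAt]

/-- The norm of `C_b^s`, for `s > 0`: the suprema of the derivatives of order at most `⌊s⌋` and,
if `s` is not an integer, the `(s - ⌊s⌋)`-Hölder seminorm of the derivative of order `⌊s⌋`. -/
def cbNorm {d : ℕ} (s : ℝ) (φ : Euc d → ℂ) : ℝ≥0∞ :=
  (∑ k ∈ Finset.range (⌊s⌋₊ + 1), ⨆ x, ‖iteratedFDeriv ℝ k φ x‖ₑ) +
    if (⌊s⌋₊ : ℝ) = s then 0
    else ⨆ (x : Euc d) (y : Euc d) (_ : x ≠ y),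
      ‖iteratedFDeriv ℝ ⌊s⌋₊ φ x - iteratedFDeriv ℝ ⌊s⌋₊ φ y‖ₑ / ‖x - y‖ₑ ^ (s - ⌊s⌋₊)

/-- The test functions of norm at most one in `C_b^s`, supported in the unit ball. -/
def IsUnitTest {d : ℕ} (s : ℝ) (φ : 𝓢(Euc d, ℂ)) : Prop :=
  tsupport (φ : Euc d → ℂ) ⊆ Metric.closedBall 0 1 ∧ cbNorm s φ ≤ 1

/-! ### Littlewood--Paley theory -/

/-- A dyadic partition of unity `(χ, ρ)` on `ℝ^d`. -/
structure DyadicPartition (d : ℕ) where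
  χ : Euc d → ℝ
  ρ : Euc d → ℝ
  χ_smooth : ContDiff ℝ ∞ χ
  ρ_smooth : ContDiff ℝ ∞ ρ
  χ_nonneg : ∀ z, 0 ≤ χ z
  ρ_nonneg : ∀ z, 0 ≤ ρ z
  χ_radial : ∀ z w, ‖z‖ = ‖w‖ → χ z = χ w
  ρ_radial : ∀ z w, ‖z‖ = ‖w‖ → ρ z = ρ w
  χ_supp : ∃ b : ℝ, 0 < b ∧ tsupport χ ⊆ {z | ‖z‖ ≤ b}
  ρ_supp : ∃ a b : ℝ, 0 < a ∧ a < b ∧ tsupport ρ ⊆ {z | a ≤ ‖z‖ ∧ ‖z‖ ≤ b}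
  sum_eq_one : ∀ z, HasSum (fun j : ℕ => ρ ((2 : ℝ) ^ (-(j : ℤ)) • z)) (1 - χ z)
  disjoint_χ : ∀ j : ℕ, 1 ≤ j →
    Disjoint (tsupport χ) (tsupport fun z => ρ ((2 : ℝ) ^ (-(j : ℤ)) • z))
  disjoint_ρ : ∀ i j : ℕ, 1 < |(i : ℤ) - j| →
    Disjoint (tsupport fun z => ρ ((2 : ℝ) ^ (-(i : ℤ)) • z))
      (tsupport fun z => ρ ((2 : ℝ) ^ (-(j : ℤ)) • z))

namespace DyadicPartition

variable {d : ℕ} (D : DyadicPartition d)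

theorem χ_compact : HasCompactSupport D.χ := by
  obtain ⟨b, _, hb⟩ := D.χ_supp
  refine HasCompactSupport.of_support_subset_isCompact (isCompact_closedBall (0 : Euc d) b)
    fun z hz => ?_
  simpa using hb (subset_tsupport _ hz)

theorem ρ_compact : HasCompactSupport D.ρ := by
  obtain ⟨a, b, _, _, hb⟩ := D.ρ_supp
  refine HasCompactSupport.of_support_subset_isCompact (isCompact_closedBall (0 : Euc d) b)
    fun z hz => ?_
  simpa using (hb (subset_tsupport _ hz)).2

/-- `χ` as a complex-valued Schwartz function. -/
def χS : 𝓢(Euc d, ℂ) :=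
  HasCompactSupport.toSchwartzMap (f := fun z => (D.χ z : ℂ))
    (D.χ_compact.comp_left (g := fun t : ℝ => (t : ℂ)) Complex.ofReal_zero)
    (Complex.ofRealCLM.contDiff.comp D.χ_smooth)

/-- `ρ` as a complex-valued Schwartz function. -/
def ρS : 𝓢(Euc d, ℂ) :=
  HasCompactSupport.toSchwartzMap (f := fun z => (D.ρ z : ℂ))
    (D.ρ_compact.comp_left (g := fun t : ℝ => (t : ℂ)) Complex.ofReal_zero)
    (Complex.ofRealCLM.contDiff.comp D.ρ_smooth)

/-- `ρ_{-1} = χ` and `ρ_j = ρ (2^{-j} ·)` for `j ≥ 0` (and `0` for the unused `j < -1`). -/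
def symbol (j : ℤ) : 𝓢(Euc d, ℂ) :=
  if j = -1 then D.χS else if 0 ≤ j then dilate ((2 : ℝ) ^ (-j)) D.ρS else 0

/-- The Littlewood--Paley kernel `K_j`, the inverse Fourier transform of `ρ_j`. Mathlib's Fourier
transform has the phase `2π⟨z, ξ⟩`, whence the dilation; see `kernel_apply`. -/
def kernel (j : ℤ) : 𝓢(Euc d, ℂ) := 𝓕⁻ (dilate (2 * Real.pi) (D.symbol j))

theorem kernel_apply (j : ℤ) (z : Euc d) :
    D.kernel j z = ((((2 * Real.pi) ^ d)⁻¹ : ℝ) : ℂ) *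
      ∫ ξ : Euc d, Complex.exp (Complex.I * (inner ℝ z ξ : ℝ)) * D.symbol j ξ := by
  have h2 : (2 * Real.pi) ≠ 0 := by positivity
  have key := Measure.integral_comp_smul (volume : Measure (Euc d))
    (fun ξ => Complex.exp (Complex.I * (inner ℝ z ξ : ℝ)) * D.symbol j ξ) (2 * Real.pi)
  rw [kernel, SchwartzMap.fourierInv_coe, Real.fourierInv_eq']
  have : ∀ v : Euc d,
      Complex.exp (((2 * Real.pi * inner ℝ v z : ℝ) : ℂ) * Complex.I) •
        (dilate (2 * Real.pi) (D.symbol j)) v =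
      Complex.exp (Complex.I * (inner ℝ z ((2 * Real.pi) • v) : ℝ)) *
        D.symbol j ((2 * Real.pi) • v) := by
    intro v
    rw [dilate_apply h2, inner_smul_right, real_inner_comm, mul_comm Complex.I, smul_eq_mul]
  simp_rw [this]
  rw [key]
  have h3 : (0 : ℝ) < ((2 * Real.pi) ^ d)⁻¹ := by positivity
  rw [finrank_euclideanSpace_fin, abs_of_pos h3]
  simp

/-- `K_{<i} = ∑_{-1 ≤ j < i} K_j`. -/
def kernelLt (i : ℤ) : 𝓢(Euc d, ℂ) := ∑ j ∈ Finset.Ico (-1) i, D.kernel j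

end DyadicPartition

/-! ### Regularity structures, models and modelled distributions -/

/-- A regularity structure `(A, T, G)`, where `T = ⨁_{α ∈ A} T_α`. A linear operator on `T` which
is triangular as in `sub_lower` is continuous if and only if all its components `T_α → T_β` are. -/
structure RegularityStructure where
  A : Set ℝ
  bddBelow : BddBelow A
  no_accPt : ∀ x : ℝ, ¬ AccPt x (Filter.principal A)
  zero_mem : (0 : ℝ) ∈ A
  T : A → Type u
  [normed : ∀ α, NormedAddCommGroup (T α)]
  [space : ∀ α, NormedSpace ℝ (T α)]
  [complete : ∀ α, CompleteSpace (T α)]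
  /-- The structure group. -/
  G : Subgroup ((⨁ α, T α) ≃ₗ[ℝ] (⨁ α, T α))
  continuous_G : ∀ g ∈ G, ∀ α β : A,
    Continuous fun τ : T α => g (DirectSum.lof ℝ A T α τ) β
  sub_lower : ∀ g ∈ G, ∀ (α : A) (τ : T α) (β : A), ¬ β < α →
    (g (DirectSum.lof ℝ A T α τ) - DirectSum.lof ℝ A T α τ) β = 0
  T_zero : Nonempty (T ⟨0, zero_mem⟩ ≃L[ℝ] ℝ)
  T_zero_invariant : ∀ g ∈ G, ∀ (τ : T ⟨0, zero_mem⟩) (β : A), β ≠ ⟨0, zero_mem⟩ →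
    g (DirectSum.lof ℝ A T ⟨0, zero_mem⟩ τ) β = 0

namespace RegularityStructure

attribute [instance] RegularityStructure.normed RegularityStructure.space
  RegularityStructure.complete

variable (S : RegularityStructure.{u})

/-- The model space `T = ⨁_{α ∈ A} T_α`. -/
abbrev Space : Type u := ⨁ α, S.T α

/-- The inclusion `T_α → T`. -/
abbrev incl (α : S.A) : S.T α →ₗ[ℝ] S.Space := DirectSum.lof ℝ S.A S.T α

/-- `min A`; see `isLeast_minA`. -/
def minA : ℝ := sInf S.A

theorem isLeast_minA : IsLeast S.A S.minA := by
  have hc : IsClosed S.A := by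
    rw [isClosed_iff_derivedSet_subset]
    intro x hx
    exact absurd hx (S.no_accPt x)
  exact ⟨hc.csInf_mem ⟨0, S.zero_mem⟩ S.bddBelow, fun a ha => csInf_le S.bddBelow ha⟩

end RegularityStructure

/-- A model `(Π, Γ)` for `S` on `ℝ^d`, with bounds over test functions in `C_b^r`. -/
structure Model (S : RegularityStructure.{u}) (d : ℕ) (r : ℝ) where
  Pi : Euc d → S.Space →ₗ[ℝ] 𝓢'(Euc d, ℂ)
  continuous_Pi : ∀ x α, Continuous fun τ : S.T α => Pi x (S.incl α τ)
  Γ : Euc d → Euc d → S.Space ≃ₗ[ℝ] S.Space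
  Γ_mem : ∀ x y, Γ x y ∈ S.G
  Γ_comp : ∀ x y z τ, Γ x y (Γ y z τ) = Γ x z τ
  Pi_Γ : ∀ x y τ, Pi x (Γ x y τ) = Pi y τ
  bounds : ∀ γ : ℝ, 0 < γ → ∃ C : ℝ,
    (∀ (α : S.A), (α : ℝ) ≤ γ → ∀ (τ : S.T α) (φ : 𝓢(Euc d, ℂ)), IsUnitTest r φ →
      ∀ (x : Euc d) (lam : ℝ), 0 < lam → lam ≤ 1 →
        ‖Pi x (S.incl α τ) (rescale φ x lam)‖ ≤ C * lam ^ (α : ℝ) * ‖τ‖) ∧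
    (∀ (α : S.A), (α : ℝ) ≤ γ → ∀ (β : S.A), β < α → ∀ (τ : S.T α) (x y : Euc d),
        ‖Γ x y (S.incl α τ) β‖ ≤ C * ‖x - y‖ ^ ((α : ℝ) - β) * ‖τ‖)

namespace Model

variable {S : RegularityStructure.{u}} {d : ℕ} {r : ℝ} (M : Model S d r)

/-- The space `𝒟^γ` of modelled distributions. -/
def modelled (γ : ℝ) : Submodule ℝ (Euc d → S.Space) where
  carrier := {f | (∀ x (α : S.A), γ ≤ α → f x α = 0) ∧
    ∀ α : S.A, (α : ℝ) < γ → ∃ C : ℝ,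
      (∀ x y, ‖(f x - M.Γ x y (f y)) α‖ ≤ C * ‖x - y‖ ^ (γ - (α : ℝ))) ∧
      ∀ x, ‖f x α‖ ≤ C}
  zero_mem' := ⟨fun x α _ => by simp, fun α _ => ⟨0, by simp, by simp⟩⟩
  add_mem' := by
    rintro f g ⟨hf, hf'⟩ ⟨hg, hg'⟩
    refine ⟨fun x α h => by simp [hf x α h, hg x α h], fun α h => ?_⟩
    obtain ⟨C, h1, h2⟩ := hf' α h
    obtain ⟨C', h1', h2'⟩ := hg' α h
    refine ⟨C + C', fun x y => ?_, fun x => ?_⟩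
    · have : ((f + g) x - M.Γ x y ((f + g) y)) α
          = (f x - M.Γ x y (f y)) α + (g x - M.Γ x y (g y)) α := by
        simp only [Pi.add_apply, map_add, ← DirectSum.add_apply]
        congr 1
        abel
      rw [this, add_mul]
      exact norm_add_le_of_le (h1 x y) (h1' x y)
    · simpa using norm_add_le_of_le (h2 x) (h2' x)
  smul_mem' := by
    rintro c f ⟨hf, hf'⟩
    refine ⟨fun x α h => by simp [DirectSum.smul_apply, hf x α h], fun α h => ?_⟩
    obtain ⟨C, h1, h2⟩ := hf' α h
    refine ⟨‖c‖ * C, fun x y => ?_, fun x => ?_⟩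
    · have : ((c • f) x - M.Γ x y ((c • f) y)) α = c • (f x - M.Γ x y (f y)) α := by
        simp only [Pi.smul_apply, map_smul, ← DirectSum.smul_apply, smul_sub]
      rw [this, norm_smul, mul_assoc]
      exact mul_le_mul_of_nonneg_left (h1 x y) (norm_nonneg c)
    · rw [Pi.smul_apply, DirectSum.smul_apply, norm_smul]
      exact mul_le_mul_of_nonneg_left (h2 x) (norm_nonneg c)

/-- `u` is a reconstruction of the modelled distribution `f ∈ 𝒟^γ`, with respect to test functions
in `C_b^{q + γ}`. -/
def IsReconstruction {γ : ℝ} (q : ℝ) (f : M.modelled γ) (u : 𝓢'(Euc d, ℂ)) : Prop :=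
  ∃ C : ℝ, ∀ φ : 𝓢(Euc d, ℂ), IsUnitTest (q + γ) φ →
    ∀ (x : Euc d) (lam : ℝ), 0 < lam → lam ≤ 1 →
      ‖u (rescale φ x lam) - M.Pi x (f.1 x) (rescale φ x lam)‖ ≤ C * lam ^ γ

/-- The integrand `z ↦ K_{<i-1,x}(z) Π_z f_z (K_{i,x})`. -/
def paraIntegrand (D : DyadicPartition d) (f : Euc d → S.Space) (i : ℕ) (x z : Euc d) : ℂ :=
  kernelAt (D.kernelLt ((i : ℤ) - 1)) x z * M.Pi z (f z) (kernelAt (D.kernel i) x)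

/-- `P_i f (x) = ∫ K_{<i-1,x}(z) Π_z f_z (K_{i,x}) dz`. -/
def paraBlock (D : DyadicPartition d) (f : Euc d → S.Space) (i : ℕ) (x : Euc d) : ℂ :=
  ∫ z, M.paraIntegrand D f i x z

/-- `u` is the generalized paraproduct `P f = ∑_{i ≥ 0} P_i f`: the integrals which define the
`P_i f` converge, the `P_i f` are tempered distributions, and their sum converges to `u`. -/
def IsParaproduct (D : DyadicPartition d) (f : Euc d → S.Space) (u : 𝓢'(Euc d, ℂ)) : Prop :=
  (∀ i x, Integrable (M.paraIntegrand D f i x)) ∧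
  ∀ φ : 𝓢(Euc d, ℂ), (∀ i, Integrable fun x => M.paraBlock D f i x * φ x) ∧
    HasSum (fun i : ℕ => ∫ x, M.paraBlock D f i x * φ x) (u φ)

/-- `T_i f (x) = P f (K_{i,x}) - Π_x f_x (K_{i,x})` for `i ≥ -1`, where `p` stands for `P f`. -/
def remBlock (D : DyadicPartition d) (f : Euc d → S.Space) (p : 𝓢'(Euc d, ℂ)) (i : ℤ)
    (x : Euc d) : ℂ :=
  p (kernelAt (D.kernel i) x) - M.Pi x (f x) (kernelAt (D.kernel i) x)

/-- `v` is the distribution given by the function `T f = ∑_{i ≥ -1} T_i f`, a pointwise convergent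
series. Here `p` stands for `P f`. -/
def IsRemainder (D : DyadicPartition d) (f : Euc d → S.Space) (p v : 𝓢'(Euc d, ℂ)) : Prop :=
  ∃ g : Euc d → ℂ,
    (∀ x, HasSum (fun n : ℕ => M.remBlock D f p ((n : ℤ) - 1) x) (g x)) ∧
    ∀ φ : 𝓢(Euc d, ℂ), Integrable (fun x => g x * φ x) ∧ v φ = ∫ x, g x * φ x

end Model

end

noncomputable section

section

open Filter Topology

/-! ### Schwartz functions and tempered distributions -/

namespace SchwartzMap

variable {d : ℕ}

/-! Write `μ = 2^{-i}` and `a = min A`. The engine is spectral localization: as a function of `x`,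
the block `P_i f` has spectrum in an annulus of size `2^i`. Indeed, for fixed `z` it is a product of
`K_{<i-1}(x - z)`, with spectrum in a ball, and of a pairing with `K_i(x - ·)`, with spectrum in an
annulus; the disjointness of the supports of `χ` and `ρ(·/2)` keeps the sum of the two spectra away
from the origin. Localization is expressed without Fourier transforms of distributions: read at
scale `μ`, a localized function satisfies `g = H * g` for one fixed Schwartz function `H` whose
Fourier transform is compactly supported away from `0` (`DyadicPartition.exists_annular`). Such an
`H` can be written as a sum of derivatives as often as desired, so pairing `g` with a smooth
function gains a power of `μ` per derivative, and fractional powers for Hölder regularity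
(`IsAnnular.norm_integral_shift_le`, `IsAnnular.norm_integral_mul_rescale_le`). The pairing vanishes
if the test function has spectrum off the annulus (`integral_mul_eq_zero_of_reproducing`).

The input from the regularity structure is that the model bounds extend to Schwartz functions
(`exists_bound_schwartz`), whence `(Π_z f_z - Π_y f_y)(K_{i,x})` is at most `μ^γ` times polynomial
weights in `|x - z|/μ` and `|x - y|/μ` (`exists_bound_sub`). Crude bounds give `P_i f = O(μ^a)`, and
enough integrations by parts make `∑ P_i f` converge (`exists_isParaproduct`).

As `K_{<i-1}` has integral one for `i ≥ 1`, `P_i f - Π_y f_y(K_{i,·})` is the paraproduct block of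
the family `Π_z f_z - Π_y f_y`, of size `μ^γ` near `y`. Only boundedly many blocks interact with
`K_{j,y}`, and so `(P f - Π_y f_y)(K_{j,y}) = O(2^{-jγ})` (`exists_bound_remBlock`). Replacing `Π_y
f_y` by `Π_x f_x` costs a weight in `2^j |y - x|` (`exists_bound_sub_pairing`).

To test `P f - Π_x f_x` against `φ_x^λ`, split frequencies at `1/λ`. High frequencies sum to `λ^γ`
by the order `q + γ > |a|` of `φ` (`exists_bound_high`). Low frequencies sum to `λ^γ` if `γ < 0`,
the geometric series being dominated by its last term. If `γ > 0` they do not, but subtracting `T f`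
leaves a tail of its series and a difference of local descriptions, both `O(λ^γ)`. For `γ > 0` the
difference of two reconstructions vanishes in the limit when tested against an approximate identity,
which gives uniqueness. -/

theorem decay_one_add (φ : 𝓢(Euc d, ℂ)) (k n : ℕ) :
    ∃ C, 0 ≤ C ∧ ∀ y, (1 + ‖y‖) ^ k * ‖iteratedFDeriv ℝ n φ y‖ ≤ C :=
  ⟨2 ^ k * ((Finset.Iic (k, n)).sup fun m => SchwartzMap.seminorm ℝ m.1 m.2) φ,
    mul_nonneg (by positivity) (apply_nonneg _ _),
    fun y => one_add_le_sup_seminorm_apply (m := (k, n)) le_rfl le_rfl φ y⟩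

theorem decay_rpow (φ : 𝓢(Euc d, ℂ)) (M : ℝ) (n : ℕ) :
    ∃ C, 0 ≤ C ∧ ∀ y, ‖iteratedFDeriv ℝ n φ y‖ ≤ C * (1 + ‖y‖) ^ (-M) := by
  obtain ⟨k, hk⟩ := exists_nat_ge M
  obtain ⟨C, hC, h⟩ := decay_one_add φ k n
  refine ⟨C, hC, fun y => ?_⟩
  have h1 : 1 ≤ 1 + ‖y‖ := by linarith [norm_nonneg y]
  have h0 : 0 < 1 + ‖y‖ := by linarith
  rw [Real.rpow_neg h0.le, ← div_eq_mul_inv, le_div_iff₀ (Real.rpow_pos_of_pos h0 _), mul_comm]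
  refine le_trans ?_ (h y)
  gcongr
  rw [← Real.rpow_natCast]
  exact Real.rpow_le_rpow_of_exponent_le h1 hk

theorem decay_rpow_zero (φ : 𝓢(Euc d, ℂ)) (M : ℝ) :
    ∃ C, 0 ≤ C ∧ ∀ y, ‖φ y‖ ≤ C * (1 + ‖y‖) ^ (-M) := by
  simpa using decay_rpow φ M 0

theorem one_add_norm_le_mul (x y : Euc d) : 1 + ‖y‖ ≤ (1 + ‖x‖) * (1 + ‖y - x‖) := by
  have : ‖y‖ ≤ ‖x‖ + ‖y - x‖ := by simpa using norm_add_le x (y - x)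
  nlinarith [norm_nonneg x, norm_nonneg (y - x)]

theorem iteratedFDeriv_shift (φ : 𝓢(Euc d, ℂ)) (x y : Euc d) (n : ℕ) :
    iteratedFDeriv ℝ n (φ.compSubConstCLM ℂ x) y = iteratedFDeriv ℝ n φ (y - x) := by
  have : (φ.compSubConstCLM ℂ x : Euc d → ℂ) = fun z => φ (z - x) := by
    ext z; simp
  rw [this, iteratedFDeriv_comp_sub]

theorem seminorm_shift_le (φ : 𝓢(Euc d, ℂ)) (k n : ℕ) :
    ∃ C, 0 ≤ C ∧ ∀ x, SchwartzMap.seminorm ℂ k n (φ.compSubConstCLM ℂ x) ≤ C * (1 + ‖x‖) ^ k := by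
  obtain ⟨C, hC, h⟩ := decay_one_add φ k n
  refine ⟨C, hC, fun x => seminorm_le_bound ℂ k n _ (by positivity) fun y => ?_⟩
  rw [iteratedFDeriv_shift]
  calc ‖y‖ ^ k * ‖iteratedFDeriv ℝ n φ (y - x)‖
      ≤ ((1 + ‖x‖) * (1 + ‖y - x‖)) ^ k * ‖iteratedFDeriv ℝ n φ (y - x)‖ := by
        gcongr
        exact (by linarith : ‖y‖ ≤ 1 + ‖y‖).trans (one_add_norm_le_mul x y)
    _ = (1 + ‖x‖) ^ k * ((1 + ‖y - x‖) ^ k * ‖iteratedFDeriv ℝ n φ (y - x)‖) := by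
        rw [mul_pow]; ring
    _ ≤ (1 + ‖x‖) ^ k * C := by gcongr; exact h _
    _ = _ := mul_comm _ _

theorem continuous_of_seminorm_tendsto {X : Type*} [TopologicalSpace X] {F : X → 𝓢(Euc d, ℂ)}
    (h : ∀ x₀ k n, Tendsto (fun x => SchwartzMap.seminorm ℂ k n (F x - F x₀)) (𝓝 x₀) (𝓝 0)) :
    Continuous F := by
  rw [continuous_iff_continuousAt]
  intro x₀
  rw [ContinuousAt, (schwartz_withSeminorms ℂ (Euc d) ℂ).tendsto_nhds]
  intro i ε hε
  exact (h x₀ i.1 i.2).eventually (gt_mem_nhds hε)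

/-- The mean value inequality for `D^n ψ` on the segment from `y` to `y - v`, where the polynomial
weights are comparable as long as `‖v‖ ≤ 1`, makes each seminorm of the increment `O(‖v‖)`. -/
theorem continuous_shift (φ : 𝓢(Euc d, ℂ)) :
    Continuous fun x : Euc d => φ.compSubConstCLM ℂ x := by
  apply continuous_of_seminorm_tendsto
  intro x₀ k n
  set ψ := φ.compSubConstCLM ℂ x₀ with hψ
  obtain ⟨C, hC, h⟩ := decay_one_add ψ k (n + 1)
  have key : ∀ x : Euc d, ‖x - x₀‖ ≤ 1 →
      SchwartzMap.seminorm ℂ k n (φ.compSubConstCLM ℂ x - ψ) ≤ 2 ^ k * C * ‖x - x₀‖ := by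
    intro x hx
    refine seminorm_le_bound ℂ k n _ (by positivity) fun y => ?_
    have e1 : φ.compSubConstCLM ℂ x = ψ.compSubConstCLM ℂ (x - x₀) := by
      rw [hψ, compSubConstCLM_comp]; simp
    set v := x - x₀ with hv
    rw [e1]
    have e2 : iteratedFDeriv ℝ n (ψ.compSubConstCLM ℂ v - ψ : 𝓢(Euc d, ℂ)) y
        = iteratedFDeriv ℝ n ψ (y - v) - iteratedFDeriv ℝ n ψ y := by
      rw [← iteratedFDeriv_shift]
      have : ((ψ.compSubConstCLM ℂ v - ψ : 𝓢(Euc d, ℂ)) : Euc d → ℂ)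
        = (ψ.compSubConstCLM ℂ v : Euc d → ℂ) - ψ := by ext; simp
      rw [this, iteratedFDeriv_sub_apply] <;> exact (SchwartzMap.smooth _ n).contDiffAt
    rw [e2]
    have hb : ∀ z ∈ segment ℝ y (y - v), ‖fderiv ℝ (iteratedFDeriv ℝ n ψ) z‖
        ≤ 2 ^ k * C / (1 + ‖y‖) ^ k := by
      intro z hz
      rw [norm_fderiv_iteratedFDeriv, le_div_iff₀ (by positivity)]
      have hzy : ‖y - z‖ ≤ 1 := by
        have := norm_sub_le_of_mem_segment hz
        rw [norm_sub_rev]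
        refine this.trans ?_
        simpa using hx
      have h3 : 1 + ‖y‖ ≤ 2 * (1 + ‖z‖) := by
        have := one_add_norm_le_mul z y
        nlinarith [norm_nonneg z]
      calc ‖iteratedFDeriv ℝ (n + 1) ψ z‖ * (1 + ‖y‖) ^ k
          ≤ ‖iteratedFDeriv ℝ (n + 1) ψ z‖ * (2 * (1 + ‖z‖)) ^ k := by gcongr
        _ = 2 ^ k * ((1 + ‖z‖) ^ k * ‖iteratedFDeriv ℝ (n + 1) ψ z‖) := by rw [mul_pow]; ring
        _ ≤ 2 ^ k * C := by gcongr; exact h z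
    have hd : ∀ z ∈ segment ℝ y (y - v), DifferentiableAt ℝ (iteratedFDeriv ℝ n ψ) z := by
      intro z _
      exact ((SchwartzMap.smooth ψ (n + 1 : ℕ)).differentiable_iteratedFDeriv
        (by exact_mod_cast Nat.lt_succ_self n)) z
    have := (convex_segment y (y - v)).norm_image_sub_le_of_norm_fderiv_le hd hb
      (left_mem_segment ℝ _ _) (right_mem_segment ℝ _ _)
    have hyk : ‖y‖ ^ k ≤ (1 + ‖y‖) ^ k := by gcongr; linarith
    calc ‖y‖ ^ k * ‖iteratedFDeriv ℝ n ψ (y - v) - iteratedFDeriv ℝ n ψ y‖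
        ≤ (1 + ‖y‖) ^ k * (2 ^ k * C / (1 + ‖y‖) ^ k * ‖y - v - y‖) := by gcongr
      _ = 2 ^ k * C * ‖v‖ := by
        rw [sub_sub_cancel_left, norm_neg]; field_simp
  have h0 : Tendsto (fun x : Euc d => 2 ^ k * C * ‖x - x₀‖) (𝓝 x₀) (𝓝 0) := by
    have : Continuous fun x : Euc d => 2 ^ k * C * ‖x - x₀‖ := by fun_prop
    simpa using this.tendsto x₀
  refine squeeze_zero' (Eventually.of_forall fun x => apply_nonneg _ _) ?_ h0
  filter_upwards [Metric.closedBall_mem_nhds x₀ one_pos] with x hx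
  exact key x (by simpa [dist_eq_norm] using hx)

theorem exists_bound_of_continuous_seminorm (q : Seminorm ℂ 𝓢(Euc d, ℂ)) (hq : Continuous q) :
    ∃ (s : Finset (ℕ × ℕ)) (C : ℝ), 0 ≤ C ∧
      ∀ φ, q φ ≤ C * ∑ m ∈ s, SchwartzMap.seminorm ℂ m.1 m.2 φ := by
  obtain ⟨s, C, _, h⟩ := Seminorm.bound_of_continuous (schwartz_withSeminorms ℂ (Euc d) ℂ) q hq
  refine ⟨s, C, C.2, fun φ => (h φ).trans ?_⟩
  rw [smul_apply, NNReal.smul_def, smul_eq_mul]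
  gcongr
  have := Seminorm.finset_sup_le_sum (schwartzSeminormFamily ℂ (Euc d) ℂ) s
  refine (this φ).trans (le_of_eq ?_)
  rw [← FunLike.coeAddMonoidHom_apply, map_sum, Finset.sum_apply]
  rfl

theorem exists_bound_seminorm (u : 𝓢'(Euc d, ℂ)) :
    ∃ (s : Finset (ℕ × ℕ)) (C : ℝ), 0 ≤ C ∧
      ∀ φ, ‖u φ‖ ≤ C * ∑ m ∈ s, SchwartzMap.seminorm ℂ m.1 m.2 φ :=
  exists_bound_of_continuous_seminorm ((normSeminorm ℂ ℂ).comp u.toLinearMap)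
    (continuous_norm.comp u.continuous)

theorem exists_bound_seminorm_clm (A : 𝓢(Euc d, ℂ) →L[ℂ] 𝓢(Euc d, ℂ)) (k n : ℕ) :
    ∃ (s : Finset (ℕ × ℕ)) (C : ℝ), 0 ≤ C ∧
      ∀ φ, SchwartzMap.seminorm ℂ k n (A φ) ≤ C * ∑ m ∈ s, SchwartzMap.seminorm ℂ m.1 m.2 φ := by
  let q : Seminorm ℂ 𝓢(Euc d, ℂ) := (SchwartzMap.seminorm ℂ k n).comp A.toLinearMap
  have hq : Continuous q :=
    ((schwartz_withSeminorms ℂ (Euc d) ℂ).continuous_seminorm (k, n)).comp A.continuous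
  exact exists_bound_of_continuous_seminorm q hq

end SchwartzMap

end

section

open Filter Topology LineDeriv

variable {d : ℕ}

/-- Bounded continuous functions with values in the `n`-linear forms. -/
def BddForms (d n : ℕ) : Type := BoundedContinuousFunction (Euc d) (Euc d [×n]→L[ℝ] ℂ)

instance (n : ℕ) : NormedAddCommGroup (BddForms d n) :=
  inferInstanceAs (NormedAddCommGroup (BoundedContinuousFunction (Euc d) (Euc d [×n]→L[ℝ] ℂ)))

instance (n : ℕ) : NormedSpace ℂ (BddForms d n) :=
  inferInstanceAs (NormedSpace ℂ (BoundedContinuousFunction (Euc d) (Euc d [×n]→L[ℝ] ℂ)))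

instance (n : ℕ) : CompleteSpace (BddForms d n) :=
  inferInstanceAs (CompleteSpace (BoundedContinuousFunction (Euc d) (Euc d [×n]→L[ℝ] ℂ)))

namespace BddForms
/-- Evaluation at a point. -/
def eval (n : ℕ) (z : Euc d) (m : Fin n → Euc d) : BddForms d n →L[ℂ] ℂ :=
  LinearMap.mkContinuous
    { toFun := fun f => (show BoundedContinuousFunction (Euc d) (Euc d [×n]→L[ℝ] ℂ) from f) z m
      map_add' := fun f g => rfl
      map_smul' := fun c f => rfl } (∏ i, ‖m i‖) fun f => by
    let g : BoundedContinuousFunction (Euc d) (Euc d [×n]→L[ℝ] ℂ) := f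
    refine ((g z).le_opNorm m).trans ?_
    rw [mul_comm]
    exact mul_le_mul_of_nonneg_left (g.norm_coe_le_norm z) (by positivity)

theorem ext {n : ℕ} {f g : BddForms d n} (h : ∀ z m, eval n z m f = eval n z m g) : f = g :=
  BoundedContinuousFunction.ext fun z => ContinuousMultilinearMap.ext fun m => h z m

/-- The weighted derivative `y ↦ ‖y‖ ^ k • D^n φ y`. -/
def ofSchwartz (k n : ℕ) : 𝓢(Euc d, ℂ) →ₗ[ℂ] BddForms d n where
  toFun φ := BoundedContinuousFunction.ofNormedAddCommGroup
    (fun y => ‖y‖ ^ k • iteratedFDeriv ℝ n φ y)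
    ((by fun_prop : Continuous fun y : Euc d => ‖y‖ ^ k).smul
      ((φ.smooth ⊤).continuous_iteratedFDeriv (mod_cast le_top)))
    (SchwartzMap.seminorm ℂ k n φ)
    fun y => by
      rw [norm_smul, norm_pow, norm_norm]
      exact SchwartzMap.le_seminorm ℂ k n φ y
  map_add' φ ψ := by
    refine BoundedContinuousFunction.ext fun y => ?_
    have : ((φ + ψ : 𝓢(Euc d, ℂ)) : Euc d → ℂ) = (φ : Euc d → ℂ) + ψ := by ext; simp
    change ‖y‖ ^ k • iteratedFDeriv ℝ n (φ + ψ : 𝓢(Euc d, ℂ)) y =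
      ‖y‖ ^ k • iteratedFDeriv ℝ n φ y + ‖y‖ ^ k • iteratedFDeriv ℝ n ψ y
    rw [this, iteratedFDeriv_add_apply ((φ.smooth n).contDiffAt) ((ψ.smooth n).contDiffAt),
      smul_add]
  map_smul' c φ := by
    refine BoundedContinuousFunction.ext fun y => ?_
    have : ((c • φ : 𝓢(Euc d, ℂ)) : Euc d → ℂ) = c • (φ : Euc d → ℂ) := by ext; simp
    change ‖y‖ ^ k • iteratedFDeriv ℝ n (c • φ : 𝓢(Euc d, ℂ)) y =
      c • ‖y‖ ^ k • iteratedFDeriv ℝ n φ y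
    rw [this, iteratedFDeriv_const_smul_apply ((φ.smooth n).contDiffAt), smul_comm]

theorem eval_ofSchwartz (k n : ℕ) (φ : 𝓢(Euc d, ℂ)) (z : Euc d) (m : Fin n → Euc d) :
    eval n z m (ofSchwartz k n φ) = ‖z‖ ^ k • (∂^{m} φ) z := by
  rw [SchwartzMap.iteratedLineDerivOp_eq_iteratedFDeriv]
  rfl

theorem norm_ofSchwartz (k n : ℕ) (φ : 𝓢(Euc d, ℂ)) :
    ‖ofSchwartz k n φ‖ = SchwartzMap.seminorm ℂ k n φ := by
  apply le_antisymm
  · exact BoundedContinuousFunction.norm_ofNormedAddCommGroup_le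
      (f := fun y => ‖y‖ ^ k • iteratedFDeriv ℝ n φ y)
      ((by fun_prop : Continuous fun y : Euc d => ‖y‖ ^ k).smul
        ((φ.smooth ⊤).continuous_iteratedFDeriv (mod_cast le_top))) (apply_nonneg _ _)
      fun y => by
        rw [norm_smul, norm_pow, norm_norm]
        exact SchwartzMap.le_seminorm ℂ k n φ y
  · refine SchwartzMap.seminorm_le_bound ℂ k n φ (norm_nonneg (ofSchwartz k n φ)) fun y => ?_
    have := BoundedContinuousFunction.norm_coe_le_norm (α := Euc d)
      (β := Euc d [×n]→L[ℝ] ℂ)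
      (ofSchwartz k n φ) y
    refine le_trans (le_of_eq ?_) this
    change _ = ‖‖y‖ ^ k • iteratedFDeriv ℝ n φ y‖
    rw [norm_smul, norm_pow, norm_norm]

end BddForms

namespace SchwartzMap

variable {d : ℕ}

open BddForms

/-- A tempered distribution factors through finitely many weighted derivatives. -/
theorem exists_factor (u : 𝓢'(Euc d, ℂ)) : ∃ (s : Finset (ℕ × ℕ))
    (v : ((m : s) → BddForms d m.1.2) →L[ℂ] ℂ),
    ∀ φ, v (fun m => ofSchwartz m.1.1 m.1.2 φ) = u φ := by
  obtain ⟨s, C, hC, h⟩ := exists_bound_seminorm u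
  let W : 𝓢(Euc d, ℂ) →ₗ[ℂ] ((m : s) → BddForms d m.1.2) :=
    LinearMap.pi fun m => ofSchwartz m.1.1 m.1.2
  have hle : ∀ φ, ‖u φ‖ ≤ (C * s.card) * ‖W φ‖ := by
    intro φ
    refine (h φ).trans ?_
    rw [mul_assoc]
    gcongr
    rw [← nsmul_eq_mul]
    refine Finset.sum_le_card_nsmul _ _ _ fun m hm => ?_
    rw [← norm_ofSchwartz]
    exact norm_le_pi_norm (W φ) ⟨m, hm⟩
  -- The seminorm bound lets `u` descend to the range of `W`, where it is bounded for the Banach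
  -- norm; Hahn–Banach then extends it to the whole product.
  have hker : LinearMap.ker W ≤ LinearMap.ker (u : 𝓢(Euc d, ℂ) →ₗ[ℂ] ℂ) := by
    intro φ hφ
    rw [LinearMap.mem_ker] at hφ ⊢
    have := hle φ
    rw [hφ, norm_zero, mul_zero] at this
    exact norm_le_zero_iff.mp this
  let f : LinearMap.range W →ₗ[ℂ] ℂ :=
    (LinearMap.ker W).liftQ (u : 𝓢(Euc d, ℂ) →ₗ[ℂ] ℂ) hker ∘ₗ W.quotKerEquivRange.symm.toLinearMap
  have hf : ∀ φ, f ⟨W φ, LinearMap.mem_range_self W φ⟩ = u φ := by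
    intro φ
    have : W.quotKerEquivRange.symm ⟨W φ, LinearMap.mem_range_self W φ⟩
        = (LinearMap.ker W).mkQ φ := by
      rw [LinearEquiv.symm_apply_eq]
      rfl
    simp only [f, LinearMap.comp_apply, LinearEquiv.coe_coe, this]
    rfl
  obtain ⟨v, hv, _⟩ := exists_extension_norm_eq (LinearMap.range W)
    (f.mkContinuous (C * s.card) (by
      rintro ⟨_, φ, rfl⟩
      rw [hf]
      exact hle φ))
  refine ⟨s, v, fun φ => ?_⟩
  rw [← hf φ]
  exact hv ⟨W φ, LinearMap.mem_range_self W φ⟩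

/-- The seminorms of a family of Schwartz functions have integrable bounds. -/
def IntegrableSeminorms (F : Euc d → 𝓢(Euc d, ℂ)) : Prop :=
  ∀ k n, ∃ b : Euc d → ℝ, Integrable b ∧ ∀ y, SchwartzMap.seminorm ℂ k n (F y) ≤ b y

theorem IntegrableSeminorms.map {F : Euc d → 𝓢(Euc d, ℂ)} (h : IntegrableSeminorms F)
    (A : 𝓢(Euc d, ℂ) →L[ℂ] 𝓢(Euc d, ℂ)) : IntegrableSeminorms fun y => A (F y) := by
  intro k n
  obtain ⟨s, C, hC, hA⟩ := exists_bound_seminorm_clm A k n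
  choose b hb hb' using h
  refine ⟨fun y => C * ∑ m ∈ s, b m.1 m.2 y, ?_, fun y => (hA _).trans ?_⟩
  · exact (integrable_finsetSum s fun m _ => hb m.1 m.2).const_mul C
  · exact mul_le_mul_of_nonneg_left (Finset.sum_le_sum fun m _ => hb' m.1 m.2 y) hC

/-- Differentiation under the integral sign, one direction at a time. The last direction is absorbed
into `F` and `G`, since continuity and integrable seminorm bounds are stable under `∂_v`. -/
theorem iteratedLineDeriv_integral {n : ℕ} (m : Fin n → Euc d) (F : Euc d → 𝓢(Euc d, ℂ))
    (hF : Continuous F) (hb : IntegrableSeminorms F) (G : 𝓢(Euc d, ℂ))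
    (hG : ∀ z, G z = ∫ y, F y z) (z : Euc d) : (∂^{m} G) z = ∫ y, (∂^{m} (F y)) z := by
  induction n generalizing F G with
  | zero => simpa using hG z
  | succ n ih =>
    have hA : Continuous fun y => ∂_{m (Fin.last n)} (F y) :=
      (lineDerivOpCLM ℂ 𝓢(Euc d, ℂ) (m (Fin.last n))).continuous.comp hF
    have hA' : IntegrableSeminorms fun y => ∂_{m (Fin.last n)} (F y) :=
      hb.map (lineDerivOpCLM ℂ 𝓢(Euc d, ℂ) (m (Fin.last n)))
    simp_rw [iteratedLineDerivOp_succ_right]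
    refine ih (Fin.init m) _ hA hA' _ fun z => ?_
    set v := m (Fin.last n)
    obtain ⟨b, hbi, hb1⟩ := hA' 0 0
    obtain ⟨b0, hb0i, hb0⟩ := hb 0 0
    have hev : ∀ {H : Euc d → 𝓢(Euc d, ℂ)} (_ : Continuous H) (w : Euc d),
        Continuous fun y => H y w := fun hH w =>
      ((BoundedContinuousFunction.evalCLM ℂ w).continuous.comp
        (toBoundedContinuousFunctionCLM ℂ (Euc d) ℂ).continuous).comp hH
    have key := (hasDerivAt_integral_of_dominated_loc_of_deriv_le (𝕜 := ℝ) (μ := volume)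
      (F := fun (t : ℝ) y => F y (z + t • v)) (F' := fun (t : ℝ) y => (∂_{v} (F y)) (z + t • v))
      (x₀ := 0) (s := Set.univ) (bound := b) Filter.univ_mem
      (Eventually.of_forall fun t => (hev hF _).aestronglyMeasurable)
      (hb0i.mono' (hev hF _).aestronglyMeasurable (Eventually.of_forall fun y =>
        (norm_le_seminorm ℂ _ _).trans (hb0 y)))
      (hev hA _).aestronglyMeasurable
      (Eventually.of_forall fun y t _ => (norm_le_seminorm ℂ _ _).trans (hb1 y))
      hbi
      (Eventually.of_forall fun y t _ => by
        rw [lineDerivOp_apply_eq_fderiv]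
        have h1 := (F y).hasFDerivAt (z + t • v)
        have h2 : HasDerivAt (fun t : ℝ => z + t • v) v t := by
          simpa using ((hasDerivAt_id t).smul_const v).const_add z
        exact h1.comp_hasDerivAt t h2)).2
    simp_rw [← hG] at key
    have h1 := G.hasFDerivAt (z + (0 : ℝ) • v)
    have h2 : HasDerivAt (fun t : ℝ => z + t • v) v 0 := by
      simpa using ((hasDerivAt_id (0 : ℝ)).smul_const v).const_add z
    have := (h1.comp_hasDerivAt 0 h2).unique key
    simp only [zero_smul, add_zero] at this
    rw [lineDerivOp_apply_eq_fderiv]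
    exact this

/-- Tempered distributions commute with integrals of Schwartz functions. -/
theorem pairing_integral (u : 𝓢'(Euc d, ℂ)) (F : Euc d → 𝓢(Euc d, ℂ))
    (hF : Continuous F) (hb : IntegrableSeminorms F) (G : 𝓢(Euc d, ℂ))
    (hG : ∀ z, G z = ∫ y, F y z) :
    Integrable (fun y => u (F y)) ∧ ∫ y, u (F y) = u G := by
  obtain ⟨s, v, hv⟩ := exists_factor u
  let W : 𝓢(Euc d, ℂ) →ₗ[ℂ] ((m : s) → BddForms d m.1.2) :=
    LinearMap.pi fun m => ofSchwartz m.1.1 m.1.2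
  have hv' : ∀ φ, v (W φ) = u φ := hv
  -- The Bochner integral is taken in a finite product of Banach spaces, because the Schwartz space
  -- itself carries no norm.
  have hWc : Continuous fun y => W (F y) := by
    refine continuous_pi fun m => ?_
    rw [continuous_iff_continuousAt]
    intro y₀
    rw [ContinuousAt, tendsto_iff_norm_sub_tendsto_zero]
    have h1 : ∀ y, ‖W (F y) m - W (F y₀) m‖ = SchwartzMap.seminorm ℂ m.1.1 m.1.2 (F y - F y₀) := by
      intro y
      rw [← norm_ofSchwartz, map_sub]
      rfl
    simp_rw [h1]
    have h2 : Continuous fun y => SchwartzMap.seminorm ℂ m.1.1 m.1.2 (F y - F y₀) :=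
      ((schwartz_withSeminorms ℂ (Euc d) ℂ).continuous_seminorm m.1).comp (hF.sub continuous_const)
    simpa using h2.tendsto y₀
  have hWi : Integrable fun y => W (F y) := by
    choose b hbi hb' using hb
    have h0 : ∀ (m : s) y, 0 ≤ b m.1.1 m.1.2 y := fun m y => (apply_nonneg _ _).trans (hb' _ _ y)
    have hs : Integrable fun y => ∑ m : s, b m.1.1 m.1.2 y :=
      integrable_finsetSum _ fun m _ => hbi m.1.1 m.1.2
    refine hs.mono' hWc.aestronglyMeasurable (Eventually.of_forall fun y => ?_)
    refine (pi_norm_le_iff_of_nonneg (Finset.sum_nonneg fun m _ => h0 m y)).2 fun m => ?_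
    refine le_trans ?_ (Finset.single_le_sum (f := fun m : s => b m.1.1 m.1.2 y)
      (fun m _ => h0 m y) (Finset.mem_univ m))
    refine le_trans (le_of_eq ?_) (hb' m.1.1 m.1.2 y)
    exact norm_ofSchwartz _ _ _
  -- Point evaluations separate the elements of the product and commute with the Bochner integral,
  -- so this reduces to differentiating `G` under the integral.
  have hWG : ∫ y, W (F y) = W G := by
    refine funext fun m => BddForms.ext fun z n => ?_
    let e : ((m : s) → BddForms d m.1.2) →L[ℂ] ℂ :=
      BddForms.eval m.1.2 z n ∘L ContinuousLinearMap.proj m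
    have e1 : ∫ y, e (W (F y)) = e (∫ y, W (F y)) := e.integral_comp_comm hWi
    have e3 : ∀ φ : 𝓢(Euc d, ℂ), e (W φ) = ‖z‖ ^ m.1.1 • (∂^{n} φ) z :=
      fun φ => eval_ofSchwartz _ _ φ z n
    change e (∫ y, W (F y)) = e (W G)
    rw [← e1, e3]
    simp_rw [e3]
    rw [integral_smul, iteratedLineDeriv_integral n F hF hb G hG]
  constructor
  · simpa only [hv'] using v.integrable_comp hWi
  · simp_rw [← hv']
    rw [v.integral_comp_comm hWi, hWG]

end SchwartzMap

end

section

open Filter Topology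

/-! ### Pairings with translates -/

theorem integrable_one_add_norm_euc {d : ℕ} {r : ℝ} (hr : (d : ℝ) < r) :
    Integrable fun x : Euc d => (1 + ‖x‖) ^ (-r) :=
  integrable_one_add_norm (by simpa using hr)

/-- Rapid decay of a function. -/
def RapidDecay {d : ℕ} (c : Euc d → ℂ) : Prop :=
  ∀ N : ℝ, ∃ C, 0 ≤ C ∧ ∀ y, ‖c y‖ ≤ C * (1 + ‖y‖) ^ (-N)

theorem SchwartzMap.rapidDecay {d : ℕ} (φ : 𝓢(Euc d, ℂ)) : RapidDecay φ :=
  fun N => SchwartzMap.decay_rpow_zero φ N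

theorem RapidDecay.exists_integrable {d : ℕ} {c : Euc d → ℂ} (hc : RapidDecay c) (M : ℝ) :
    ∃ b : Euc d → ℝ, Integrable b ∧ ∀ y, ‖c y‖ * (1 + ‖y‖) ^ M ≤ b y := by
  obtain ⟨C, _, h⟩ := hc (M + (d + 1))
  refine ⟨fun y => C * (1 + ‖y‖) ^ (-((d : ℝ) + 1)),
    (integrable_one_add_norm_euc (by linarith)).const_mul C, fun y => ?_⟩
  have h0 : 0 < 1 + ‖y‖ := by positivity
  calc ‖c y‖ * (1 + ‖y‖) ^ M ≤ C * (1 + ‖y‖) ^ (-(M + (d + 1))) * (1 + ‖y‖) ^ M := by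
        gcongr; exact h y
    _ = _ := by rw [mul_assoc, ← Real.rpow_add h0]; congr 2; ring

theorem RapidDecay.integrable_mul {d : ℕ} {c : Euc d → ℂ} (hc : RapidDecay c)
    (hm : Continuous c) (M : ℝ) : Integrable fun y => ‖c y‖ * (1 + ‖y‖) ^ M := by
  obtain ⟨b, hb, h⟩ := hc.exists_integrable M
  refine hb.mono' (Continuous.aestronglyMeasurable ?_) (Eventually.of_forall fun y => ?_)
  · refine hm.norm.mul (Continuous.rpow_const (by fun_prop) fun y => Or.inl ?_)
    positivity
  · rw [Real.norm_of_nonneg (by positivity)]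
    exact h y

namespace SchwartzMap

variable {d : ℕ}

theorem continuous_smul_shift {c : Euc d → ℂ} (hc : Continuous c) (V : 𝓢(Euc d, ℂ)) :
    Continuous fun y => c y • V.compSubConstCLM ℂ y :=
  hc.smul (continuous_shift V)

theorem integrableSeminorms_smul_shift {c : Euc d → ℂ} (hc : RapidDecay c) (V : 𝓢(Euc d, ℂ)) :
    IntegrableSeminorms fun y => c y • V.compSubConstCLM ℂ y := by
  intro k n
  obtain ⟨C, hC, h⟩ := seminorm_shift_le V k n
  obtain ⟨b, hb, hb'⟩ := hc.exists_integrable k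
  refine ⟨fun y => C * b y, hb.const_mul C, fun y => ?_⟩
  rw [map_smul_eq_mul]
  calc ‖c y‖ * SchwartzMap.seminorm ℂ k n (V.compSubConstCLM ℂ y)
      ≤ ‖c y‖ * (C * (1 + ‖y‖) ^ k) := by gcongr; exact h y
    _ = C * (‖c y‖ * (1 + ‖y‖) ^ (k : ℝ)) := by rw [Real.rpow_natCast]; ring
    _ ≤ C * b y := by gcongr; exact hb' y

/-- A tempered distribution composed with a continuous linear map on Schwartz functions. -/
def compDist (u : 𝓢'(Euc d, ℂ)) (A : 𝓢(Euc d, ℂ) →L[ℂ] 𝓢(Euc d, ℂ)) : 𝓢'(Euc d, ℂ) :=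
  PointwiseConvergenceCLM.precomp ℂ A u

theorem compDist_apply (u : 𝓢'(Euc d, ℂ)) (A : 𝓢(Euc d, ℂ) →L[ℂ] 𝓢(Euc d, ℂ))
    (φ : 𝓢(Euc d, ℂ)) : compDist u A φ = u (A φ) := rfl

/-- Seminorms of translates grow only polynomially, so rapid decay of `c` makes the superposition of
translates integrable in every seminorm. All reproducing formulas for pairings come from this
exchange. -/
theorem pairing_shift (u : 𝓢'(Euc d, ℂ)) {c : Euc d → ℂ} (hc : Continuous c) (hc' : RapidDecay c)
    (V G : 𝓢(Euc d, ℂ)) (hG : ∀ t, G t = ∫ y, c y * V (t - y)) :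
    Integrable (fun y => c y * u (V.compSubConstCLM ℂ y)) ∧
      ∫ y, c y * u (V.compSubConstCLM ℂ y) = u G := by
  simpa using pairing_integral u _ (continuous_smul_shift hc V)
    (integrableSeminorms_smul_shift hc' V) G (by simpa using hG)

theorem norm_pairing_shift_le (u : 𝓢'(Euc d, ℂ)) (V : 𝓢(Euc d, ℂ)) :
    ∃ C M : ℝ, 0 ≤ C ∧ 0 ≤ M ∧ ∀ y, ‖u (V.compSubConstCLM ℂ y)‖ ≤ C * (1 + ‖y‖) ^ M := by
  obtain ⟨s, C, hC, h⟩ := exists_bound_seminorm u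
  choose B hB hB' using fun m : ℕ × ℕ => seminorm_shift_le V m.1 m.2
  let N := s.sup Prod.fst
  refine ⟨C * ∑ m ∈ s, B m, N, by have := Finset.sum_nonneg fun m (_ : m ∈ s) => hB m; positivity,
    by positivity, fun y => (h _).trans ?_⟩
  rw [mul_assoc, Finset.sum_mul]
  gcongr with m hm
  refine (hB' m y).trans ?_
  have := hB m
  gcongr
  rw [Real.rpow_natCast]
  exact pow_le_pow_right₀ (by linarith [norm_nonneg y]) (Finset.le_sup (f := Prod.fst) hm)

theorem continuous_pairing_shift (u : 𝓢'(Euc d, ℂ)) (V : 𝓢(Euc d, ℂ)) :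
    Continuous fun y => u (V.compSubConstCLM ℂ y) :=
  u.continuous.comp (continuous_shift V)

theorem rescale_eq_shift (φ : 𝓢(Euc d, ℂ)) (x : Euc d) {lam : ℝ} (h : 0 < lam) :
    rescale φ x lam = (rescale φ 0 lam).compSubConstCLM ℂ x := by
  ext y
  simp [rescale_apply _ _ h]

/-- `rescale` as a continuous linear map. -/
def rescaleCLM (x : Euc d) (lam : ℝ) : 𝓢(Euc d, ℂ) →L[ℂ] 𝓢(Euc d, ℂ) :=
  if h : lam⁻¹ ≠ 0 then
    (((lam ^ d)⁻¹ : ℝ) : ℂ) • (compSubConstCLM ℂ x ∘L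
      SchwartzMap.compCLMOfContinuousLinearEquiv ℂ
        (ContinuousLinearEquiv.smulLeft (Units.mk0 lam⁻¹ h) : Euc d ≃L[ℝ] Euc d))
  else 0

theorem rescaleCLM_apply (φ : 𝓢(Euc d, ℂ)) (x : Euc d) {lam : ℝ} (h : 0 < lam) :
    rescaleCLM x lam φ = rescale φ x lam := by
  have h' : lam⁻¹ ≠ 0 := by positivity
  simp only [rescaleCLM, rescale, dilate, dif_pos h']
  rfl

theorem rescale_shift (φ : 𝓢(Euc d, ℂ)) (x w : Euc d) {lam : ℝ} (h : 0 < lam) :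
    rescale (φ.compSubConstCLM ℂ w) x lam = rescale φ (x + lam • w) lam := by
  ext y
  rw [rescale_apply _ _ h, rescale_apply _ _ h, compSubConstCLM_apply]
  congr 2
  rw [← sub_sub, smul_sub lam⁻¹ (y - x), smul_smul, inv_mul_cancel₀ h.ne', one_smul]

theorem integral_rescale_mul (η : 𝓢(Euc d, ℂ)) (x : Euc d) {lam : ℝ} (h : 0 < lam)
    (g : Euc d → ℂ) : ∫ y, rescale η x lam y * g y = ∫ w, η w * g (x + lam • w) := by
  have e1 : ∫ w, η w * g (x + lam • w)
      = ∫ w, (fun z => η (lam⁻¹ • z) * g (x + z)) (lam • w) := by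
    congr 1; ext w; simp [smul_smul, inv_mul_cancel₀ h.ne']
  rw [e1, Measure.integral_comp_smul volume (fun z => η (lam⁻¹ • z) * g (x + z)), finrank_euclideanSpace_fin, abs_of_pos (by positivity),
    ← integral_add_left_eq_self (fun z => rescale η x lam z * g z) x, ← integral_smul]
  congr 1
  ext w
  rw [rescale_apply _ _ h, add_sub_cancel_left, Complex.real_smul, mul_assoc]

theorem integral_mul_rescale (η : 𝓢(Euc d, ℂ)) (x : Euc d) {lam : ℝ} (h : 0 < lam)
    (g : Euc d → ℂ) : ∫ y, g y * rescale η x lam y = ∫ w, g (x + lam • w) * η w := by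
  simpa only [mul_comm] using integral_rescale_mul η x h g

/-- The convolution of two Schwartz functions. -/
def conv (f g : 𝓢(Euc d, ℂ)) : 𝓢(Euc d, ℂ) :=
  SchwartzMap.convolution (ContinuousLinearMap.mul ℂ ℂ) f g

theorem conv_apply (f g : 𝓢(Euc d, ℂ)) (x : Euc d) : conv f g x = ∫ y, f y * g (x - y) := by
  rw [conv, convolution_apply]
  rfl

theorem conv_comm (f g : 𝓢(Euc d, ℂ)) : conv f g = conv g f := by
  rw [conv, conv, ← convolution_flip, ContinuousLinearMap.flip_mul]

theorem fourier_conv (f g : 𝓢(Euc d, ℂ)) (ξ : Euc d) :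
    𝓕 (conv f g) ξ = 𝓕 f ξ * 𝓕 g ξ := by
  rw [conv, fourier_convolution, pairing_apply_apply]
  rfl

theorem integral_pairing_shift (u : 𝓢'(Euc d, ℂ)) (V ψ : 𝓢(Euc d, ℂ)) :
    Integrable (fun y => ψ y * u (V.compSubConstCLM ℂ y)) ∧
    ∫ y, ψ y * u (V.compSubConstCLM ℂ y) = u (conv ψ V) :=
  pairing_shift u ψ.continuous ψ.rapidDecay V _ (conv_apply ψ V)

/-- Rescalings of a function of integral one are an approximate identity. -/
theorem tendsto_integral_rescale (u : 𝓢'(Euc d, ℂ)) (η ψ : 𝓢(Euc d, ℂ)) (hη : ∫ y, η y = 1) :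
    Tendsto (fun lam => ∫ y, u (rescale η y lam) * ψ y) (𝓝[>] 0) (𝓝 (u ψ)) := by
  have e : ∀ lam : ℝ, 0 < lam →
      ∫ y, u (rescale η y lam) * ψ y = ∫ h, η h * u (ψ.compSubConstCLM ℂ (lam • h)) := by
    intro lam hl
    have : (fun y => u (rescale η y lam) * ψ y)
        = fun y => ψ y * u ((rescale η 0 lam).compSubConstCLM ℂ y) := by
      funext y
      rw [rescale_eq_shift η y hl, mul_comm]
    -- Both sides are `u` applied to the convolution of `ψ` with the rescaled `η`; commutativity
    -- moves the small scale from the test function to the size of the translations of `ψ`.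
    rw [this, (integral_pairing_shift u _ ψ).2, conv_comm, ← (integral_pairing_shift u ψ _).2,
      integral_rescale_mul η 0 hl]
    simp
  obtain ⟨C, M, hC, hM, hb⟩ := norm_pairing_shift_le u ψ
  obtain ⟨b, hbi, hb'⟩ := η.rapidDecay.exists_integrable M
  have h1 : u ψ = ∫ h, η h * u ψ := by rw [integral_mul_const, hη, one_mul]
  rw [h1]
  have h2 : Tendsto (fun lam : ℝ => ∫ h, η h * u (ψ.compSubConstCLM ℂ (lam • h))) (𝓝[>] 0)
      (𝓝 (∫ h, η h * u ψ)) := by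
    refine tendsto_integral_filter_of_dominated_convergence (fun h => C * b h) ?_ ?_
      (hbi.const_mul C) ?_
    · refine Eventually.of_forall fun lam => Continuous.aestronglyMeasurable ?_
      exact η.continuous.mul ((continuous_pairing_shift u ψ).comp (by fun_prop))
    · filter_upwards [Ioc_mem_nhdsGT (zero_lt_one' ℝ)] with lam hl
      refine Eventually.of_forall fun h => ?_
      rw [norm_mul]
      calc ‖η h‖ * ‖u (ψ.compSubConstCLM ℂ (lam • h))‖
          ≤ ‖η h‖ * (C * (1 + ‖lam • h‖) ^ M) := by gcongr; exact hb _
        _ ≤ ‖η h‖ * (C * (1 + ‖h‖) ^ M) := by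
          gcongr
          rw [norm_smul, Real.norm_of_nonneg hl.1.le]
          exact mul_le_of_le_one_left (norm_nonneg _) hl.2
        _ = C * (‖η h‖ * (1 + ‖h‖) ^ M) := by ring
        _ ≤ C * b h := by gcongr; exact hb' h
    · refine Eventually.of_forall fun h => tendsto_nhdsWithin_of_tendsto_nhds ?_
      have : Continuous fun lam : ℝ => η h * u (ψ.compSubConstCLM ℂ (lam • h)) :=
        continuous_const.mul ((continuous_pairing_shift u ψ).comp (by fun_prop))
      simpa using this.tendsto 0
  refine h2.congr' ?_
  filter_upwards [self_mem_nhdsWithin] with lam hl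
  exact (e lam hl).symm

end SchwartzMap

end

section

open Filter Topology LineDeriv

/-! ### Functions with spectrum in an annulus -/

namespace SchwartzMap

variable {d : ℕ}

/-- The Fourier transform has compact support away from the origin. -/
def IsAnnular (H : 𝓢(Euc d, ℂ)) : Prop :=
  HasCompactSupport (𝓕 H : 𝓢(Euc d, ℂ)) ∧ (0 : Euc d) ∉ tsupport (𝓕 H : 𝓢(Euc d, ℂ))

/-- The multiplier may be singular at the origin, because `f` vanishes in a neighbourhood of it. -/
theorem exists_schwartz_mul {f : 𝓢(Euc d, ℂ)} (hc : HasCompactSupport f)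
    (h0 : (0 : Euc d) ∉ tsupport f) {m : Euc d → ℂ} (hm : ∀ ξ, ξ ≠ 0 → ContDiffAt ℝ ∞ m ξ) :
    ∃ g : 𝓢(Euc d, ℂ), (∀ ξ, g ξ = m ξ * f ξ) ∧ HasCompactSupport g ∧ (0 : Euc d) ∉ tsupport g := by
  have hs : ContDiff ℝ ∞ fun ξ => m ξ * f ξ := by
    rw [contDiff_iff_contDiffAt]
    intro ξ
    by_cases hξ : ξ = 0
    · subst hξ
      have : (fun ξ => m ξ * f ξ) =ᶠ[𝓝 0] fun _ => 0 := by
        filter_upwards [notMem_tsupport_iff_eventuallyEq.mp h0] with ξ hξ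
        simp [hξ]
      exact contDiffAt_const.congr_of_eventuallyEq this
    · exact (hm ξ hξ).mul (f.smooth ⊤).contDiffAt
  have hc' : HasCompactSupport fun ξ => m ξ * f ξ := hc.mul_left
  refine ⟨hc'.toSchwartzMap hs, fun ξ => rfl, hc', fun h => h0 ?_⟩
  exact tsupport_mul_subset_right h

/-- On the Fourier side this is `1 = ∑ ξ_k² / |ξ|²` away from the origin: one factor `ξ_k` is the
derivative, and the other, divided by `|ξ|²`, is a smooth multiplier on the annulus. The `K k` are
again annular, so the step can be iterated. -/
theorem IsAnnular.exists_eq_sum_lineDeriv {H : 𝓢(Euc d, ℂ)} (hH : IsAnnular H) :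
    ∃ K : Fin d → 𝓢(Euc d, ℂ), (∀ k, IsAnnular (K k)) ∧
      H = ∑ k, ∂_{EuclideanSpace.basisFun (Fin d) ℝ k} (K k) := by
  set e := EuclideanSpace.basisFun (Fin d) ℝ
  choose g hg hgc hg0 using fun k : Fin d => exists_schwartz_mul hH.1 hH.2
    (m := fun ξ => (2 * Real.pi * Complex.I)⁻¹ * (((inner ℝ ξ (e k)) / ‖ξ‖ ^ 2 : ℝ) : ℂ))
    (fun ξ hξ => by
      refine contDiffAt_const.mul (Complex.ofRealCLM.contDiff.contDiffAt.comp ξ ?_)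
      exact (contDiffAt_id.inner ℝ contDiffAt_const).div (contDiffAt_id.norm_sq ℝ)
        (by simpa using hξ))
  refine ⟨fun k => 𝓕⁻ (g k), fun k => ⟨by simpa using hgc k, by simpa using hg0 k⟩, ?_⟩
  apply (FourierTransform.fourierEquiv ℂ 𝓢(Euc d, ℂ)).injective
  rw [map_sum]
  simp only [FourierTransform.fourierEquiv_apply, fourier_lineDerivOp_eq,
    FourierTransform.fourier_fourierInv_eq]
  ext ξ
  rw [sum_apply]
  have h2 : (2 * Real.pi * Complex.I) ≠ 0 := by simp [Real.pi_ne_zero]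
  have : ∀ k, ((2 * Real.pi * Complex.I) •
      (smulLeftCLM ℂ fun x => (inner ℝ x (e k) : ℝ)) (g k)) ξ
      = (((inner ℝ ξ (e k)) ^ 2 / ‖ξ‖ ^ 2 : ℝ) : ℂ) * (𝓕 H : 𝓢(Euc d, ℂ)) ξ := by
    intro k
    rw [smul_apply, smulLeftCLM_apply_apply (by fun_prop), hg]
    simp only [smul_eq_mul, Complex.real_smul]
    push_cast
    field_simp
  simp_rw [this]
  rw [← Finset.sum_mul, ← Complex.ofReal_sum, ← Finset.sum_div]
  by_cases hξ : ξ = 0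
  · subst hξ
    rw [image_eq_zero_of_notMem_tsupport hH.2, mul_zero]
  · have h3 := e.sum_sq_inner_left ξ
    rw [h3, div_self (by simpa using hξ)]
    simp

theorem norm_iteratedFDeriv_lineDeriv_sub_le (φ : 𝓢(Euc d, ℂ)) (n : ℕ) (v x y : Euc d) :
    ‖iteratedFDeriv ℝ n (∂_{v} φ : 𝓢(Euc d, ℂ)) x - iteratedFDeriv ℝ n (∂_{v} φ : 𝓢(Euc d, ℂ)) y‖
      ≤ ‖iteratedFDeriv ℝ (n + 1) φ x - iteratedFDeriv ℝ (n + 1) φ y‖ * ‖v‖ := by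
  have e : ∀ z (m : Fin n → Euc d), iteratedFDeriv ℝ n (∂_{v} φ : 𝓢(Euc d, ℂ)) z m
      = iteratedFDeriv ℝ (n + 1) φ z (Fin.snoc m v : Fin (n + 1) → Euc d) := by
    intro z m
    rw [← iteratedLineDerivOp_eq_iteratedFDeriv, ← iteratedLineDerivOp_eq_iteratedFDeriv,
      iteratedLineDerivOp_succ_right]
    simp
  refine ContinuousMultilinearMap.opNorm_le_bound (by positivity) fun m => ?_
  rw [sub_apply, e, e, ← sub_apply]
  refine (ContinuousMultilinearMap.le_opNorm _ _).trans (le_of_eq ?_)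
  rw [Fin.prod_univ_castSucc]
  simp
  ring

theorem integrable_weight_mul_diff (φ : 𝓢(Euc d, ℂ)) (n : ℕ) {N : ℝ} (hN : (d : ℝ) < N)
    (x : Euc d) : Integrable fun x' : Euc d => (1 + ‖x' - x‖) ^ (-N) *
      ‖iteratedFDeriv ℝ n φ x' - iteratedFDeriv ℝ n φ x‖ := by
  have hi := ((integrable_one_add_norm_euc hN).comp_sub_right x).mul_const
    (2 * SchwartzMap.seminorm ℝ 0 n φ)
  refine hi.mono' (Continuous.aestronglyMeasurable ?_) (Eventually.of_forall fun y => ?_)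
  · refine Continuous.mul (Continuous.rpow_const (by fun_prop) fun y => Or.inl (by positivity)) ?_
    exact (((φ.smooth n).continuous_iteratedFDeriv le_rfl).sub continuous_const).norm
  · rw [Real.norm_of_nonneg (by positivity)]
    gcongr
    refine (norm_sub_le _ _).trans ?_
    have h1 := norm_iteratedFDeriv_le_seminorm ℝ φ n y
    have h2 := norm_iteratedFDeriv_le_seminorm ℝ φ n x
    linarith

theorem IsAnnular.integral_eq_zero {H : 𝓢(Euc d, ℂ)} (hH : IsAnnular H) : ∫ x, H x = 0 := by
  have h1 : (𝓕 H : 𝓢(Euc d, ℂ)) 0 = 0 := image_eq_zero_of_notMem_tsupport hH.2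
  rw [fourier_coe, Real.fourier_eq'] at h1
  simpa using h1

/-- Induction on `n`: each step writes `H` as a sum of derivatives and integrates by parts. At `n =
0` the vanishing integral of `H` allows the subtraction of `φ x`. Keeping the increment of `D^n φ`,
rather than its size, is what later captures fractional regularity. -/
theorem IsAnnular.norm_integral_shift_le (n : ℕ) {N : ℝ} (hN : (d : ℝ) < N) :
    ∀ {H : 𝓢(Euc d, ℂ)}, IsAnnular H → ∃ C, 0 ≤ C ∧ ∀ (φ : 𝓢(Euc d, ℂ)) (x : Euc d),
      ‖∫ x', H (x' - x) * φ x'‖ ≤ C * ∫ x', (1 + ‖x' - x‖) ^ (-N) *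
        ‖iteratedFDeriv ℝ n φ x' - iteratedFDeriv ℝ n φ x‖ := by
  induction n with
  | zero =>
    intro H hH
    obtain ⟨C, hC, h⟩ := decay_rpow_zero H N
    refine ⟨C, hC, fun φ x => ?_⟩
    have e0 : ∫ x', H (x' - x) * φ x = 0 := by
      rw [integral_mul_const, integral_sub_right_eq_self (fun z => H z) x, hH.integral_eq_zero,
        zero_mul]
    have hi1 : Integrable fun x' => H (x' - x) * φ x := (H.integrable.comp_sub_right x).mul_const _
    have hi2 : Integrable fun x' => H (x' - x) * φ x' := by
      refine (H.integrable.comp_sub_right x).mul_bdd (c := SchwartzMap.seminorm ℝ 0 0 φ)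
        φ.continuous.aestronglyMeasurable (Eventually.of_forall fun y => norm_le_seminorm ℝ φ y)
    rw [← sub_zero (∫ x', H (x' - x) * φ x'), ← e0, ← integral_sub hi2 hi1, ← integral_const_mul]
    refine norm_integral_le_of_norm_le ((integrable_weight_mul_diff φ 0 hN x).const_mul C)
      (Eventually.of_forall fun y => ?_)
    rw [← mul_sub, norm_mul, ← mul_assoc]
    gcongr
    · exact h _
    · apply le_of_eq
      rw [iteratedFDeriv_zero_eq_comp]
      simp only [Function.comp_apply]
      rw [← (continuousMultilinearCurryFin0 ℝ (Euc d) ℂ).symm.map_sub, LinearIsometryEquiv.norm_map]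
  | succ n ih =>
    intro H hH
    obtain ⟨K, hK, hsum⟩ := hH.exists_eq_sum_lineDeriv
    choose C hC h using fun k => ih (hK k)
    refine ⟨∑ k, C k, Finset.sum_nonneg fun k _ => hC k, fun φ x => ?_⟩
    set e := EuclideanSpace.basisFun (Fin d) ℝ
    have e1 : ∀ k, ∫ x', (∂_{e k} (K k)) (x' - x) * φ x'
        = - ∫ x', K k (x' - x) * (∂_{e k} φ) x' := by
      intro k
      have := integral_mul_lineDerivOp_right_eq_neg_left (μ := volume)
        ((K k).compSubConstCLM ℂ x) φ (e k)
      simp only [compSubConstCLM_apply] at this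
      rw [this, neg_neg]
      congr 1; ext y
      congr 1
      rw [lineDerivOp_apply_eq_fderiv, lineDerivOp_apply_eq_fderiv]
      have : ((K k).compSubConstCLM ℂ x : Euc d → ℂ) = fun z => K k (z - x) := by ext; simp
      rw [this, fderiv_comp_sub]
    have e2 : ∫ x', H (x' - x) * φ x' = ∑ k, ∫ x', (∂_{e k} (K k)) (x' - x) * φ x' := by
      rw [← integral_finsetSum]
      · congr 1; ext y
        conv_lhs => rw [hsum]
        rw [sum_apply, Finset.sum_mul]
      · intro k _
        refine ((∂_{e k} (K k)).integrable.comp_sub_right x).mul_bdd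
          (c := SchwartzMap.seminorm ℝ 0 0 φ)
          φ.continuous.aestronglyMeasurable (Eventually.of_forall fun y => norm_le_seminorm ℝ φ y)
    rw [e2, Finset.sum_mul]
    refine norm_sum_le_of_le _ fun k _ => ?_
    rw [e1, norm_neg]
    refine (h k (∂_{e k} φ) x).trans ?_
    refine mul_le_mul_of_nonneg_left ?_ (hC k)
    refine integral_mono (integrable_weight_mul_diff _ n hN x)
      (integrable_weight_mul_diff _ (n + 1) hN x) fun y => ?_
    dsimp only
    gcongr
    refine (norm_iteratedFDeriv_lineDeriv_sub_le φ n (e k) y x).trans (le_of_eq ?_)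
    rw [e.norm_eq_one, mul_one]

end SchwartzMap

end

section

open Filter Topology

theorem integrable_weight_shift {d : ℕ} {N : ℝ} (hN : (d : ℝ) < N) (w : Euc d) :
    Integrable fun x : Euc d => (1 + ‖w - x‖) ^ (-N) := by
  simpa only [norm_sub_rev] using (integrable_one_add_norm_euc hN).comp_sub_right w

theorem continuous_weight {d : ℕ} (N : ℝ) : Continuous fun t : Euc d => (1 + ‖t‖) ^ N :=
  Continuous.rpow_const (by fun_prop) fun y => Or.inl (by positivity)

theorem weight_le_mul {d : ℕ} {M : ℝ} (hM : 0 ≤ M) (x y : Euc d) :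
    (1 + ‖y‖) ^ M ≤ (1 + ‖x‖) ^ M * (1 + ‖y - x‖) ^ M := by
  rw [← Real.mul_rpow (by positivity) (by positivity)]
  exact Real.rpow_le_rpow (by positivity) (SchwartzMap.one_add_norm_le_mul x y) hM

/-- Young's inequality for a weight and an integrable function. -/
theorem integrable_weight_convolution {d : ℕ} {N : ℝ} (hN : (d : ℝ) < N) {h : Euc d → ℝ}
    (hh : Integrable h) :
    Integrable (fun w : Euc d => ∫ x, (1 + ‖w - x‖) ^ (-N) * (h x + h w)) ∧
    ∫ w : Euc d, ∫ x, (1 + ‖w - x‖) ^ (-N) * (h x + h w)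
      = 2 * (∫ t : Euc d, (1 + ‖t‖) ^ (-N)) * ∫ x, h x := by
  have hk := integrable_one_add_norm_euc (d := d) hN
  have e : ∀ w : Euc d, ∫ x, (1 + ‖w - x‖) ^ (-N) * (h x + h w)
      = convolution h (fun t => (1 + ‖t‖) ^ (-N)) (ContinuousLinearMap.mul ℝ ℝ) volume w
        + (∫ t : Euc d, (1 + ‖t‖) ^ (-N)) * h w := by
    intro w
    simp_rw [mul_add]
    rw [integral_add, integral_mul_const, convolution_def]
    · congr 1
      · congr 1; ext x; simp [mul_comm]
      · congr 1
        exact integral_sub_left_eq_self (fun t : Euc d => (1 + ‖t‖) ^ (-N)) volume w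
    · refine Integrable.bdd_mul (c := 1) hh
        (Continuous.aestronglyMeasurable ((continuous_weight _).comp (by fun_prop)))
        (Eventually.of_forall fun x => ?_)
      rw [Real.norm_of_nonneg (by positivity)]
      exact Real.rpow_le_one_of_one_le_of_nonpos (by linarith [norm_nonneg (w - x)])
        (by have := Nat.cast_nonneg (α := ℝ) d; linarith)
    · exact (integrable_weight_shift hN w).mul_const _
  simp_rw [e]
  have h1 := hh.integrable_convolution (ContinuousLinearMap.mul ℝ ℝ) hk
  refine ⟨h1.add (hh.const_mul _), ?_⟩
  rw [integral_add h1 (hh.const_mul _), integral_convolution _ hh hk, integral_const_mul]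
  simp
  ring

/-- The polynomial growth of `g` at `p.2` is split between `p.1` and `p.1 - p.2`, where the decay of
`φ` and of `H` absorbs it; the majorant is a product after a change of variables. -/
theorem integral_integral_swap_growth {d : ℕ} (H φ : 𝓢(Euc d, ℂ)) {g : Euc d → ℂ}
    (hg : StronglyMeasurable g) {B M : ℝ} (hM : 0 ≤ M)
    (hb : ∀ w, ‖g w‖ ≤ B * (1 + ‖w‖) ^ M) :
    Integrable (fun p : Euc d × Euc d => H (p.1 - p.2) * g p.2 * φ p.1) := by
  have hB : 0 ≤ B := by
    have := (norm_nonneg _).trans (hb 0)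
    simpa using this
  have i1 := φ.rapidDecay.integrable_mul φ.continuous M
  have i2 := H.rapidDecay.integrable_mul H.continuous M
  have i3 : Integrable fun p : Euc d × Euc d =>
      (‖φ p.1‖ * (1 + ‖p.1‖) ^ M) * (‖H (p.1 - p.2)‖ * (1 + ‖p.1 - p.2‖) ^ M) := by
    have := (i1.convolution_integrand (ContinuousLinearMap.mul ℝ ℝ) i2.comp_neg).swap
    refine this.congr (Eventually.of_forall fun p => ?_)
    simp [norm_sub_rev]
  refine (i3.const_mul B).mono' ?_ (Eventually.of_forall fun p => ?_)
  · refine AEStronglyMeasurable.mul (AEStronglyMeasurable.mul ?_ ?_) ?_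
    · exact Continuous.aestronglyMeasurable (by fun_prop)
    · exact (hg.comp_measurable measurable_snd).aestronglyMeasurable
    · exact Continuous.aestronglyMeasurable (by fun_prop)
  · rw [norm_mul, norm_mul]
    calc ‖H (p.1 - p.2)‖ * ‖g p.2‖ * ‖φ p.1‖
        ≤ ‖H (p.1 - p.2)‖ * (B * ((1 + ‖p.1‖) ^ M * (1 + ‖p.1 - p.2‖) ^ M)) * ‖φ p.1‖ := by
          gcongr
          refine (hb _).trans ?_
          gcongr
          rw [norm_sub_rev p.1]
          exact weight_le_mul hM _ _
      _ = _ := by ring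

namespace SchwartzMap

variable {d : ℕ}

/-- A function which is reproduced by an annular kernel is small against smooth functions. -/
theorem IsAnnular.norm_integral_mul_le {H : 𝓢(Euc d, ℂ)} (hH : IsAnnular H) (n : ℕ) {N N' : ℝ}
    (hN : (d : ℝ) < N) (hN' : (d : ℝ) < N') :
    ∃ C, 0 ≤ C ∧ ∀ (M B : ℝ) (g : Euc d → ℂ) (φ : 𝓢(Euc d, ℂ)) (h : Euc d → ℝ), 0 ≤ M →
      StronglyMeasurable g → (∀ w, ‖g w‖ ≤ B * (1 + ‖w‖) ^ M) →
      (∀ w, g w = ∫ w', H (w - w') * g w') → Integrable h →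
      (∀ x w, (1 + ‖w‖) ^ M * ((1 + ‖x - w‖) ^ (-N) *
        ‖iteratedFDeriv ℝ n φ x - iteratedFDeriv ℝ n φ w‖) ≤
        (1 + ‖w - x‖) ^ (-N') * (h x + h w)) →
      ‖∫ w, g w * φ w‖ ≤ C * B * ∫ x, h x := by
  obtain ⟨C, hC, hb⟩ := hH.norm_integral_shift_le n hN
  refine ⟨C * (2 * ∫ t : Euc d, (1 + ‖t‖) ^ (-N')), by positivity, ?_⟩
  intro M B g φ h hM hgm hg hrep hh hle
  have hB : 0 ≤ B := by
    have := (norm_nonneg _).trans (hg 0)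
    simpa using this
  have hint := integral_integral_swap_growth H φ hgm hM hg
  -- The reproducing formula moves `H` onto `φ`, where its cancellations can be used; `g` then
  -- enters only through its size.
  have e1 : ∫ w, g w * φ w = ∫ w', g w' * ∫ w, H (w - w') * φ w := by
    have : ∫ w, g w * φ w = ∫ w, ∫ w', H (w - w') * g w' * φ w := by
      congr 1; ext w
      rw [integral_mul_const, ← hrep]
    rw [this, integral_integral_swap hint]
    congr 1; ext w'
    rw [← integral_const_mul]
    congr 1; ext w; ring
  obtain ⟨hi, hie⟩ := integrable_weight_convolution hN' hh
  rw [e1]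
  refine (norm_integral_le_of_norm_le (hi.const_mul (C * B)) (Eventually.of_forall fun w => ?_)).trans
    (le_of_eq ?_)
  · rw [norm_mul]
    calc ‖g w‖ * ‖∫ x, H (x - w) * φ x‖
        ≤ (B * (1 + ‖w‖) ^ M) * (C * ∫ x, (1 + ‖x - w‖) ^ (-N) *
          ‖iteratedFDeriv ℝ n φ x - iteratedFDeriv ℝ n φ w‖) := by
          gcongr
          · exact hg w
          · exact hb φ w
      _ = C * B * ∫ x, (1 + ‖w‖) ^ M * ((1 + ‖x - w‖) ^ (-N) *
          ‖iteratedFDeriv ℝ n φ x - iteratedFDeriv ℝ n φ w‖) := by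
          rw [integral_const_mul]; ring
      _ ≤ C * B * ∫ x, (1 + ‖w - x‖) ^ (-N') * (h x + h w) := by
          refine mul_le_mul_of_nonneg_left ?_ (by positivity)
          refine integral_mono ((integrable_weight_mul_diff φ n hN w).const_mul _) ?_
            fun x => hle x w
          simp_rw [mul_add]
          refine Integrable.add ?_ ((integrable_weight_shift hN' w).mul_const _)
          refine Integrable.bdd_mul (c := 1) hh
            (Continuous.aestronglyMeasurable ((continuous_weight _).comp (by fun_prop)))
            (Eventually.of_forall fun x => ?_)
          rw [Real.norm_of_nonneg (by positivity)]
          exact Real.rpow_le_one_of_one_le_of_nonpos (by linarith [norm_nonneg (w - x)])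
            (by have := Nat.cast_nonneg (α := ℝ) d; linarith)
  · rw [integral_const_mul, hie]; ring

theorem IsAnnular.norm_integral_mul_le_deriv {H : 𝓢(Euc d, ℂ)} (hH : IsAnnular H) (n : ℕ) :
    ∃ C, 0 ≤ C ∧ ∀ (B : ℝ) (g : Euc d → ℂ) (φ : 𝓢(Euc d, ℂ)),
      StronglyMeasurable g → (∀ w, ‖g w‖ ≤ B) → (∀ w, g w = ∫ w', H (w - w') * g w') →
      ‖∫ w, g w * φ w‖ ≤ C * B * ∫ x, ‖iteratedFDeriv ℝ n φ x‖ := by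
  have hN : (d : ℝ) < d + 1 := by linarith
  obtain ⟨C, hC, h⟩ := hH.norm_integral_mul_le n hN hN
  refine ⟨C, hC, fun B g φ hgm hg hrep => ?_⟩
  refine h 0 B g φ (fun x => ‖iteratedFDeriv ℝ n φ x‖) le_rfl hgm (by simpa using hg) hrep ?_ ?_
  · simpa using φ.integrable_pow_mul_iteratedFDeriv volume 0 n
  · intro x w
    rw [Real.rpow_zero, one_mul, norm_sub_rev w x]
    gcongr
    exact norm_sub_le _ _

/-- Since `D^n φ` vanishes outside the ball of radius `R`, its increment between `x` and `w` is seen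
only if one of the two points lies in the ball. The indicator of the ball, times `L (2R)^M`, thus
serves as the majorant `h`; its integral produces the power `M + d` of `R`. -/
theorem IsAnnular.norm_integral_mul_le_holder {H : 𝓢(Euc d, ℂ)} (hH : IsAnnular H) (n : ℕ)
    {M θ : ℝ} (hM : 0 ≤ M) (hθ0 : 0 ≤ θ) (hθ1 : θ ≤ 1) :
    ∃ C, 0 ≤ C ∧ ∀ (B L R : ℝ) (g : Euc d → ℂ) (φ : 𝓢(Euc d, ℂ)), 1 ≤ R → 0 ≤ L →
      StronglyMeasurable g → (∀ w, ‖g w‖ ≤ B * (1 + ‖w‖) ^ M) →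
      (∀ w, g w = ∫ w', H (w - w') * g w') →
      tsupport φ ⊆ Metric.closedBall 0 R →
      (∀ x y, ‖iteratedFDeriv ℝ n φ x - iteratedFDeriv ℝ n φ y‖ ≤ L * ‖x - y‖ ^ θ) →
      ‖∫ w, g w * φ w‖ ≤ C * B * L * R ^ (M + d) := by
  have hN' : (d : ℝ) < d + 1 := by linarith
  -- The decay budget: `M` pays for moving the growth weight from `w` to `x`, one unit for the
  -- Hölder factor with `θ ≤ 1`, and `d + 1` remains for integrability.
  have hN : (d : ℝ) < d + 1 + 1 + M := by linarith
  obtain ⟨C, hC, h⟩ := hH.norm_integral_mul_le n hN hN'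
  set v := (volume : Measure (Euc d)).real (Metric.ball 0 1)
  refine ⟨C * 2 ^ M * v, by positivity, fun B L R g φ hR hL hgm hg hrep hsupp hφ => ?_⟩
  have hB : 0 ≤ B := by
    have := (norm_nonneg _).trans (hg 0)
    simpa using this
  have hsupp0 : ∀ x, x ∉ Metric.closedBall (0 : Euc d) R → iteratedFDeriv ℝ n φ x = 0 := by
    intro x hx
    by_contra hne
    exact hx (hsupp (support_iteratedFDeriv_subset n hne))
  have key := h M B g φ (Set.indicator (Metric.closedBall 0 R) fun _ => L * (2 * R) ^ M) hM hgm hg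
    hrep ?_ ?_
  · refine key.trans (le_of_eq ?_)
    rw [integral_indicator Metric.isClosed_closedBall.measurableSet, setIntegral_const,
      Measure.addHaar_real_closedBall _ _ (by linarith), finrank_euclideanSpace_fin, smul_eq_mul,
      Real.mul_rpow (by norm_num) (by linarith), Real.rpow_add (by linarith), Real.rpow_natCast]
    ring
  · rw [integrable_indicator_iff Metric.isClosed_closedBall.measurableSet]
    exact integrableOn_const (isCompact_closedBall _ _).measure_lt_top.ne
  · intro x w
    set I := Set.indicator (Metric.closedBall (0 : Euc d) R) fun _ => L * (2 * R) ^ M with hI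
    have hI0 : ∀ z, 0 ≤ I z := fun z => Set.indicator_nonneg (fun _ _ => by positivity) z
    have ha : 1 ≤ 1 + ‖x - w‖ := by linarith [norm_nonneg (x - w)]
    have ha0 : 0 < 1 + ‖x - w‖ := by linarith
    have hI1 : ∀ z, z ∈ Metric.closedBall (0 : Euc d) R → L * (1 + ‖z‖) ^ M ≤ I z := by
      intro z hz
      rw [hI, Set.indicator_of_mem hz]
      gcongr
      have : ‖z‖ ≤ R := by simpa using hz
      linarith
    have hw : (1 + ‖w‖) ^ M ≤ (1 + ‖x‖) ^ M * (1 + ‖x - w‖) ^ M := by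
      rw [norm_sub_rev]; exact weight_le_mul hM x w
    have hmain : (1 + ‖w‖) ^ M * ‖iteratedFDeriv ℝ n φ x - iteratedFDeriv ℝ n φ w‖
        ≤ (1 + ‖x - w‖) ^ (M + 1) * (I x + I w) := by
      have hθ : ‖x - w‖ ^ θ ≤ 1 + ‖x - w‖ :=
        calc ‖x - w‖ ^ θ ≤ (1 + ‖x - w‖) ^ θ := by gcongr; linarith
          _ ≤ (1 + ‖x - w‖) ^ (1 : ℝ) := Real.rpow_le_rpow_of_exponent_le ha hθ1
          _ = _ := Real.rpow_one _
      have hd : ‖iteratedFDeriv ℝ n φ x - iteratedFDeriv ℝ n φ w‖ ≤ L * (1 + ‖x - w‖) :=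
        (hφ x w).trans (by gcongr)
      have h1M : 1 ≤ (1 + ‖x - w‖) ^ M := Real.one_le_rpow ha hM
      rw [Real.rpow_add ha0, Real.rpow_one]
      by_cases hx : x ∈ Metric.closedBall (0 : Euc d) R
      · calc (1 + ‖w‖) ^ M * ‖iteratedFDeriv ℝ n φ x - iteratedFDeriv ℝ n φ w‖
            ≤ ((1 + ‖x‖) ^ M * (1 + ‖x - w‖) ^ M) * (L * (1 + ‖x - w‖)) := by gcongr
          _ = (1 + ‖x - w‖) ^ M * (1 + ‖x - w‖) * (L * (1 + ‖x‖) ^ M) := by ring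
          _ ≤ (1 + ‖x - w‖) ^ M * (1 + ‖x - w‖) * (I x + I w) := by
            gcongr
            linarith [hI1 x hx, hI0 w]
      · by_cases hw' : w ∈ Metric.closedBall (0 : Euc d) R
        · calc (1 + ‖w‖) ^ M * ‖iteratedFDeriv ℝ n φ x - iteratedFDeriv ℝ n φ w‖
              ≤ (1 + ‖w‖) ^ M * (L * (1 + ‖x - w‖)) := by gcongr
            _ = 1 * (1 + ‖x - w‖) * (L * (1 + ‖w‖) ^ M) := by ring
            _ ≤ (1 + ‖x - w‖) ^ M * (1 + ‖x - w‖) * (I x + I w) := by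
              gcongr
              linarith [hI1 w hw', hI0 x]
        · rw [hsupp0 x hx, hsupp0 w hw', sub_zero, norm_zero, mul_zero]
          have := hI0 x
          have := hI0 w
          positivity
    calc (1 + ‖w‖) ^ M * ((1 + ‖x - w‖) ^ (-((d : ℝ) + 1 + 1 + M)) *
          ‖iteratedFDeriv ℝ n φ x - iteratedFDeriv ℝ n φ w‖)
        = (1 + ‖x - w‖) ^ (-((d : ℝ) + 1 + 1 + M)) * ((1 + ‖w‖) ^ M *
          ‖iteratedFDeriv ℝ n φ x - iteratedFDeriv ℝ n φ w‖) := by ring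
      _ ≤ (1 + ‖x - w‖) ^ (-((d : ℝ) + 1 + 1 + M)) *
          ((1 + ‖x - w‖) ^ (M + 1) * (I x + I w)) := by gcongr
      _ = (1 + ‖w - x‖) ^ (-((d : ℝ) + 1)) * (I x + I w) := by
        rw [← mul_assoc, ← Real.rpow_add ha0, norm_sub_rev w x]
        congr 2; ring

end SchwartzMap

end

section

open Filter Topology

/-! ### Unit test functions -/

namespace IsUnitTest

variable {d : ℕ} {s : ℝ} {φ : 𝓢(Euc d, ℂ)}

theorem norm_iteratedFDeriv_le (h : IsUnitTest s φ) {k : ℕ} (hk : k ≤ ⌊s⌋₊) (x : Euc d) :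
    ‖iteratedFDeriv ℝ k φ x‖ ≤ 1 := by
  have h1 : ‖iteratedFDeriv ℝ k φ x‖ₑ ≤ 1 := by
    refine le_trans ?_ h.2
    refine le_trans ?_ le_self_add
    refine le_trans (le_iSup (fun x => ‖iteratedFDeriv ℝ k φ x‖ₑ) x) ?_
    exact Finset.single_le_sum (f := fun k => ⨆ x, ‖iteratedFDeriv ℝ k φ x‖ₑ)
      (fun _ _ => zero_le) (Finset.mem_range.2 (by omega))
  rwa [← ofReal_norm, ENNReal.ofReal_le_one] at h1

/-- The factor `2` is needed when `s` is an integer: the exponent is then zero and the increment is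
bounded by two suprema. This puts integer and fractional orders in the same form. -/
theorem norm_sub_le (h : IsUnitTest s φ) (x y : Euc d) :
    ‖iteratedFDeriv ℝ ⌊s⌋₊ φ x - iteratedFDeriv ℝ ⌊s⌋₊ φ y‖ ≤ 2 * ‖x - y‖ ^ (s - ⌊s⌋₊) := by
  by_cases hs : (⌊s⌋₊ : ℝ) = s
  · rw [sub_eq_zero.2 hs.symm, Real.rpow_zero, mul_one]
    have h1 := h.norm_iteratedFDeriv_le le_rfl x
    have h2 := h.norm_iteratedFDeriv_le le_rfl y
    linarith [_root_.norm_sub_le (iteratedFDeriv ℝ ⌊s⌋₊ φ x) (iteratedFDeriv ℝ ⌊s⌋₊ φ y)]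
  · by_cases hxy : x = y
    · subst hxy
      rw [sub_self, norm_zero]
      positivity
    have h0 : 0 < ‖x - y‖ := norm_pos_iff.2 (sub_ne_zero.2 hxy)
    have h1 : ‖iteratedFDeriv ℝ ⌊s⌋₊ φ x - iteratedFDeriv ℝ ⌊s⌋₊ φ y‖ₑ
        / ‖x - y‖ₑ ^ (s - ⌊s⌋₊) ≤ 1 := by
      refine le_trans ?_ h.2
      refine le_trans ?_ le_add_self
      rw [if_neg hs]
      exact le_iSup₂_of_le x y (le_iSup_of_le hxy le_rfl)
    have hp : 0 < ‖x - y‖ ^ (s - ⌊s⌋₊) := Real.rpow_pos_of_pos h0 _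
    rw [← ofReal_norm, ← ofReal_norm, ENNReal.ofReal_rpow_of_pos h0,
      ← ENNReal.ofReal_div_of_pos hp, ENNReal.ofReal_le_one, div_le_one hp] at h1
    linarith

end IsUnitTest

/-- The norm has `⌊s⌋ + 1` suprema and one Hölder seminorm. The latter costs at most two units: for
close points the derivative of order `⌊s⌋ + 1` controls it, for distant points two suprema do. This
accounts for `⌊s⌋ + 3`. -/
theorem cbNorm_le_one {d : ℕ} {s : ℝ} (hs : 0 < s) {φ : 𝓢(Euc d, ℂ)}
    (h : ∀ k ≤ ⌊s⌋₊ + 1, ∀ x, ‖iteratedFDeriv ℝ k φ x‖ ≤ ((⌊s⌋₊ : ℝ) + 3)⁻¹) :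
    cbNorm s φ ≤ 1 := by
  set n := ⌊s⌋₊ with hn
  set b : ℝ := ((n : ℝ) + 3)⁻¹ with hb
  have hb0 : 0 ≤ b := by positivity
  have hns : (n : ℝ) ≤ s := Nat.floor_le hs.le
  have hsn : s < n + 1 := Nat.lt_floor_add_one s
  have h1 : ∑ k ∈ Finset.range (n + 1), ⨆ x, ‖iteratedFDeriv ℝ k φ x‖ₑ
      ≤ ENNReal.ofReal ((n + 1) * b) := by
    refine (Finset.sum_le_card_nsmul _ _ (ENNReal.ofReal b) fun k hk => ?_).trans (le_of_eq ?_)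
    · refine iSup_le fun x => ?_
      rw [← ofReal_norm]
      exact ENNReal.ofReal_le_ofReal (h k (by have := Finset.mem_range.1 hk; omega) x)
    · rw [Finset.card_range, nsmul_eq_mul, ENNReal.ofReal_mul (by positivity)]
      congr 1
      rw [← Nat.cast_succ, ENNReal.ofReal_natCast]
  have h2 : (if (n : ℝ) = s then 0
    else ⨆ (x : Euc d) (y : Euc d) (_ : x ≠ y),
      ‖iteratedFDeriv ℝ n φ x - iteratedFDeriv ℝ n φ y‖ₑ / ‖x - y‖ₑ ^ (s - n))
      ≤ ENNReal.ofReal (2 * b) := by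
    split_ifs with hs'
    · exact zero_le
    · refine iSup_le fun x => iSup_le fun y => iSup_le fun hxy => ?_
      have h0 : 0 < ‖x - y‖ := norm_pos_iff.2 (sub_ne_zero.2 hxy)
      have hp : 0 < ‖x - y‖ ^ (s - n) := Real.rpow_pos_of_pos h0 _
      rw [← ofReal_norm, ← ofReal_norm, ENNReal.ofReal_rpow_of_pos h0,
        ← ENNReal.ofReal_div_of_pos hp]
      apply ENNReal.ofReal_le_ofReal
      rw [div_le_iff₀ hp]
      rcases le_total ‖x - y‖ 1 with hle | hge
      · have hd : ‖iteratedFDeriv ℝ n φ x - iteratedFDeriv ℝ n φ y‖ ≤ b * ‖x - y‖ := by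
          refine convex_univ.norm_image_sub_le_of_norm_fderiv_le (𝕜 := ℝ)
            (fun z _ => ((φ.smooth (n + 1 : ℕ)).differentiable_iteratedFDeriv
              (by exact_mod_cast Nat.lt_succ_self n)) z) (fun z _ => ?_)
            (Set.mem_univ _) (Set.mem_univ _)
          rw [norm_fderiv_iteratedFDeriv]
          exact h (n + 1) le_rfl z
        have : ‖x - y‖ ^ (1 : ℝ) ≤ ‖x - y‖ ^ (s - n) :=
          Real.rpow_le_rpow_of_exponent_ge h0 hle (by linarith)
        rw [Real.rpow_one] at this
        nlinarith
      · have : 1 ≤ ‖x - y‖ ^ (s - n) := Real.one_le_rpow hge (by linarith)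
        have h1 := h n (by omega) x
        have h2 := h n (by omega) y
        have h3 := norm_sub_le (iteratedFDeriv ℝ n φ x) (iteratedFDeriv ℝ n φ y)
        nlinarith
  calc cbNorm s φ ≤ ENNReal.ofReal ((n + 1) * b) + ENNReal.ofReal (2 * b) := add_le_add h1 h2
    _ = ENNReal.ofReal 1 := by
      rw [← ENNReal.ofReal_add (by positivity) (by positivity)]
      congr 1
      rw [← add_mul, hb]
      field_simp
      ring
    _ = 1 := ENNReal.ofReal_one

theorem isUnitTest_smul {d : ℕ} {s : ℝ} (hs : 0 < s) {φ : 𝓢(Euc d, ℂ)} {b : ℝ} (hb : 0 < b)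
    (hφ : tsupport φ ⊆ Metric.closedBall 0 1)
    (h : ∀ k ≤ ⌊s⌋₊ + 1, ∀ x, ‖iteratedFDeriv ℝ k φ x‖ ≤ b) :
    IsUnitTest s (((((⌊s⌋₊ : ℝ) + 3) * b)⁻¹ : ℝ) • φ) := by
  set c : ℝ := (((⌊s⌋₊ : ℝ) + 3) * b)⁻¹
  have e : ((c • φ : 𝓢(Euc d, ℂ)) : Euc d → ℂ) = c • (φ : Euc d → ℂ) := by ext; simp
  refine ⟨?_, cbNorm_le_one hs fun k hk x => ?_⟩
  · rw [e]
    exact (tsupport_smul_subset_right (fun _ => c) (φ : Euc d → ℂ)).trans hφ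
  · rw [e, iteratedFDeriv_const_smul_apply ((φ.smooth k).contDiffAt), norm_smul,
      Real.norm_of_nonneg (by positivity)]
    calc c * ‖iteratedFDeriv ℝ k φ x‖ ≤ c * b := by gcongr; exact h k hk x
      _ = _ := by simp only [c]; field_simp

theorem rescale_smul {d : ℕ} (c : ℝ) (φ : 𝓢(Euc d, ℂ)) (x : Euc d) {lam : ℝ} (h : 0 < lam) :
    rescale (c • φ) x lam = c • rescale φ x lam := by
  ext y
  simp only [rescale_apply _ _ h, smul_apply, Complex.real_smul]
  ring

/-- By homogeneity, estimates over unit test functions apply to any smooth function supported in the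
unit ball, at the price of its derivative bounds. -/
theorem norm_pairing_le_of_unitTest {d : ℕ} {s : ℝ} (hs : 0 < s) {φ : 𝓢(Euc d, ℂ)} {b X : ℝ}
    (hb : 0 < b) (hφ : tsupport φ ⊆ Metric.closedBall 0 1)
    (h : ∀ k ≤ ⌊s⌋₊ + 1, ∀ x, ‖iteratedFDeriv ℝ k φ x‖ ≤ b)
    (u : 𝓢'(Euc d, ℂ)) {x : Euc d} {lam : ℝ} (hl : 0 < lam)
    (hu : ∀ ψ, IsUnitTest s ψ → ‖u (rescale ψ x lam)‖ ≤ X) :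
    ‖u (rescale φ x lam)‖ ≤ ((⌊s⌋₊ : ℝ) + 3) * b * X := by
  have h1 := hu _ (isUnitTest_smul hs hb hφ h)
  set c : ℝ := ((⌊s⌋₊ : ℝ) + 3) * b with hc
  have hc0 : 0 < c := by positivity
  have e : u (rescale (c⁻¹ • φ) x lam) = (c⁻¹ : ℝ) • u (rescale φ x lam) := by
    rw [rescale_smul _ _ _ hl, ← Complex.coe_smul, map_smul, Complex.coe_smul]
  rw [e, norm_smul, Real.norm_of_nonneg (by positivity), ← div_eq_inv_mul, div_le_iff₀ hc0] at h1
  linarith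

namespace SchwartzMap

variable {d : ℕ}

theorem iteratedFDeriv_rescale_zero (φ : 𝓢(Euc d, ℂ)) {R : ℝ} (hR : 0 < R) (n : ℕ) (x : Euc d) :
    iteratedFDeriv ℝ n (rescale φ 0 R) x
      = ((R ^ d)⁻¹ * (R⁻¹) ^ n : ℝ) • iteratedFDeriv ℝ n φ (R⁻¹ • x) := by
  have e : (rescale φ 0 R : Euc d → ℂ) = (R ^ d)⁻¹ • fun y => φ (R⁻¹ • y) := by
    ext y; simp [rescale_apply _ _ hR]
  have hs : ContDiff ℝ n fun y => φ (R⁻¹ • y) := (φ.smooth n).comp (by fun_prop)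
  rw [e, iteratedFDeriv_const_smul_apply hs.contDiffAt,
    iteratedFDeriv_comp_const_smul R⁻¹ (φ.smooth n), smul_smul]

theorem tsupport_rescale_zero (φ : 𝓢(Euc d, ℂ)) {R : ℝ} (hR : 0 < R)
    (hφ : tsupport φ ⊆ Metric.closedBall 0 1) :
    tsupport (rescale φ 0 R) ⊆ Metric.closedBall 0 R := by
  refine closure_minimal (fun y hy => ?_) Metric.isClosed_closedBall
  rw [Function.mem_support, rescale_apply _ _ hR] at hy
  have h1 : R⁻¹ • (y - 0) ∈ tsupport φ := subset_tsupport _ (right_ne_zero_of_mul hy)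
  have h2 := hφ h1
  rw [mem_closedBall_zero_iff, sub_zero, norm_smul, norm_inv, Real.norm_of_nonneg hR.le,
    inv_mul_le_iff₀ hR, mul_one] at h2
  simpa using h2

/-- A function reproduced by an annular kernel at scale `μ` is small against test functions at
scale `lam ≥ μ`. -/
theorem IsAnnular.norm_integral_mul_rescale_le {H : 𝓢(Euc d, ℂ)} (hH : IsAnnular H) {M s : ℝ}
    (hM : 0 ≤ M) (hs : 0 < s) :
    ∃ C, 0 ≤ C ∧ ∀ (B : ℝ) (g : Euc d → ℂ) (φ : 𝓢(Euc d, ℂ)) (x₀ : Euc d) (μ lam : ℝ),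
      0 < μ → μ ≤ lam → IsUnitTest s φ → StronglyMeasurable g →
      (∀ w, ‖g (x₀ + μ • w)‖ ≤ B * (1 + ‖w‖) ^ M) →
      (∀ w, g (x₀ + μ • w) = ∫ w', H (w - w') * g (x₀ + μ • w')) →
      ‖∫ y, g y * rescale φ x₀ lam y‖ ≤ C * B * (μ / lam) ^ (s - M) := by
  set n := ⌊s⌋₊ with hn
  have hns : (n : ℝ) ≤ s := Nat.floor_le hs.le
  have hsn : s < n + 1 := Nat.lt_floor_add_one s
  obtain ⟨C, hC, h⟩ := hH.norm_integral_mul_le_holder n (M := M) (θ := s - n) hM (by linarith)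
    (by linarith)
  refine ⟨2 * C, by positivity, fun B g φ x₀ μ lam hμ hl hφ hgm hg hrep => ?_⟩
  have hlam : 0 < lam := hμ.trans_le hl
  set R := lam / μ with hR
  have hR1 : 1 ≤ R := (one_le_div hμ).2 hl
  have hR0 : 0 < R := by linarith
  have hB : 0 ≤ B := by
    have := (norm_nonneg _).trans (hg 0)
    simpa using this
  have hgm' : StronglyMeasurable fun w => g (x₀ + μ • w) :=
    hgm.comp_measurable (by fun_prop : Continuous fun w : Euc d => x₀ + μ • w).measurable
  -- In units of `μ` the test function lives at scale `R = lam / μ`, and its derivative of order `n`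
  -- has Hölder constant `2 R^{-d-s}`. Against the growth factor `R^{M+d}` this leaves `R^{-(s-M)}`.
  have key := h B (2 * ((R ^ d)⁻¹ * (R⁻¹) ^ n * (R⁻¹) ^ (s - n))) R (fun w => g (x₀ + μ • w))
    (rescale φ 0 R) hR1 (by positivity) hgm' hg hrep (tsupport_rescale_zero φ hR0 hφ.1) ?_
  · have e : ∫ w, g (x₀ + μ • w) * rescale φ 0 R w = ∫ y, g y * rescale φ x₀ lam y := by
      rw [integral_mul_rescale φ x₀ hlam, integral_mul_rescale φ 0 hR0 fun w => g (x₀ + μ • w)]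
      congr 1; ext w
      rw [zero_add, smul_smul, hR, mul_div_cancel₀ _ hμ.ne']
    rw [← e]
    refine key.trans (le_of_eq ?_)
    have e2 : μ / lam = R⁻¹ := by rw [hR, inv_div]
    rw [e2, Real.inv_rpow hR0.le, Real.inv_rpow hR0.le, ← Real.rpow_neg hR0.le,
      ← Real.rpow_neg hR0.le, inv_pow, ← Real.rpow_natCast, ← Real.rpow_natCast,
      ← Real.rpow_neg hR0.le, ← Real.rpow_neg hR0.le]
    have : R ^ (-(s - M)) = R ^ (-(d : ℝ)) * R ^ (-(n : ℝ)) * R ^ (-(s - n)) * R ^ (M + d) := by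
      rw [← Real.rpow_add hR0, ← Real.rpow_add hR0, ← Real.rpow_add hR0]
      congr 1; ring
    rw [this]; ring
  · intro x y
    rw [iteratedFDeriv_rescale_zero φ hR0, iteratedFDeriv_rescale_zero φ hR0, ← smul_sub, norm_smul,
      Real.norm_of_nonneg (by positivity)]
    calc (R ^ d)⁻¹ * R⁻¹ ^ n * ‖iteratedFDeriv ℝ n φ (R⁻¹ • x) - iteratedFDeriv ℝ n φ (R⁻¹ • y)‖
        ≤ (R ^ d)⁻¹ * R⁻¹ ^ n * (2 * ‖R⁻¹ • x - R⁻¹ • y‖ ^ (s - n)) := by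
          gcongr; exact hφ.norm_sub_le _ _
      _ = _ := by
        rw [← smul_sub, norm_smul, Real.norm_of_nonneg (by positivity),
          Real.mul_rpow (by positivity) (norm_nonneg _)]
        ring

/-- Bernstein-type gain for bounded functions: after rescaling by `μ`, each derivative of the test
function contributes one factor `μ`. No compact support of `φ` is required, which suits convergence
in the sense of tempered distributions. -/
theorem IsAnnular.norm_integral_mul_dilate_le {H : 𝓢(Euc d, ℂ)} (hH : IsAnnular H) (n : ℕ) :
    ∃ C, 0 ≤ C ∧ ∀ (B : ℝ) (g : Euc d → ℂ) (φ : 𝓢(Euc d, ℂ)) (μ : ℝ), 0 < μ →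
      StronglyMeasurable g → (∀ y, ‖g y‖ ≤ B) →
      (∀ w, g (μ • w) = ∫ w', H (w - w') * g (μ • w')) →
      ‖∫ y, g y * φ y‖ ≤ C * B * μ ^ n * ∫ y, ‖iteratedFDeriv ℝ n φ y‖ := by
  obtain ⟨C, hC, h⟩ := hH.norm_integral_mul_le_deriv n
  refine ⟨C, hC, fun B g φ μ hμ hgm hg hrep => ?_⟩
  have hgm' : StronglyMeasurable fun w => g (μ • w) :=
    hgm.comp_measurable (by fun_prop : Continuous fun w : Euc d => μ • w).measurable
  have hμ' : 0 < μ⁻¹ := inv_pos.2 hμ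
  have key := h B (fun w => g (μ • w)) (rescale φ 0 μ⁻¹) hgm' (fun w => hg _) hrep
  rw [integral_mul_rescale φ 0 hμ'] at key
  have e1 : ∀ w : Euc d, μ • (0 + μ⁻¹ • w) = w := fun w => by
    rw [zero_add, smul_smul, mul_inv_cancel₀ hμ.ne', one_smul]
  simp_rw [e1, iteratedFDeriv_rescale_zero φ hμ', norm_smul] at key
  rw [integral_const_mul] at key
  have e2 := Measure.integral_comp_smul (volume : Measure (Euc d))
    (fun y => ‖iteratedFDeriv ℝ n φ y‖) μ⁻¹⁻¹
  rw [e2, finrank_euclideanSpace_fin, Real.norm_of_nonneg (by positivity),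
    abs_of_pos (by positivity), inv_inv] at key
  refine key.trans (le_of_eq ?_)
  rw [smul_eq_mul, inv_pow, inv_inv]
  field_simp

end SchwartzMap

end

section

open Filter Topology
open scoped Pointwise

/-! ### Spectral localization -/

namespace SchwartzMap

variable {d : ℕ}

theorem fourier_injective {f g : 𝓢(Euc d, ℂ)}
    (h : ∀ ξ, (𝓕 f : 𝓢(Euc d, ℂ)) ξ = (𝓕 g : 𝓢(Euc d, ℂ)) ξ) : f = g :=
  (FourierTransform.fourierEquiv ℂ 𝓢(Euc d, ℂ)).injective (SchwartzMap.ext h)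

theorem fourier_rescale (V : 𝓢(Euc d, ℂ)) (x ξ : Euc d) {R : ℝ} (hR : 0 < R) :
    (𝓕 (rescale V x R) : 𝓢(Euc d, ℂ)) ξ
      = Complex.exp (-(2 * Real.pi * inner ℝ x ξ : ℝ) * Complex.I) *
        (𝓕 V : 𝓢(Euc d, ℂ)) (R • ξ) := by
  rw [fourier_coe, fourier_coe, Real.fourier_eq', Real.fourier_eq', ← integral_const_mul]
  simp_rw [smul_eq_mul]
  rw [integral_mul_rescale V x hR fun y => Complex.exp (↑(-2 * Real.pi * inner ℝ y ξ) * Complex.I)]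
  congr 1; ext w
  rw [← mul_assoc, ← Complex.exp_add]
  congr 2
  rw [inner_add_left, inner_smul_left, inner_smul_right]
  push_cast
  simp
  ring

theorem rescale_one (V : 𝓢(Euc d, ℂ)) (x : Euc d) :
    rescale V x 1 = V.compSubConstCLM ℂ x := by
  ext y
  simp [rescale_apply _ _ one_pos]

theorem fourier_kernelAt (V : 𝓢(Euc d, ℂ)) (x ξ : Euc d) :
    (𝓕 (kernelAt V x) : 𝓢(Euc d, ℂ)) ξ
      = Complex.exp (-(2 * Real.pi * inner ℝ x ξ : ℝ) * Complex.I) *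
        (𝓕 V : 𝓢(Euc d, ℂ)) (-ξ) := by
  rw [fourier_coe, fourier_coe, Real.fourier_eq', Real.fourier_eq', ← integral_const_mul]
  rw [← integral_sub_left_eq_self _ volume x]
  congr 1; ext w
  rw [kernelAt_apply, sub_sub_cancel, smul_eq_mul, smul_eq_mul, ← mul_assoc, ← Complex.exp_add]
  congr 2
  rw [inner_sub_left, inner_neg_right]
  push_cast
  ring

theorem conv_eq_self {H V : 𝓢(Euc d, ℂ)}
    (h : ∀ ξ, (𝓕 V : 𝓢(Euc d, ℂ)) ξ ≠ 0 → (𝓕 H : 𝓢(Euc d, ℂ)) ξ = 1) : conv H V = V := by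
  apply fourier_injective
  intro ξ
  rw [fourier_conv]
  by_cases hξ : (𝓕 V : 𝓢(Euc d, ℂ)) ξ = 0
  · rw [hξ, mul_zero]
  · rw [h ξ hξ, one_mul]

theorem integral_reproducing {H V : 𝓢(Euc d, ℂ)}
    (h : ∀ ξ, (𝓕 V : 𝓢(Euc d, ℂ)) ξ ≠ 0 → (𝓕 H : 𝓢(Euc d, ℂ)) ξ = 1) (w : Euc d) :
    V w = ∫ w', H (w - w') * V w' := by
  conv_lhs => rw [← conv_eq_self h, conv_comm, conv_apply]
  congr 1; ext y; ring

/-- The product of two Schwartz functions. -/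
def prodS (f g : 𝓢(Euc d, ℂ)) : 𝓢(Euc d, ℂ) :=
  SchwartzMap.pairing (ContinuousLinearMap.mul ℂ ℂ) f g

theorem prodS_apply (f g : 𝓢(Euc d, ℂ)) (x : Euc d) : prodS f g x = f x * g x := by
  rw [prodS, pairing_apply_apply]
  rfl

theorem fourierInv_eq_neg (f : 𝓢(Euc d, ℂ)) (ξ : Euc d) :
    (𝓕⁻ f : 𝓢(Euc d, ℂ)) ξ = (𝓕 f : 𝓢(Euc d, ℂ)) (-ξ) := by
  rw [fourierInv_coe, fourier_coe, Real.fourierInv_eq_fourier_neg]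

/-- The Fourier transform turns the product into a convolution; if no such `η` existed, its
integrand would vanish identically. -/
theorem exists_of_fourier_prodS_ne_zero {f g : 𝓢(Euc d, ℂ)} {ξ : Euc d}
    (h : (𝓕 (prodS f g) : 𝓢(Euc d, ℂ)) ξ ≠ 0) :
    ∃ η, (𝓕 f : 𝓢(Euc d, ℂ)) η ≠ 0 ∧ (𝓕 g : 𝓢(Euc d, ℂ)) (ξ - η) ≠ 0 := by
  by_contra! hc
  apply h
  have e1 : 𝓕⁻ (prodS f g) = conv (𝓕⁻ f) (𝓕⁻ g) := by
    rw [conv, SchwartzMap.convolution]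
    simp [prodS]
  have e2 : (𝓕 (prodS f g) : 𝓢(Euc d, ℂ)) ξ = (𝓕⁻ (prodS f g) : 𝓢(Euc d, ℂ)) (-ξ) := by
    rw [fourierInv_eq_neg, neg_neg]
  rw [e2, e1, conv_apply]
  have : ∀ y : Euc d, (𝓕⁻ f : 𝓢(Euc d, ℂ)) y * (𝓕⁻ g : 𝓢(Euc d, ℂ)) (-ξ - y) = 0 := by
    intro y
    rw [fourierInv_eq_neg, fourierInv_eq_neg]
    by_cases hy : (𝓕 f : 𝓢(Euc d, ℂ)) (-y) = 0
    · rw [hy, zero_mul]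
    · have := hc (-y) hy
      rw [show -(-ξ - y) = ξ - -y by
        rw [neg_sub, sub_neg_eq_add, sub_neg_eq_add, add_comm], this, mul_zero]
  simp [this]

/-- There is an annular kernel whose Fourier transform is one on a given compact set. -/
theorem exists_annular_eq_one {S : Set (Euc d)} (hS : IsCompact S) (h0 : (0 : Euc d) ∉ S) :
    ∃ H : 𝓢(Euc d, ℂ), IsAnnular H ∧ ∀ ξ ∈ S, (𝓕 H : 𝓢(Euc d, ℂ)) ξ = 1 := by
  obtain ⟨U, hU, hSU, hUc, hU0⟩ : ∃ U, IsOpen U ∧ S ⊆ U ∧ IsCompact (closure U) ∧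
      closure U ⊆ {0}ᶜ := by
    obtain ⟨U, hU, hSU, hUV, hUc⟩ := exists_open_between_and_isCompact_closure hS
      (isOpen_compl_singleton (x := (0 : Euc d))) (by
        intro x hx hx0
        exact h0 (by rwa [Set.mem_singleton_iff.1 hx0] at hx))
    exact ⟨U, hU, hSU, hUc, hUV⟩
  obtain ⟨f, hf, _, hf0, hf1⟩ : ∃ f : Euc d → ℝ, ContDiff ℝ ∞ f ∧ Set.range f ⊆ Set.Icc 0 1 ∧
      Function.support f ⊆ U ∧ ∀ x ∈ S, f x = 1 := by
    obtain ⟨f, hf, hr, h1, h2⟩ := exists_contMDiff_support_eq_eq_one_iff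
      (modelWithCornersSelf ℝ (Euc d)) (n := (⊤ : ℕ∞)) hU hS.isClosed hSU
    exact ⟨f, hf.contDiff, hr, h1.le, fun x hx => (h2 x).1 hx⟩
  have hts : tsupport (fun z => (f z : ℂ)) ⊆ closure U := by
    refine closure_mono fun z hz => hf0 ?_
    simpa using hz
  have hc : HasCompactSupport fun z => (f z : ℂ) := hUc.of_isClosed_subset isClosed_closure hts
  set g : 𝓢(Euc d, ℂ) := hc.toSchwartzMap (Complex.ofRealCLM.contDiff.comp hf) with hg
  have hg' : (g : Euc d → ℂ) = fun z => (f z : ℂ) := rfl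
  refine ⟨𝓕⁻ g, ⟨?_, ?_⟩, fun ξ hξ => ?_⟩
  · rw [FourierTransform.fourier_fourierInv_eq, hg']
    exact hc
  · rw [FourierTransform.fourier_fourierInv_eq, hg']
    exact fun h => hU0 (hts h) rfl
  · rw [FourierTransform.fourier_fourierInv_eq, hg']
    simp [hf1 ξ hξ]

/-- Reproducing formulas for a low-high product and for its high frequency factor. -/
theorem exists_annular_reproducing {J K : 𝓢(Euc d, ℂ)}
    (hJ : HasCompactSupport (𝓕 J : 𝓢(Euc d, ℂ))) (hK : HasCompactSupport (𝓕 K : 𝓢(Euc d, ℂ)))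
    (hK0 : (0 : Euc d) ∉ tsupport (𝓕 K : 𝓢(Euc d, ℂ)))
    (hJK : ∀ ξ, ξ ∈ tsupport (𝓕 J : 𝓢(Euc d, ℂ)) → -ξ ∉ tsupport (𝓕 K : 𝓢(Euc d, ℂ))) :
    ∃ H : 𝓢(Euc d, ℂ), IsAnnular H ∧
      (∀ w t, K (w - t) = ∫ w', H (w - w') * K (w' - t)) ∧
      ∀ w z t, J (w - z) * K (w - t) = ∫ w', H (w - w') * (J (w' - z) * K (w' - t)) := by
  obtain ⟨H, hH, h1⟩ := exists_annular_eq_one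
    (S := (tsupport (𝓕 J : 𝓢(Euc d, ℂ)) + tsupport (𝓕 K : 𝓢(Euc d, ℂ))) ∪
      tsupport (𝓕 K : 𝓢(Euc d, ℂ))) ((hJ.isCompact.add hK.isCompact).union hK.isCompact) (by
        -- The origin lies in the sum of the two supports only if they contain opposite frequencies,
        -- which `hJK` excludes.
        rintro (⟨ξ, hξ, η, hη, h⟩ | h)
        · refine hJK ξ hξ ?_
          rwa [← eq_neg_of_add_eq_zero_right h]
        · exact hK0 h)
  have hsh : ∀ (V : 𝓢(Euc d, ℂ)) (x ξ : Euc d),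
      (𝓕 (V.compSubConstCLM ℂ x) : 𝓢(Euc d, ℂ)) ξ ≠ 0 → (𝓕 V : 𝓢(Euc d, ℂ)) ξ ≠ 0 := by
    intro V x ξ h
    rw [← rescale_one, fourier_rescale _ _ _ one_pos, one_smul] at h
    exact right_ne_zero_of_mul h
  refine ⟨H, hH, fun w t => ?_, fun w z t => ?_⟩
  · have := integral_reproducing (H := H) (V := K.compSubConstCLM ℂ t) (fun ξ hξ =>
      h1 ξ (Or.inr (subset_tsupport _ (hsh K t ξ hξ)))) w
    simpa using this
  · have := integral_reproducing (H := H)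
      (V := prodS (J.compSubConstCLM ℂ z) (K.compSubConstCLM ℂ t)) (fun ξ hξ => ?_) w
    · simpa [prodS_apply] using this
    · obtain ⟨η, h2, h3⟩ := exists_of_fourier_prodS_ne_zero hξ
      exact h1 ξ (Or.inl ⟨η, subset_tsupport _ (hsh J z η h2), ξ - η,
        subset_tsupport _ (hsh K t _ h3), add_sub_cancel _ _⟩)

/-- Orthogonality for disjoint spectra: Fubini moves the reflected `H` onto `φ`, and that
convolution has zero Fourier transform. The growth bound on `g` serves only to justify Fubini. -/
theorem integral_mul_eq_zero_of_reproducing {H φ : 𝓢(Euc d, ℂ)} {g : Euc d → ℂ} {B M : ℝ}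
    (hM : 0 ≤ M) (hgm : StronglyMeasurable g) (hg : ∀ w, ‖g w‖ ≤ B * (1 + ‖w‖) ^ M)
    (hrep : ∀ w, g w = ∫ w', H (w - w') * g w')
    (h0 : ∀ ξ, (𝓕 H : 𝓢(Euc d, ℂ)) (-ξ) * (𝓕 φ : 𝓢(Euc d, ℂ)) ξ = 0) :
    ∫ w, g w * φ w = 0 := by
  have hint := integral_integral_swap_growth H φ hgm hM hg
  have e1 : ∫ w, g w * φ w = ∫ w', g w' * ∫ w, H (w - w') * φ w := by
    have : ∫ w, g w * φ w = ∫ w, ∫ w', H (w - w') * g w' * φ w := by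
      congr 1; ext w
      rw [integral_mul_const, ← hrep]
    rw [this, integral_integral_swap hint]
    congr 1; ext w'
    rw [← integral_const_mul]
    congr 1; ext w; ring
  have e2 : conv φ (kernelAt H 0) = 0 := by
    apply fourier_injective
    intro ξ
    rw [fourier_conv, fourier_kernelAt, FourierTransform.fourier_zero, zero_apply]
    linear_combination Complex.exp (-(2 * Real.pi * inner ℝ (0 : Euc d) ξ : ℝ) * Complex.I) * h0 ξ
  have e3 : ∀ w', ∫ w, H (w - w') * φ w = 0 := by
    intro w'
    have := congrArg (fun f : 𝓢(Euc d, ℂ) => f w') e2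
    simp only [conv_apply, kernelAt_apply, zero_apply] at this
    rw [← this]
    congr 1; ext w
    rw [mul_comm, zero_sub, neg_sub]
  rw [e1]
  simp [e3]

theorem IsAnnular.exists_bounds {H : 𝓢(Euc d, ℂ)} (hH : IsAnnular H) :
    ∃ a b : ℝ, 0 < a ∧ 0 < b ∧ ∀ ξ, (𝓕 H : 𝓢(Euc d, ℂ)) ξ ≠ 0 → a ≤ ‖ξ‖ ∧ ‖ξ‖ ≤ b := by
  obtain ⟨b, hb⟩ := hH.1.isCompact.isBounded.exists_pos_norm_le
  have := (isClosed_tsupport (𝓕 H : 𝓢(Euc d, ℂ))).isOpen_compl.mem_nhds hH.2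
  obtain ⟨a, ha, ha'⟩ := Metric.mem_nhds_iff.1 this
  refine ⟨a, b, ha, hb.1, fun ξ hξ => ⟨?_, hb.2 ξ (subset_tsupport _ hξ)⟩⟩
  by_contra! h
  exact ha' (by simpa using h) (subset_tsupport _ hξ)

/-- At large `R` the spectrum of the rescaled `V` shrinks into the hole of the annulus; compactness
of the spectrum of `V` is enough. The factor `2` in the threshold makes the separation strict. -/
theorem IsAnnular.exists_large {H : 𝓢(Euc d, ℂ)} (hH : IsAnnular H) {V : 𝓢(Euc d, ℂ)}
    (hV : HasCompactSupport (𝓕 V : 𝓢(Euc d, ℂ))) :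
    ∃ R₀ : ℝ, ∀ R, R₀ ≤ R → 0 < R → ∀ x ξ,
      (𝓕 H : 𝓢(Euc d, ℂ)) (-ξ) * (𝓕 (rescale V x R) : 𝓢(Euc d, ℂ)) ξ = 0 := by
  obtain ⟨a, b, ha, hb, h⟩ := hH.exists_bounds
  obtain ⟨b', hb', h'⟩ := hV.isCompact.isBounded.exists_pos_norm_le
  refine ⟨2 * b' / a, fun R hR hR0 x ξ => ?_⟩
  by_contra hne
  have h1 := (h _ (left_ne_zero_of_mul hne)).1
  have h2 := right_ne_zero_of_mul hne
  rw [fourier_rescale _ _ _ hR0] at h2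
  have h3 := h' _ (subset_tsupport _ (right_ne_zero_of_mul h2))
  rw [norm_smul, Real.norm_of_nonneg hR0.le] at h3
  rw [norm_neg] at h1
  rw [div_le_iff₀ ha] at hR
  nlinarith

/-- At small `R` the spectrum of the rescaled `V` leaves the annulus outwards; here `V` must have no
spectrum near zero. -/
theorem IsAnnular.exists_small {H : 𝓢(Euc d, ℂ)} (hH : IsAnnular H) {V : 𝓢(Euc d, ℂ)}
    (hV : IsAnnular V) :
    ∃ r₀ : ℝ, 0 < r₀ ∧ ∀ R, R ≤ r₀ → 0 < R → ∀ x ξ,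
      (𝓕 H : 𝓢(Euc d, ℂ)) (-ξ) * (𝓕 (rescale V x R) : 𝓢(Euc d, ℂ)) ξ = 0 := by
  obtain ⟨a, b, ha, hb, h⟩ := hH.exists_bounds
  obtain ⟨a', b', ha', hb', h'⟩ := hV.exists_bounds
  refine ⟨a' / (2 * b), by positivity, fun R hR hR0 x ξ => ?_⟩
  by_contra hne
  have h1 := (h _ (left_ne_zero_of_mul hne)).2
  have h2 := right_ne_zero_of_mul hne
  rw [fourier_rescale _ _ _ hR0] at h2
  have h3 := (h' _ (right_ne_zero_of_mul h2)).1
  rw [norm_smul, Real.norm_of_nonneg hR0.le] at h3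
  rw [norm_neg] at h1
  rw [le_div_iff₀ (by positivity)] at hR
  nlinarith [norm_nonneg ξ]

end SchwartzMap

end

section

open Filter Topology SchwartzMap

/-! ### Littlewood--Paley kernels -/

/-- The dyadic scale `2^{-i}`. -/
def dyadicScale (i : ℕ) : ℝ := (1 / 2) ^ i

theorem dyadicScale_pos (i : ℕ) : 0 < dyadicScale i := by
  unfold dyadicScale; positivity

theorem dyadicScale_le_one (i : ℕ) : dyadicScale i ≤ 1 :=
  pow_le_one₀ (by norm_num) (by norm_num)

theorem dyadicScale_eq_zpow (i : ℕ) : dyadicScale i = (2 : ℝ) ^ (-(i : ℤ)) := by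
  rw [dyadicScale, zpow_neg, zpow_natCast, one_div, inv_pow]

theorem dyadicScale_add (i j : ℕ) : dyadicScale (i + j) = dyadicScale i * dyadicScale j :=
  pow_add _ _ _

theorem dyadicScale_rpow (i : ℕ) (a : ℝ) : dyadicScale i ^ a = ((1 / 2 : ℝ) ^ a) ^ i := by
  rw [dyadicScale, ← Real.rpow_natCast, ← Real.rpow_natCast, ← Real.rpow_mul (by norm_num),
    ← Real.rpow_mul (by norm_num), mul_comm]

theorem kernelAt_eq_shift {d : ℕ} (V : 𝓢(Euc d, ℂ)) (x : Euc d) :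
    kernelAt V x = (kernelAt V 0).compSubConstCLM ℂ x := by
  ext y
  simp [kernelAt_apply]

theorem kernelAt_rescale {d : ℕ} (V : 𝓢(Euc d, ℂ)) (x : Euc d) {R : ℝ} (hR : 0 < R) :
    kernelAt (rescale V 0 R) x = rescale (kernelAt V 0) x R := by
  ext y
  rw [kernelAt_apply, rescale_apply _ _ hR, rescale_apply _ _ hR, kernelAt_apply, sub_zero,
    zero_sub, ← smul_neg, neg_sub]

namespace DyadicPartition

variable {d : ℕ} (D : DyadicPartition d)

theorem χS_apply (z : Euc d) : D.χS z = D.χ z := rfl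

theorem ρS_apply (z : Euc d) : D.ρS z = D.ρ z := rfl

theorem symbol_neg_one (z : Euc d) : D.symbol (-1) z = D.χ z := by
  simp [symbol, χS_apply]

theorem symbol_natCast (i : ℕ) (z : Euc d) : D.symbol i z = D.ρ (dyadicScale i • z) := by
  have h1 : (i : ℤ) ≠ -1 := by omega
  have h2 : (0 : ℤ) ≤ i := by omega
  rw [symbol, if_neg h1, if_pos h2, dilate_apply (by positivity), ρS_apply, dyadicScale_eq_zpow]

theorem symbol_zero (z : Euc d) : D.symbol 0 z = D.ρ z := by
  simpa [dyadicScale] using D.symbol_natCast 0 z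

theorem fourier_kernel (j : ℤ) (ξ : Euc d) :
    (𝓕 (D.kernel j) : 𝓢(Euc d, ℂ)) ξ = D.symbol j ((2 * Real.pi) • ξ) := by
  rw [kernel, FourierTransform.fourier_fourierInv_eq, dilate_apply (by positivity)]

theorem kernel_natCast (i : ℕ) : D.kernel i = rescale (D.kernel 0) 0 (dyadicScale i) := by
  apply fourier_injective
  intro ξ
  rw [fourier_rescale _ _ _ (dyadicScale_pos i), fourier_kernel, fourier_kernel, symbol_natCast,
    symbol_zero, smul_comm]
  simp

/-- Evaluating the partition of unity at `z` and at `2^{-i} z` and subtracting cancels the common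
tail. This makes `K_{<i}` a rescaling of the single kernel `K_{-1}`, so that all blocks have the
same shape. -/
theorem χ_scale (i : ℕ) (z : Euc d) :
    D.χ (dyadicScale i • z) = D.χ z + ∑ j ∈ Finset.range i, D.ρ (dyadicScale j • z) := by
  have h1 := D.sum_eq_one z
  have h2 := D.sum_eq_one (dyadicScale i • z)
  simp_rw [← dyadicScale_eq_zpow] at h1 h2
  simp_rw [smul_smul, ← dyadicScale_add] at h2
  have h3 := (hasSum_nat_add_iff' (f := fun j => D.ρ (dyadicScale j • z)) i).2 h1
  have := h2.unique h3
  linarith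

theorem sum_Ico_int {M : Type*} [AddCommMonoid M] (f : ℤ → M) (i : ℕ) :
    ∑ j ∈ Finset.Ico (-1 : ℤ) i, f j = f (-1) + ∑ j ∈ Finset.range i, f j := by
  induction i with
  | zero =>
    have : Finset.Ico (-1 : ℤ) 0 = {-1} := rfl
    simp [this]
  | succ n ih =>
    rw [Finset.sum_range_succ, ← add_assoc, ← ih, Nat.cast_succ,
      ← Finset.insert_Ico_right_eq_Ico_add_one (by omega), Finset.sum_insert (by simp), add_comm]

theorem kernelLt_natCast (i : ℕ) :
    D.kernelLt i = rescale (D.kernel (-1)) 0 (dyadicScale i) := by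
  apply fourier_injective
  intro ξ
  rw [fourier_rescale _ _ _ (dyadicScale_pos i), fourier_kernel, symbol_neg_one, smul_comm,
    χ_scale, kernelLt, sum_Ico_int, FourierTransform.fourier_add, FourierTransform.fourier_sum]
  simp only [add_apply, sum_apply, fourier_kernel, symbol_neg_one, symbol_natCast]
  simp

theorem kernelLt_natCast_eq_add (i : ℕ) :
    D.kernelLt i = D.kernel (-1) + ∑ j ∈ Finset.range i, D.kernel j := by
  rw [kernelLt, sum_Ico_int]

theorem kernelLt_neg_one : D.kernelLt (-1) = 0 := by simp [kernelLt]

theorem kernelAt_kernel (i : ℕ) (x : Euc d) :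
    kernelAt (D.kernel i) x = rescale (kernelAt (D.kernel 0) 0) x (dyadicScale i) := by
  rw [kernel_natCast, kernelAt_rescale _ _ (dyadicScale_pos i)]

theorem kernelAt_kernelLt (i : ℕ) (x : Euc d) :
    kernelAt (D.kernelLt i) x = rescale (kernelAt (D.kernel (-1)) 0) x (dyadicScale i) := by
  rw [kernelLt_natCast, kernelAt_rescale _ _ (dyadicScale_pos i)]

theorem ρ_zero : D.ρ 0 = 0 := by
  obtain ⟨a, b, ha, _, h⟩ := D.ρ_supp
  by_contra hne
  have := (h (subset_tsupport _ hne)).1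
  simp at this
  linarith

theorem χ_zero : D.χ 0 = 1 := by
  have h := D.sum_eq_one 0
  simp only [smul_zero, ρ_zero] at h
  have := h.unique hasSum_zero
  linarith

theorem integral_kernel_neg_one : ∫ x, D.kernel (-1) x = 1 := by
  have h1 := D.fourier_kernel (-1) 0
  rw [fourier_coe, Real.fourier_eq', symbol_neg_one, smul_zero, χ_zero] at h1
  simpa using h1

theorem integral_kernelAt_neg_one : ∫ x, kernelAt (D.kernel (-1)) 0 x = 1 := by
  simp_rw [kernelAt_apply, zero_sub]
  rw [integral_neg_eq_self (fun y => D.kernel (-1) y), integral_kernel_neg_one]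

theorem tsupport_fourier_kernel_neg_one_subset :
    tsupport (𝓕 (D.kernel (-1)) : 𝓢(Euc d, ℂ)) ⊆ {ξ | (2 * Real.pi) • ξ ∈ tsupport D.χ} := by
  refine closure_minimal (fun ξ hξ => ?_)
    ((isClosed_tsupport D.χ).preimage (by fun_prop : Continuous fun ξ => (2 * Real.pi) • ξ))
  rw [Function.mem_support, fourier_kernel, symbol_neg_one] at hξ
  refine subset_tsupport D.χ (Function.mem_support.2 ?_)
  simpa using hξ

theorem tsupport_fourier_kernel_zero_subset :
    tsupport (𝓕 (D.kernel 0) : 𝓢(Euc d, ℂ)) ⊆ {ξ | (2 * Real.pi) • ξ ∈ tsupport D.ρ} := by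
  refine closure_minimal (fun ξ hξ => ?_)
    ((isClosed_tsupport D.ρ).preimage (by fun_prop : Continuous fun ξ => (2 * Real.pi) • ξ))
  rw [Function.mem_support, fourier_kernel, symbol_zero] at hξ
  refine subset_tsupport D.ρ (Function.mem_support.2 ?_)
  simpa using hξ

theorem norm_le_of_two_pi_smul {ξ : Euc d} {b : ℝ} (h : ‖(2 * Real.pi) • ξ‖ ≤ b) : ‖ξ‖ ≤ b := by
  rw [norm_smul, Real.norm_of_nonneg (by positivity)] at h
  nlinarith [Real.pi_gt_three, norm_nonneg ξ]

theorem hasCompactSupport_fourier_kernel_neg_one :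
    HasCompactSupport (𝓕 (D.kernel (-1)) : 𝓢(Euc d, ℂ)) := by
  obtain ⟨b, _, hb⟩ := D.χ_supp
  refine (isCompact_closedBall (0 : Euc d) b).of_isClosed_subset (isClosed_tsupport _) ?_
  intro ξ hξ
  simpa using norm_le_of_two_pi_smul (hb (D.tsupport_fourier_kernel_neg_one_subset hξ))

theorem isAnnular_kernel_zero : IsAnnular (D.kernel 0) := by
  obtain ⟨a, b, ha, _, hb⟩ := D.ρ_supp
  constructor
  · refine (isCompact_closedBall (0 : Euc d) b).of_isClosed_subset (isClosed_tsupport _) ?_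
    intro ξ hξ
    simpa using norm_le_of_two_pi_smul (hb (D.tsupport_fourier_kernel_zero_subset hξ)).2
  · intro h
    have := (hb (D.tsupport_fourier_kernel_zero_subset h)).1
    simp at this
    linarith

theorem tsupport_comp_smul {E : Type*} [Zero E] (f : Euc d → E) {c : ℝ} (hc : c ≠ 0) {z : Euc d}
    (h : c • z ∈ tsupport f) : z ∈ tsupport fun z => f (c • z) := by
  rw [tsupport, mem_closure_iff_nhds] at h ⊢
  intro U hU
  have hc' : Continuous fun z : Euc d => c⁻¹ • z := by fun_prop
  have h1 : (fun z : Euc d => c⁻¹ • z) ⁻¹' U ∈ 𝓝 (c • z) := by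
    apply hc'.continuousAt
    simpa [smul_smul, inv_mul_cancel₀ hc] using hU
  obtain ⟨y, hy1, hy2⟩ := h _ h1
  refine ⟨c⁻¹ • y, hy1, ?_⟩
  simpa [smul_smul, mul_inv_cancel₀ hc] using hy2

theorem neg_mem_tsupport_χ {z : Euc d} (h : z ∈ tsupport D.χ) : -z ∈ tsupport D.χ := by
  have e : D.χ = fun z => D.χ ((-1 : ℝ) • z) := by
    ext z
    exact D.χ_radial _ _ (by simp)
  rw [e]
  refine tsupport_comp_smul D.χ (by norm_num) ?_
  simpa using h

/-- One kernel `H` serves all scales. The factor `2` appears because `K_{<i-1}` lives at twice the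
scale of `K_i`. Its spectrum, given by `χ(2·)` up to normalization, misses that of `ρ`, which is
`disjoint_χ` for `j = 1` after dilation; the reflection in the sum condition is harmless by radial
symmetry. -/
theorem exists_annular :
    ∃ H : 𝓢(Euc d, ℂ), IsAnnular H ∧
      (∀ w t, D.kernel 0 (w - t) = ∫ w', H (w - w') * D.kernel 0 (w' - t)) ∧
      ∀ w z t, rescale (D.kernel (-1)) 0 2 (w - z) * D.kernel 0 (w - t) =
        ∫ w', H (w - w') * (rescale (D.kernel (-1)) 0 2 (w' - z) * D.kernel 0 (w' - t)) := by
  have hsub : tsupport (𝓕 (rescale (D.kernel (-1)) 0 2) : 𝓢(Euc d, ℂ)) ⊆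
      {ξ | (2 * Real.pi) • (2 : ℝ) • ξ ∈ tsupport D.χ} := by
    refine closure_minimal (fun ξ hξ => ?_) ((isClosed_tsupport D.χ).preimage
      (by fun_prop : Continuous fun ξ => (2 * Real.pi) • (2 : ℝ) • ξ))
    rw [Function.mem_support, fourier_rescale _ _ _ two_pos, fourier_kernel,
      symbol_neg_one] at hξ
    refine subset_tsupport D.χ (Function.mem_support.2 ?_)
    simpa using hξ
  refine exists_annular_reproducing ?_ D.isAnnular_kernel_zero.1 D.isAnnular_kernel_zero.2 ?_
  · obtain ⟨b, _, hb⟩ := D.χ_supp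
    refine (isCompact_closedBall (0 : Euc d) b).of_isClosed_subset (isClosed_tsupport _) ?_
    intro ξ hξ
    have h1 := norm_le_of_two_pi_smul (hb (hsub hξ))
    rw [norm_smul] at h1
    simp at h1 ⊢
    linarith [norm_nonneg ξ]
  · intro ξ hξ hξ'
    have h1 := D.neg_mem_tsupport_χ (hsub hξ)
    have h2 : (2 * Real.pi) • -ξ ∈ tsupport D.ρ := D.tsupport_fourier_kernel_zero_subset hξ'
    refine Set.disjoint_left.1 (D.disjoint_χ 1 le_rfl) h1 ?_
    refine tsupport_comp_smul D.ρ (by positivity) ?_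
    convert h2 using 1
    rw [← smul_neg, ← smul_neg, smul_comm (2 * Real.pi) (2 : ℝ), smul_smul]
    norm_num

/-- The blocks `j ≥ 2` do not see the low-frequency correction left over because the comparison of
paraproduct blocks starts at `i = 1`. -/
theorem fourier_kernel_mul_kernelLt_one {j : ℕ} (hj : 2 ≤ j) (ξ : Euc d) :
    (𝓕 (D.kernel j) : 𝓢(Euc d, ℂ)) ξ * (𝓕 (D.kernelLt 1) : 𝓢(Euc d, ℂ)) ξ = 0 := by
  have e : D.kernelLt 1 = D.kernel (-1) + D.kernel ((0 : ℕ) : ℤ) := by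
    simpa using D.kernelLt_natCast_eq_add 1
  rw [e, FourierTransform.fourier_add, add_apply, fourier_kernel, fourier_kernel, fourier_kernel,
    symbol_natCast, symbol_natCast, symbol_neg_one]
  set z := (2 * Real.pi) • ξ
  by_cases h : D.ρ (dyadicScale j • z) = 0
  · simp [h]
  have h1 : z ∈ tsupport fun z => D.ρ ((2 : ℝ) ^ (-(j : ℤ)) • z) := by
    refine subset_tsupport _ ?_
    rwa [Function.mem_support, ← dyadicScale_eq_zpow]
  have h2 : D.χ z = 0 := by
    by_contra hne
    exact Set.disjoint_left.1 (D.disjoint_χ j (by omega)) (subset_tsupport _ hne) h1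
  have h3 : D.ρ (dyadicScale 0 • z) = 0 := by
    by_contra hne
    refine Set.disjoint_left.1 (D.disjoint_ρ 0 j ?_)
      (subset_tsupport _ (by rwa [Function.mem_support, ← dyadicScale_eq_zpow])) h1
    rw [Nat.cast_zero, zero_sub, abs_neg, Nat.abs_cast]
    omega
  simp [h2, h3]

end DyadicPartition

end

section

open Filter Topology SchwartzMap

/-! ### Bounds for models against Schwartz functions -/

namespace RegularityStructure

variable (S : RegularityStructure.{u})

/-- An infinite set of homogeneities between `min A` and `γ` would accumulate in a compact interval.
Finiteness lets the bounds be summed over homogeneities. -/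
theorem finite_lt (γ : ℝ) : {α : S.A | (α : ℝ) < γ}.Finite := by
  have : (S.A ∩ Set.Icc S.minA γ).Finite := by
    by_contra hinf
    obtain ⟨x, _, hx⟩ := Set.Infinite.exists_accPt_of_subset_isCompact hinf isCompact_Icc
      Set.inter_subset_right
    exact S.no_accPt x (hx.mono (principal_mono.2 Set.inter_subset_left))
  refine (this.preimage (Subtype.val_injective.injOn)).subset fun α hα => ?_
  exact ⟨α.2, S.isLeast_minA.2 α.2, le_of_lt hα⟩

/-- The homogeneities below `γ`. -/
def lowIdx (γ : ℝ) : Finset S.A := (S.finite_lt γ).toFinset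

variable {S}

theorem mem_lowIdx {γ : ℝ} {α : S.A} : α ∈ S.lowIdx γ ↔ (α : ℝ) < γ := by
  simp [lowIdx]

theorem minA_le (α : S.A) : S.minA ≤ α := S.isLeast_minA.2 α.2

theorem minA_nonpos : S.minA ≤ 0 := S.isLeast_minA.2 S.zero_mem

theorem eq_sum_incl {F : Finset S.A} {τ : S.Space} (h : ∀ α, α ∉ F → τ α = 0) :
    τ = ∑ α ∈ F, S.incl α (τ α) := by
  refine DFinsupp.ext fun β => ?_
  have e : (∑ α ∈ F, S.incl α (τ α)) β = ∑ α ∈ F, S.incl α (τ α) β :=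
    DFinsupp.finsetSum_apply F (fun α => S.incl α (τ α)) β
  rw [e]
  by_cases hβ : β ∈ F
  · rw [Finset.sum_eq_single_of_mem β hβ]
    · exact (DirectSum.lof_apply ℝ β (τ β)).symm
    · intro α _ hne
      exact DirectSum.of_eq_of_ne _ _ _ hne.symm
  · rw [h β hβ, Finset.sum_eq_zero]
    intro α hα
    refine DirectSum.of_eq_of_ne _ _ _ ?_
    rintro rfl
    exact hβ hα

theorem G_apply_same {g : S.Space ≃ₗ[ℝ] S.Space} (hg : g ∈ S.G) (α : S.A) (τ : S.T α) :
    g (S.incl α τ) α = τ := by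
  have h := S.sub_lower g hg α τ α (lt_irrefl _)
  rw [DirectSum.sub_apply, sub_eq_zero] at h
  rw [h]
  exact DirectSum.lof_apply ℝ α τ

theorem G_apply_of_lt {g : S.Space ≃ₗ[ℝ] S.Space} (hg : g ∈ S.G) {α β : S.A} (hαβ : α < β)
    (τ : S.T α) : g (S.incl α τ) β = 0 := by
  have h := S.sub_lower g hg α τ β (not_lt.2 hαβ.le)
  rw [DirectSum.sub_apply, sub_eq_zero] at h
  rw [h]
  exact DirectSum.of_eq_of_ne _ _ _ hαβ.ne'

/-- Triangularity preserves the truncation below `γ`, so local descriptions transported to another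
base point are still finite sums over `lowIdx γ`. -/
theorem G_apply_eq_zero {g : S.Space ≃ₗ[ℝ] S.Space} (hg : g ∈ S.G) {γ : ℝ} {τ : S.Space}
    (hτ : ∀ α : S.A, γ ≤ α → τ α = 0) (β : S.A) (hβ : γ ≤ β) : g τ β = 0 := by
  rw [eq_sum_incl (F := S.lowIdx γ) (τ := τ) fun α hα => hτ α (by simpa [mem_lowIdx] using hα),
    map_sum]
  refine (DFinsupp.finsetSum_apply _ _ β).trans (Finset.sum_eq_zero fun α hα => ?_)
  exact G_apply_of_lt hg (show (α : ℝ) < β from lt_of_lt_of_le (mem_lowIdx.1 hα) hβ) _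

end RegularityStructure

namespace SchwartzMap

variable {d : ℕ}

/-- By Leibniz and a Peetre-type inequality, a window seen around `k` inherits the decay of `V` in
`k`, while `ψ` supplies the decay in `y`. -/
theorem norm_iteratedFDeriv_prodS_shift_le (V ψ : 𝓢(Euc d, ℂ)) (m : ℕ) {N K : ℝ} (hN : 0 ≤ N) :
    ∃ C, 0 ≤ C ∧ ∀ k y, ‖iteratedFDeriv ℝ m (prodS (V.compSubConstCLM ℂ (-k)) ψ) y‖
      ≤ C * (1 + ‖k‖) ^ (-N) * (1 + ‖y‖) ^ (-K) := by
  choose C hC h using decay_rpow V N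
  choose C' hC' h' using decay_rpow ψ (N + K)
  refine ⟨∑ i ∈ Finset.range (m + 1), (m.choose i : ℝ) * C i * C' (m - i),
    Finset.sum_nonneg fun i _ => by have := hC i; have := hC' (m - i); positivity, fun k y => ?_⟩
  have e : (prodS (V.compSubConstCLM ℂ (-k)) ψ : Euc d → ℂ)
      = fun y => V.compSubConstCLM ℂ (-k) y * ψ y := by
    ext y; rw [prodS_apply]
  rw [e]
  refine (norm_iteratedFDeriv_mul_le ((V.compSubConstCLM ℂ (-k)).smooth m) (ψ.smooth m) y
    le_rfl).trans ?_
  rw [Finset.sum_mul, Finset.sum_mul]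
  refine Finset.sum_le_sum fun i _ => ?_
  rw [iteratedFDeriv_shift, sub_neg_eq_add]
  have hy0 : 0 < 1 + ‖y‖ := by positivity
  have hyk0 : 0 < 1 + ‖y + k‖ := by positivity
  have hk0 : 0 < 1 + ‖k‖ := by positivity
  have hkey : (1 + ‖y + k‖) ^ (-N) * (1 + ‖y‖) ^ (-N) ≤ (1 + ‖k‖) ^ (-N) := by
    rw [← Real.mul_rpow hyk0.le hy0.le]
    refine Real.rpow_le_rpow_of_nonpos hk0 ?_ (by linarith)
    have := one_add_norm_le_mul (-y) k
    rw [sub_neg_eq_add, norm_neg, add_comm k y] at this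
    linarith
  have := hC i
  have := hC' (m - i)
  calc (m.choose i : ℝ) * ‖iteratedFDeriv ℝ i V (y + k)‖ * ‖iteratedFDeriv ℝ (m - i) ψ y‖
      ≤ (m.choose i : ℝ) * (C i * (1 + ‖y + k‖) ^ (-N)) * (C' (m - i) * (1 + ‖y‖) ^ (-(N + K))) := by
        gcongr
        · exact h i _
        · exact h' _ _
    _ = (m.choose i : ℝ) * C i * C' (m - i) *
        ((1 + ‖y + k‖) ^ (-N) * (1 + ‖y‖) ^ (-N)) * (1 + ‖y‖) ^ (-K) := by
        rw [neg_add, Real.rpow_add hy0]; ring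
    _ ≤ _ := by gcongr

theorem prodS_shift (V ψ : 𝓢(Euc d, ℂ)) (k : Euc d) :
    prodS V (ψ.compSubConstCLM ℂ k)
      = (prodS (V.compSubConstCLM ℂ (-k)) ψ).compSubConstCLM ℂ k := by
  ext y
  simp [prodS_apply]

theorem integrableSeminorms_prodS_shift (V ψ : 𝓢(Euc d, ℂ)) :
    IntegrableSeminorms fun k => prodS V (ψ.compSubConstCLM ℂ k) := by
  intro K m
  obtain ⟨C, hC, h⟩ := norm_iteratedFDeriv_prodS_shift_le V ψ m (N := K + (d + 1)) (K := K)
    (by positivity)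
  refine ⟨fun k => C * (1 + ‖k‖) ^ (-((d : ℝ) + 1)),
    (integrable_one_add_norm_euc (by linarith)).const_mul C, fun k => ?_⟩
  refine seminorm_le_bound ℂ K m _ (by positivity) fun y => ?_
  beta_reduce
  rw [prodS_shift, iteratedFDeriv_shift]
  have hk0 : 0 < 1 + ‖k‖ := by positivity
  have hy0 : 0 < 1 + ‖y - k‖ := by positivity
  calc ‖y‖ ^ K * ‖iteratedFDeriv ℝ m (prodS (V.compSubConstCLM ℂ (-k)) ψ) (y - k)‖
      ≤ ((1 + ‖k‖) * (1 + ‖y - k‖)) ^ K *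
        (C * (1 + ‖k‖) ^ (-((K : ℝ) + (d + 1))) * (1 + ‖y - k‖) ^ (-(K : ℝ))) := by
        gcongr
        · exact (by linarith : ‖y‖ ≤ 1 + ‖y‖).trans (one_add_norm_le_mul k y)
        · exact h k _
    _ = C * ((1 + ‖k‖) ^ (K : ℝ) * (1 + ‖k‖) ^ (-((K : ℝ) + (d + 1)))) *
        ((1 + ‖y - k‖) ^ (K : ℝ) * (1 + ‖y - k‖) ^ (-(K : ℝ))) := by
        rw [mul_pow, ← Real.rpow_natCast, ← Real.rpow_natCast]; ring
    _ = C * (1 + ‖k‖) ^ (-((d : ℝ) + 1)) := by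
        rw [← Real.rpow_add hk0, ← Real.rpow_add hy0, add_neg_cancel, Real.rpow_zero, mul_one]
        congr 2; ring

/-- A smooth bump function of integral one supported in the unit ball. -/
theorem exists_unit_bump (d : ℕ) : ∃ ψ : 𝓢(Euc d, ℂ), tsupport ψ ⊆ Metric.closedBall 0 1 ∧
    ∫ y, ψ y = 1 := by
  let b : ContDiffBump (0 : Euc d) := ⟨1 / 2, 1, by norm_num, by norm_num⟩
  have hc : HasCompactSupport fun z => (b.normed volume z : ℂ) :=
    b.hasCompactSupport_normed.comp_left (g := fun t : ℝ => (t : ℂ)) Complex.ofReal_zero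
  refine ⟨hc.toSchwartzMap (Complex.ofRealCLM.contDiff.comp b.contDiff_normed), ?_, ?_⟩
  · refine (closure_mono (fun z hz => ?_)).trans (b.tsupport_normed_eq (μ := volume)).le
    have hz' : (b.normed volume z : ℂ) ≠ 0 := hz
    simpa using hz'
  · change ∫ y, (b.normed volume y : ℂ) = 1
    rw [integral_complex_ofReal, b.integral_normed, Complex.ofReal_one]

end SchwartzMap

namespace Model

variable {S : RegularityStructure.{u}} {d : ℕ} {r : ℝ} (M : Model S d r)

open RegularityStructure

theorem Pi_eq_sum {F : Finset S.A} {τ : S.Space} (h : ∀ α, α ∉ F → τ α = 0) (x : Euc d)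
    (φ : 𝓢(Euc d, ℂ)) : M.Pi x τ φ = ∑ α ∈ F, M.Pi x (S.incl α (τ α)) φ := by
  conv_lhs => rw [eq_sum_incl h, map_sum]
  exact _root_.sum_apply _ _ _

/-- The bounds of the model for a Schwartz function in place of a compactly supported one. -/
theorem exists_bound_schwartz (hr : 0 < r) (γ₀ : ℝ) (V : 𝓢(Euc d, ℂ)) :
    ∃ C, 0 ≤ C ∧ ∀ (α : S.A), (α : ℝ) < γ₀ → ∀ (τ : S.T α) (x : Euc d) (lam : ℝ), 0 < lam →
      lam ≤ 1 → ‖M.Pi x (S.incl α τ) (rescale V x lam)‖ ≤ C * lam ^ (α : ℝ) * ‖τ‖ := by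
  obtain ⟨C₀', hP', hG'⟩ := M.bounds (max γ₀ 1) (by positivity)
  set C₀ := max C₀' 0 with hC₀
  have hC₀0 : 0 ≤ C₀ := le_max_right _ _
  obtain ⟨ψ, hψs, hψ1⟩ := exists_unit_bump d
  set n := ⌊r⌋₊
  -- `E` bounds the power of `‖k‖` produced by reexpansion from `x` to `x + lam k`; the window must
  -- decay like `-(E + d + 1)` to remain integrable in `k`.
  set E := max (γ₀ - S.minA) 0 with hE
  have hE0 : 0 ≤ E := le_max_right _ _
  choose B hB hBd using fun m : ℕ => norm_iteratedFDeriv_prodS_shift_le V ψ m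
    (N := E + (d + 1)) (K := 0) (by positivity)
  set b : ℝ := 1 + ∑ m ∈ Finset.range (n + 2), B m with hb
  have hb0 : 0 < b := by
    have := Finset.sum_nonneg fun m (_ : m ∈ Finset.range (n + 2)) => hB m
    positivity
  set Q : ℝ := (S.lowIdx γ₀).card * (((n : ℝ) + 3) * b * (C₀ * (C₀ + 1))) with hQ
  have hQ0 : 0 ≤ Q := by positivity
  have hw := integrable_one_add_norm_euc (d := d) (r := d + 1) (by linarith)
  refine ⟨Q * ∫ k : Euc d, (1 + ‖k‖) ^ (-((d : ℝ) + 1)), by positivity, ?_⟩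
  intro α hα τ x lam hl hl1
  have hαm : (α : ℝ) ≤ max γ₀ 1 := hα.le.trans (le_max_left _ _)
  set u := compDist (M.Pi x (S.incl α τ)) (rescaleCLM x lam) with hu
  -- The continuous partition of unity `∫ ψ(· - k) dk = 1` cuts `V` into windows supported in unit
  -- balls.
  have hpet := pairing_integral u (fun k => prodS V (ψ.compSubConstCLM ℂ k))
    ((SchwartzMap.pairing (ContinuousLinearMap.mul ℂ ℂ) V).continuous.comp (continuous_shift ψ))
    (integrableSeminorms_prodS_shift V ψ) V (fun z => by
      simp_rw [prodS_apply, compSubConstCLM_apply]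
      rw [integral_const_mul, integral_sub_left_eq_self (fun y => ψ y) volume z, hψ1, mul_one])
  have e0 : M.Pi x (S.incl α τ) (rescale V x lam) = u V := by
    rw [hu, compDist_apply, rescaleCLM_apply _ _ hl]
  rw [e0, ← hpet.2]
  have hpt : ∀ k, ‖u (prodS V (ψ.compSubConstCLM ℂ k))‖
      ≤ Q * lam ^ (α : ℝ) * ‖τ‖ * (1 + ‖k‖) ^ (-((d : ℝ) + 1)) := by
    intro k
    have hk0 : 0 < 1 + ‖k‖ := by positivity
    set η := prodS (V.compSubConstCLM ℂ (-k)) ψ with hη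
    set x' := x + lam • k with hx'
    have hxx' : ‖x' - x‖ = lam * ‖k‖ := by
      rw [hx', add_sub_cancel_left, norm_smul, Real.norm_of_nonneg hl.le]
    -- Each window is recentred at `x'`, where the model bound applies once the symbol has been
    -- transported by `Γ x' x`.
    have e1 : u (prodS V (ψ.compSubConstCLM ℂ k))
        = M.Pi x' (M.Γ x' x (S.incl α τ)) (rescale η x' lam) := by
      rw [hu, compDist_apply, rescaleCLM_apply _ _ hl, prodS_shift, rescale_shift _ _ _ hl,
        M.Pi_Γ]
    have hηs : tsupport η ⊆ Metric.closedBall 0 1 := by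
      refine Set.Subset.trans ?_ hψs
      have : (η : Euc d → ℂ) = fun y => V.compSubConstCLM ℂ (-k) y * ψ y := by
        ext y; rw [hη, prodS_apply]
      rw [this]
      exact tsupport_mul_subset_right
    have hηb : ∀ m ≤ n + 1, ∀ y, ‖iteratedFDeriv ℝ m η y‖
        ≤ b * (1 + ‖k‖) ^ (-(E + (d + 1))) := by
      intro m hm y
      refine (hBd m k y).trans ?_
      rw [neg_zero, Real.rpow_zero, mul_one]
      gcongr
      have := Finset.single_le_sum (f := B) (fun i _ => hB i)
        (Finset.mem_range.2 (by omega : m < n + 2))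
      linarith
    have hb' : 0 < b * (1 + ‖k‖) ^ (-(E + ((d : ℝ) + 1))) := by positivity
    rw [e1, M.Pi_eq_sum (F := S.lowIdx γ₀) (fun β hβ => by
      rw [mem_lowIdx, not_lt] at hβ
      exact G_apply_of_lt (M.Γ_mem _ _) (show (α : ℝ) < β from lt_of_lt_of_le hα hβ) τ)]
    have hterm : ∀ β ∈ S.lowIdx γ₀, ‖M.Pi x' (S.incl β ((M.Γ x' x (S.incl α τ)) β))
        (rescale η x' lam)‖ ≤ (((n : ℝ) + 3) * b * (C₀ * (C₀ + 1))) *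
          (lam ^ (α : ℝ) * ‖τ‖ * (1 + ‖k‖) ^ (-((d : ℝ) + 1))) := by
      intro β hβ
      rw [mem_lowIdx] at hβ
      have hβm : (β : ℝ) ≤ max γ₀ 1 := hβ.le.trans (le_max_left _ _)
      rcases lt_or_ge α β with hlt | hle
      · rw [G_apply_of_lt (M.Γ_mem _ _) hlt τ, map_zero, map_zero]
        change ‖(0 : ℂ)‖ ≤ _
        rw [norm_zero]
        positivity
      · have hle' : (β : ℝ) ≤ α := hle
        -- The extra `1` covers `β = α`, where the diagonal component of `Γ` is the identity and the
        -- model gives no bound.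
        have hΓ : ‖(M.Γ x' x (S.incl α τ)) β‖
            ≤ (C₀ + 1) * (lam * ‖k‖) ^ ((α : ℝ) - β) * ‖τ‖ := by
          rcases hle.lt_or_eq with hlt | rfl
          · refine (hG' α hαm β hlt τ x' x).trans ?_
            rw [hxx']
            gcongr
            exact (le_max_left _ _).trans (by linarith)
          · rw [G_apply_same (M.Γ_mem _ _), sub_self, Real.rpow_zero]
            nlinarith [norm_nonneg τ]
        have h1 := norm_pairing_le_of_unitTest hr hb' hηs hηb
          (M.Pi x' (S.incl β ((M.Γ x' x (S.incl α τ)) β))) (x := x') hl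
          (fun ζ hζ => hP' β hβm _ ζ hζ x' lam hl hl1)
        refine h1.trans ?_
        have h2 : (lam * ‖k‖) ^ ((α : ℝ) - β) * lam ^ (β : ℝ)
            ≤ lam ^ (α : ℝ) * (1 + ‖k‖) ^ E := by
          rw [Real.mul_rpow hl.le (norm_nonneg _)]
          have h3 : ‖k‖ ^ ((α : ℝ) - β) ≤ (1 + ‖k‖) ^ E := by
            calc ‖k‖ ^ ((α : ℝ) - β) ≤ (1 + ‖k‖) ^ ((α : ℝ) - β) :=
                  Real.rpow_le_rpow (norm_nonneg _) (by linarith) (by linarith)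
              _ ≤ (1 + ‖k‖) ^ E := by
                  refine Real.rpow_le_rpow_of_exponent_le (by linarith [norm_nonneg k]) ?_
                  refine le_trans ?_ (le_max_left _ _)
                  linarith [minA_le β]
          calc lam ^ ((α : ℝ) - β) * ‖k‖ ^ ((α : ℝ) - β) * lam ^ (β : ℝ)
              = (lam ^ ((α : ℝ) - β) * lam ^ (β : ℝ)) * ‖k‖ ^ ((α : ℝ) - β) := by ring
            _ = lam ^ (α : ℝ) * ‖k‖ ^ ((α : ℝ) - β) := by
                rw [← Real.rpow_add hl, sub_add_cancel]
            _ ≤ _ := by gcongr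
        calc ((n : ℝ) + 3) * (b * (1 + ‖k‖) ^ (-(E + ((d : ℝ) + 1)))) *
              (C₀' * lam ^ (β : ℝ) * ‖(M.Γ x' x (S.incl α τ)) β‖)
            ≤ ((n : ℝ) + 3) * (b * (1 + ‖k‖) ^ (-(E + ((d : ℝ) + 1)))) *
              (C₀ * lam ^ (β : ℝ) * ((C₀ + 1) * (lam * ‖k‖) ^ ((α : ℝ) - β) * ‖τ‖)) := by
              gcongr
              exact le_max_left _ _
          _ = ((n : ℝ) + 3) * b * (C₀ * (C₀ + 1)) * (1 + ‖k‖) ^ (-(E + ((d : ℝ) + 1))) * ‖τ‖ *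
              ((lam * ‖k‖) ^ ((α : ℝ) - β) * lam ^ (β : ℝ)) := by ring
          _ ≤ ((n : ℝ) + 3) * b * (C₀ * (C₀ + 1)) * (1 + ‖k‖) ^ (-(E + ((d : ℝ) + 1))) * ‖τ‖ *
              (lam ^ (α : ℝ) * (1 + ‖k‖) ^ E) := by gcongr
          _ = ((n : ℝ) + 3) * b * (C₀ * (C₀ + 1)) * (lam ^ (α : ℝ) * ‖τ‖ *
              ((1 + ‖k‖) ^ (-(E + ((d : ℝ) + 1))) * (1 + ‖k‖) ^ E)) := by ring
          _ = _ := by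
              rw [← Real.rpow_add hk0]
              congr 4; ring
    refine (norm_sum_le_of_le _ hterm).trans (le_of_eq ?_)
    rw [Finset.sum_const, nsmul_eq_mul, hQ]
    ring
  refine (norm_integral_le_of_norm_le (hw.const_mul _) (Eventually.of_forall hpt)).trans
    (le_of_eq ?_)
  rw [integral_const_mul]
  ring

end Model

end

section

open Filter Topology SchwartzMap

/-! ### Local descriptions of a modelled distribution -/

namespace Model

variable {S : RegularityStructure.{u}} {d : ℕ} {r γ : ℝ} (M : Model S d r)

open RegularityStructure

variable {M}

theorem exists_bound_modelled (f : M.modelled γ) : ∃ C, 0 ≤ C ∧ ∀ α : S.A, (α : ℝ) < γ →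
    (∀ x y, ‖(f.1 x - M.Γ x y (f.1 y)) α‖ ≤ C * ‖x - y‖ ^ (γ - (α : ℝ))) ∧
    ∀ x, ‖f.1 x α‖ ≤ C := by
  have h : ∀ α : S.A, ∃ C, 0 ≤ C ∧ ((α : ℝ) < γ →
      (∀ x y, ‖(f.1 x - M.Γ x y (f.1 y)) α‖ ≤ C * ‖x - y‖ ^ (γ - (α : ℝ))) ∧
      ∀ x, ‖f.1 x α‖ ≤ C) := by
    intro α
    by_cases hα : (α : ℝ) < γ
    · obtain ⟨C, h1, h2⟩ := f.2.2 α hα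
      exact ⟨C, (norm_nonneg _).trans (h2 0), fun _ => ⟨h1, h2⟩⟩
    · exact ⟨0, le_rfl, fun h => absurd h hα⟩
  choose C hC h using h
  refine ⟨∑ α ∈ S.lowIdx γ, C α, Finset.sum_nonneg fun α _ => hC α, fun α hα => ?_⟩
  have hle := Finset.single_le_sum (f := C) (fun i _ => hC i) (mem_lowIdx.2 hα)
  refine ⟨fun x y => ((h α hα).1 x y).trans ?_, fun x => ((h α hα).2 x).trans hle⟩
  gcongr

/-- Both descriptions are expanded at a third point `x`, where the test function will be centred;
the model estimates can then be used at that base point. -/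
theorem Pi_sub_eq_sum (f : M.modelled γ) (x y z : Euc d) (φ : 𝓢(Euc d, ℂ)) :
    M.Pi z (f.1 z) φ - M.Pi y (f.1 y) φ = ∑ α ∈ S.lowIdx γ,
      M.Pi x (S.incl α ((M.Γ x z (f.1 z) - M.Γ x y (f.1 y)) α)) φ := by
  rw [← M.Pi_Γ x z, ← M.Pi_Γ x y, ← M.Pi_eq_sum, map_sub]
  · rfl
  · intro α hα
    rw [mem_lowIdx, not_lt] at hα
    rw [DirectSum.sub_apply, G_apply_eq_zero (M.Γ_mem _ _) (f.2.1 z) α hα,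
      G_apply_eq_zero (M.Γ_mem _ _) (f.2.1 y) α hα, sub_zero]

/-- Comparison of the local descriptions of a modelled distribution at two points. -/
theorem exists_bound_sub_sum (hr : 0 < r) (f : M.modelled γ) (V : 𝓢(Euc d, ℂ)) :
    ∃ C, 0 ≤ C ∧ ∀ (x y z : Euc d) (μ : ℝ), 0 < μ → μ ≤ 1 →
      ‖M.Pi z (f.1 z) (rescale V x μ) - M.Pi y (f.1 y) (rescale V x μ)‖ ≤
        C * ∑ α ∈ S.lowIdx γ,
          μ ^ (α : ℝ) * (‖x - z‖ ^ (γ - (α : ℝ)) + ‖x - y‖ ^ (γ - (α : ℝ))) := by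
  obtain ⟨C, hC, h⟩ := M.exists_bound_schwartz hr γ V
  obtain ⟨C', hC', h'⟩ := exists_bound_modelled f
  refine ⟨C * C', by positivity, fun x y z μ hμ hμ1 => ?_⟩
  rw [Pi_sub_eq_sum f x, Finset.mul_sum]
  refine norm_sum_le_of_le _ fun α hα => ?_
  rw [mem_lowIdx] at hα
  refine (h α hα _ x μ hμ hμ1).trans ?_
  have e : (M.Γ x z (f.1 z) - M.Γ x y (f.1 y)) α
      = (f.1 x - M.Γ x y (f.1 y)) α - (f.1 x - M.Γ x z (f.1 z)) α := by
    rw [← DirectSum.sub_apply]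
    congr 1
    abel
  have h1 : ‖(M.Γ x z (f.1 z) - M.Γ x y (f.1 y)) α‖
      ≤ C' * (‖x - z‖ ^ (γ - (α : ℝ)) + ‖x - y‖ ^ (γ - (α : ℝ))) := by
    rw [e]
    refine (norm_sub_le _ _).trans ?_
    linarith [(h' α hα).1 x y, (h' α hα).1 x z]
  calc C * μ ^ (α : ℝ) * ‖(M.Γ x z (f.1 z) - M.Γ x y (f.1 y)) α‖
      ≤ C * μ ^ (α : ℝ) * (C' * (‖x - z‖ ^ (γ - (α : ℝ)) + ‖x - y‖ ^ (γ - (α : ℝ)))) := by gcongr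
    _ = _ := by ring

/-- Each summand `μ^α t^{γ-α}` equals `μ^γ (t/μ)^{γ-α}`, and the largest possible exponent is `γ -
min A`. In units of `μ` this is `μ^γ` with polynomial growth. -/
theorem exists_bound_sub (hr : 0 < r) (f : M.modelled γ) (V : 𝓢(Euc d, ℂ)) :
    ∃ C, 0 ≤ C ∧ ∀ (x y z : Euc d) (μ : ℝ), 0 < μ → μ ≤ 1 →
      ‖M.Pi z (f.1 z) (rescale V x μ) - M.Pi y (f.1 y) (rescale V x μ)‖ ≤
        C * μ ^ γ * ((1 + ‖x - z‖ / μ) ^ (γ - S.minA) + (1 + ‖x - y‖ / μ) ^ (γ - S.minA)) := by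
  obtain ⟨C, hC, h⟩ := exists_bound_sub_sum hr f V
  refine ⟨C * (S.lowIdx γ).card, by positivity, fun x y z μ hμ hμ1 => ?_⟩
  refine (h x y z μ hμ hμ1).trans ?_
  rw [mul_assoc, mul_assoc]
  refine mul_le_mul_of_nonneg_left ?_ hC
  rw [← nsmul_eq_mul]
  refine Finset.sum_le_card_nsmul _ _ _ fun α hα => ?_
  rw [mem_lowIdx] at hα
  have key : ∀ t : ℝ, 0 ≤ t → μ ^ (α : ℝ) * t ^ (γ - (α : ℝ))
      ≤ μ ^ γ * (1 + t / μ) ^ (γ - S.minA) := by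
    intro t ht
    have ht' : 0 ≤ t / μ := by positivity
    calc μ ^ (α : ℝ) * t ^ (γ - (α : ℝ))
        = μ ^ (α : ℝ) * (μ * (t / μ)) ^ (γ - (α : ℝ)) := by rw [mul_div_cancel₀ _ hμ.ne']
      _ = μ ^ γ * (t / μ) ^ (γ - (α : ℝ)) := by
          rw [Real.mul_rpow hμ.le ht', ← mul_assoc, ← Real.rpow_add hμ]
          congr 2; ring
      _ ≤ μ ^ γ * (1 + t / μ) ^ (γ - (α : ℝ)) := by
          gcongr
          linarith
      _ ≤ μ ^ γ * (1 + t / μ) ^ (γ - S.minA) := by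
          refine mul_le_mul_of_nonneg_left ?_ (by positivity)
          exact Real.rpow_le_rpow_of_exponent_le (by linarith) (by linarith [minA_le α])
  rw [mul_add, mul_add]
  exact add_le_add (key _ (norm_nonneg _)) (key _ (norm_nonneg _))

/-- Compare with the description at `x` itself, whose components are uniformly bounded; the lowest
homogeneity dictates the power of `μ`. -/
theorem exists_bound_growth (hr : 0 < r) (f : M.modelled γ) (V : 𝓢(Euc d, ℂ)) :
    ∃ C, 0 ≤ C ∧ ∀ (x z : Euc d) (μ : ℝ), 0 < μ → μ ≤ 1 →
      ‖M.Pi z (f.1 z) (rescale V x μ)‖ ≤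
        C * μ ^ S.minA * (1 + ‖x - z‖) ^ (γ - S.minA) := by
  obtain ⟨C, hC, h⟩ := M.exists_bound_schwartz hr γ V
  obtain ⟨C', hC', h'⟩ := exists_bound_modelled f
  obtain ⟨C₂, hC₂, h₂⟩ := exists_bound_sub_sum hr f V
  refine ⟨(S.lowIdx γ).card * (C * C' + C₂), by positivity, fun x z μ hμ hμ1 => ?_⟩
  set A := μ ^ S.minA * (1 + ‖x - z‖) ^ (γ - S.minA) with hA
  have hA0 : 0 ≤ A := by positivity
  have hμα : ∀ α : S.A, μ ^ (α : ℝ) ≤ μ ^ S.minA := fun α =>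
    Real.rpow_le_rpow_of_exponent_ge hμ hμ1 (minA_le α)
  have h1 : ‖M.Pi x (f.1 x) (rescale V x μ)‖ ≤ (S.lowIdx γ).card * (C * C') * A := by
    rw [M.Pi_eq_sum (F := S.lowIdx γ) fun α hα => f.2.1 x α (by simpa [mem_lowIdx] using hα),
      mul_assoc, ← nsmul_eq_mul]
    refine (norm_sum_le _ _).trans (Finset.sum_le_card_nsmul _ _ _ fun α hα => ?_)
    rw [mem_lowIdx] at hα
    have hγa : 0 ≤ γ - S.minA := by linarith [minA_le α]
    have h1A : μ ^ S.minA ≤ A :=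
      le_mul_of_one_le_right (by positivity)
        (Real.one_le_rpow (by linarith [norm_nonneg (x - z)]) hγa)
    calc _ ≤ C * μ ^ (α : ℝ) * ‖f.1 x α‖ := h α hα _ x μ hμ hμ1
      _ ≤ C * A * C' := by
          gcongr
          · exact (hμα α).trans h1A
          · exact (h' α hα).2 x
      _ = _ := by ring
  have h2 : ‖M.Pi z (f.1 z) (rescale V x μ) - M.Pi x (f.1 x) (rescale V x μ)‖
      ≤ (S.lowIdx γ).card * C₂ * A := by
    refine (h₂ x x z μ hμ hμ1).trans ?_
    rw [mul_comm _ C₂, mul_assoc]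
    refine mul_le_mul_of_nonneg_left ?_ hC₂
    rw [← nsmul_eq_mul]
    refine Finset.sum_le_card_nsmul _ _ _ fun α hα => ?_
    rw [mem_lowIdx] at hα
    rw [sub_self, norm_zero, Real.zero_rpow (by linarith), add_zero]
    refine mul_le_mul (hμα α) ?_ (by positivity) (by positivity)
    calc ‖x - z‖ ^ (γ - (α : ℝ)) ≤ (1 + ‖x - z‖) ^ (γ - (α : ℝ)) :=
          Real.rpow_le_rpow (norm_nonneg _) (by linarith) (by linarith)
      _ ≤ _ := Real.rpow_le_rpow_of_exponent_le (by linarith [norm_nonneg (x - z)])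
          (by linarith [minA_le α])
  calc _ = ‖M.Pi x (f.1 x) (rescale V x μ)
        + (M.Pi z (f.1 z) (rescale V x μ) - M.Pi x (f.1 x) (rescale V x μ))‖ := by
        rw [add_sub_cancel]
    _ ≤ _ := norm_add_le_of_le h1 h2
    _ = _ := by rw [hA]; ring

/-- Regard `φ` as a test function centred at `z₀` at scale `1`; the comparison bound then tends to
zero, because every exponent `γ - α` is positive. -/
theorem continuous_pairing (hr : 0 < r) (f : M.modelled γ) (φ : 𝓢(Euc d, ℂ)) :
    Continuous fun z => M.Pi z (f.1 z) φ := by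
  rw [continuous_iff_continuousAt]
  intro z₀
  obtain ⟨C, hC, h⟩ := exists_bound_sub_sum hr f (φ.compSubConstCLM ℂ (-z₀))
  have e : rescale (φ.compSubConstCLM ℂ (-z₀)) z₀ 1 = φ := by
    rw [rescale_one]
    ext y
    simp
  rw [ContinuousAt, tendsto_iff_norm_sub_tendsto_zero]
  refine squeeze_zero (fun _ => norm_nonneg _) (fun z => ?_)
    (g := fun z => C * ∑ α ∈ S.lowIdx γ, ‖z₀ - z‖ ^ (γ - (α : ℝ))) ?_
  · have := h z₀ z₀ z 1 one_pos le_rfl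
    rw [e] at this
    refine this.trans (le_of_eq ?_)
    congr 1
    refine Finset.sum_congr rfl fun α hα => ?_
    rw [mem_lowIdx] at hα
    rw [Real.one_rpow, one_mul, sub_self, norm_zero, Real.zero_rpow (by linarith), add_zero]
  · have hc : Continuous fun z : Euc d => C * ∑ α ∈ S.lowIdx γ, ‖z₀ - z‖ ^ (γ - (α : ℝ)) := by
      refine continuous_const.mul (continuous_finsetSum _ fun α hα => ?_)
      rw [mem_lowIdx] at hα
      exact (continuous_const.sub continuous_id).norm.rpow_const fun _ => Or.inr (by linarith)
    have := hc.tendsto z₀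
    convert this using 2
    refine (mul_eq_zero_of_right _ (Finset.sum_eq_zero fun α hα => ?_)).symm
    rw [mem_lowIdx] at hα
    rw [sub_self, norm_zero, Real.zero_rpow (by linarith)]

/-- A Carathéodory function: continuity in the centre for each base point and measurability in the
base point give joint measurability. -/
theorem stronglyMeasurable_pairing (hr : 0 < r) (f : M.modelled γ) (V : 𝓢(Euc d, ℂ)) {μ : ℝ}
    (hμ : 0 < μ) : StronglyMeasurable fun p : Euc d × Euc d =>
      M.Pi p.2 (f.1 p.2) (rescale V p.1 μ) := by
  have := stronglyMeasurable_uncurry_of_continuous_of_stronglyMeasurable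
    (u := fun (x z : Euc d) => M.Pi z (f.1 z) (rescale V x μ)) (fun z => by
      refine (continuous_pairing_shift (M.Pi z (f.1 z)) (rescale V 0 μ)).congr fun x => ?_
      rw [← rescale_eq_shift V x hμ]) (fun x => (continuous_pairing hr f _).stronglyMeasurable)
  exact this

end Model

end

section

open Filter Topology SchwartzMap

/-! ### Paraproduct blocks of families of distributions -/

section Blocks

variable {d : ℕ}

/-- The integrand `z ↦ J_x^{2 μ}(z) v_z(K_x^μ)` of a paraproduct block. -/
def blockIntegrand (J K : 𝓢(Euc d, ℂ)) (v : Euc d → 𝓢'(Euc d, ℂ)) (μ : ℝ) (x z : Euc d) : ℂ :=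
  rescale J x (2 * μ) z * v z (rescale K x μ)

/-- The constant in the bounds for paraproduct blocks. -/
def blockConst (J : 𝓢(Euc d, ℂ)) (M : ℝ) : ℝ := ∫ t, ‖J t‖ * (1 + 2 * ‖t‖) ^ M

theorem blockConst_nonneg (J : 𝓢(Euc d, ℂ)) (M : ℝ) : 0 ≤ blockConst J M :=
  integral_nonneg fun t => by positivity

theorem integrable_mul_weight_two (J : 𝓢(Euc d, ℂ)) {M : ℝ} (hM : 0 ≤ M) :
    Integrable fun t => ‖J t‖ * (1 + 2 * ‖t‖) ^ M := by
  refine ((J.rapidDecay.integrable_mul J.continuous M).const_mul (2 ^ M)).mono' ?_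
    (Eventually.of_forall fun t => ?_)
  · refine Continuous.aestronglyMeasurable (J.continuous.norm.mul ?_)
    exact (by fun_prop : Continuous fun t : Euc d => 1 + 2 * ‖t‖).rpow_const
      fun _ => Or.inr hM
  · rw [Real.norm_of_nonneg (by positivity)]
    calc ‖J t‖ * (1 + 2 * ‖t‖) ^ M ≤ ‖J t‖ * (2 * (1 + ‖t‖)) ^ M := by
          gcongr; linarith
      _ = 2 ^ M * (‖J t‖ * (1 + ‖t‖) ^ M) := by
          rw [Real.mul_rpow (by norm_num) (by positivity)]; ring

theorem integrable_rescale_mul_weight (J : 𝓢(Euc d, ℂ)) {M : ℝ} (hM : 0 ≤ M) (x : Euc d) {μ : ℝ}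
    (hμ : 0 < μ) :
    Integrable (fun z => ‖rescale J x (2 * μ) z‖ * (1 + ‖x - z‖ / μ) ^ M) ∧
    ∫ z, ‖rescale J x (2 * μ) z‖ * (1 + ‖x - z‖ / μ) ^ M = blockConst J M := by
  have h2 : 0 < 2 * μ := by positivity
  have e : (fun z => ‖rescale J x (2 * μ) z‖ * (1 + ‖x - z‖ / μ) ^ M) = fun z =>
      ((2 * μ) ^ d)⁻¹ * (fun w => (fun t => ‖J t‖ * (1 + 2 * ‖t‖) ^ M) ((2 * μ)⁻¹ • w)) (z - x) := by
    ext z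
    have e1 : ‖x - z‖ / μ = 2 * ‖(2 * μ)⁻¹ • (z - x)‖ := by
      rw [norm_smul, norm_inv, Real.norm_of_nonneg h2.le, norm_sub_rev]
      field_simp
    rw [rescale_apply _ _ h2, norm_mul, Complex.norm_of_nonneg (by positivity), e1, mul_assoc]
  rw [e]
  have hi := integrable_mul_weight_two J hM
  constructor
  · exact ((hi.comp_smul (inv_ne_zero h2.ne')).comp_sub_right x).const_mul _
  · rw [integral_const_mul, integral_sub_right_eq_self
      (fun w => (fun t => ‖J t‖ * (1 + 2 * ‖t‖) ^ M) ((2 * μ)⁻¹ • w)) x,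
      Measure.integral_comp_inv_smul_of_nonneg volume (fun t => ‖J t‖ * (1 + 2 * ‖t‖) ^ M) h2.le, finrank_euclideanSpace_fin, smul_eq_mul,
      ← mul_assoc, inv_mul_cancel₀ (by positivity), one_mul]
    rfl

variable {J K : 𝓢(Euc d, ℂ)} {v : Euc d → 𝓢'(Euc d, ℂ)} {μ : ℝ}

theorem stronglyMeasurable_family (hv : ∀ φ, Continuous fun z => v z φ) (K : 𝓢(Euc d, ℂ))
    (hμ : 0 < μ) : StronglyMeasurable fun p : Euc d × Euc d => v p.2 (rescale K p.1 μ) :=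
  stronglyMeasurable_uncurry_of_continuous_of_stronglyMeasurable
    (u := fun (x z : Euc d) => v z (rescale K x μ)) (fun z => by
      refine (continuous_pairing_shift (v z) (rescale K 0 μ)).congr fun x => ?_
      rw [← rescale_eq_shift K x hμ]) (fun x => (hv _).stronglyMeasurable)

theorem stronglyMeasurable_blockIntegrand (hv : ∀ φ, Continuous fun z => v z φ) (hμ : 0 < μ) :
    StronglyMeasurable fun p : Euc d × Euc d => blockIntegrand J K v μ p.1 p.2 := by
  refine StronglyMeasurable.mul ?_ (stronglyMeasurable_family hv K hμ)
  refine Continuous.stronglyMeasurable ?_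
  simp_rw [fun p : Euc d × Euc d => rescale_apply J p.1 (by positivity : 0 < 2 * μ) p.2]
  fun_prop

theorem stronglyMeasurable_block (hv : ∀ φ, Continuous fun z => v z φ) (hμ : 0 < μ) :
    StronglyMeasurable fun x => ∫ z, blockIntegrand J K v μ x z :=
  (stronglyMeasurable_blockIntegrand hv hμ).integral_prod_right

theorem norm_blockIntegrand_le {b M : ℝ} {x : Euc d}
    (hb : ∀ z, ‖v z (rescale K x μ)‖ ≤ b * (1 + ‖x - z‖ / μ) ^ M) (z : Euc d) :
    ‖blockIntegrand J K v μ x z‖ ≤ b * (‖rescale J x (2 * μ) z‖ * (1 + ‖x - z‖ / μ) ^ M) := by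
  rw [blockIntegrand, norm_mul]
  calc _ ≤ ‖rescale J x (2 * μ) z‖ * (b * (1 + ‖x - z‖ / μ) ^ M) := by gcongr; exact hb z
    _ = _ := by ring

theorem integrable_blockIntegrand (hv : ∀ φ, Continuous fun z => v z φ) (hμ : 0 < μ)
    {b M : ℝ} (hM : 0 ≤ M) {x : Euc d}
    (hb : ∀ z, ‖v z (rescale K x μ)‖ ≤ b * (1 + ‖x - z‖ / μ) ^ M) :
    Integrable (blockIntegrand J K v μ x) :=
  ((integrable_rescale_mul_weight J hM x hμ).1.const_mul b).mono'
    ((rescale J x (2 * μ)).continuous.mul (hv _)).aestronglyMeasurable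
    (Eventually.of_forall (norm_blockIntegrand_le hb))

theorem integral_norm_blockIntegrand_le (hμ : 0 < μ)
    {b M : ℝ} (hM : 0 ≤ M) {x : Euc d}
    (hb : ∀ z, ‖v z (rescale K x μ)‖ ≤ b * (1 + ‖x - z‖ / μ) ^ M) :
    ∫ z, ‖blockIntegrand J K v μ x z‖ ≤ b * blockConst J M := by
  obtain ⟨hi, he⟩ := integrable_rescale_mul_weight J hM x hμ
  have := integral_mono_of_nonneg (Eventually.of_forall fun z => norm_nonneg _) (hi.const_mul b)
    (Eventually.of_forall (norm_blockIntegrand_le (J := J) hb))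
  rwa [integral_const_mul, he] at this

theorem norm_block_le (hμ : 0 < μ) {b M : ℝ} (hM : 0 ≤ M) {x : Euc d}
    (hb : ∀ z, ‖v z (rescale K x μ)‖ ≤ b * (1 + ‖x - z‖ / μ) ^ M) :
    ‖∫ z, blockIntegrand J K v μ x z‖ ≤ b * blockConst J M :=
  (norm_integral_le_integral_norm _).trans (integral_norm_blockIntegrand_le hμ hM hb)

/-- In units of `μ` around `x₀`, the `w`-dependence consists of `j(w - z')` and of translates of `k`
inside a fixed distribution. The scalar identity `hH`, valid for every `t`, can thus be applied
under that distribution by `pairing_shift`. -/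
theorem blockIntegrand_reproducing {j k H : 𝓢(Euc d, ℂ)}
    (hH : ∀ w z t, rescale j 0 2 (w - z) * k (w - t) =
      ∫ w', H (w - w') * (rescale j 0 2 (w' - z) * k (w' - t)))
    (v : Euc d → 𝓢'(Euc d, ℂ)) (hμ : 0 < μ) (x₀ w z : Euc d) :
    blockIntegrand (kernelAt j 0) (kernelAt k 0) v μ (x₀ + μ • w) z =
      ∫ w', H (w - w') * blockIntegrand (kernelAt j 0) (kernelAt k 0) v μ (x₀ + μ • w') z := by
  set z' := μ⁻¹ • (z - x₀) with hz'
  set u := compDist (v z) (rescaleCLM x₀ μ) with hu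
  have h2 : 0 < 2 * μ := by positivity
  have e1 : ∀ w, blockIntegrand (kernelAt j 0) (kernelAt k 0) v μ (x₀ + μ • w) z =
      (((μ ^ d)⁻¹ : ℝ) : ℂ) *
        (rescale j 0 2 (w - z') * u ((kernelAt k 0).compSubConstCLM ℂ w)) := by
    intro w
    rw [blockIntegrand, hu, compDist_apply, rescaleCLM_apply _ _ hμ, rescale_shift _ _ _ hμ,
      rescale_apply _ _ h2, rescale_apply _ _ two_pos, kernelAt_apply, zero_sub, sub_zero,
      ← smul_neg, neg_sub, ← mul_assoc, ← mul_assoc]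
    congr 2
    · rw [mul_pow, mul_inv]
      push_cast
      ring
    · congr 1
      rw [hz', mul_inv, mul_smul, add_sub_right_comm, ← neg_sub z x₀, smul_add, smul_smul,
        inv_mul_cancel₀ hμ.ne', one_smul, smul_neg]
      congr 1
      abel
  have hp := pairing_shift u (c := fun w' => H (w - w') * rescale j 0 2 (w' - z'))
    (by fun_prop) (by
      have := (prodS (kernelAt H w) ((rescale j 0 2).compSubConstCLM ℂ z')).rapidDecay
      convert this using 2
      rw [prodS_apply, kernelAt_apply, compSubConstCLM_apply])
    (kernelAt k 0) (rescale j 0 2 (w - z') • (kernelAt k 0).compSubConstCLM ℂ w) (fun t => by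
      rw [smul_apply, compSubConstCLM_apply, kernelAt_apply, smul_eq_mul, zero_sub, neg_sub, hH]
      congr 1
      ext w'
      rw [kernelAt_apply, zero_sub, neg_sub, mul_assoc])
  rw [e1, ← smul_eq_mul (rescale j 0 2 (w - z')), ← map_smul, ← hp.2, ← integral_const_mul]
  congr 1
  ext w'
  rw [e1]
  ring

theorem stronglyMeasurable_mul_comp (H : 𝓢(Euc d, ℂ)) {F : Euc d → Euc d → ℂ}
    (hF : StronglyMeasurable fun p : Euc d × Euc d => F p.1 p.2) (w x₀ : Euc d) (μ : ℝ) :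
    StronglyMeasurable fun p : Euc d × Euc d => H (w - p.1) * F (x₀ + μ • p.1) p.2 := by
  have hm : Measurable fun p : Euc d × Euc d => (x₀ + μ • p.1, p.2) := by fun_prop
  have hc : Continuous fun p : Euc d × Euc d => H (w - p.1) := by fun_prop
  exact hc.stronglyMeasurable.mul (hF.comp_measurable hm)

theorem integral_integral_mul_swap (H : 𝓢(Euc d, ℂ)) {F : Euc d → Euc d → ℂ}
    (hF : StronglyMeasurable fun p : Euc d × Euc d => F p.1 p.2) (w x₀ : Euc d) (μ : ℝ) {B M : ℝ}
    (hi : ∀ w', Integrable (F (x₀ + μ • w')))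
    (hb : ∀ w', ∫ z, ‖F (x₀ + μ • w') z‖ ≤ B * (1 + ‖w'‖) ^ M) :
    ∫ z, ∫ w', H (w - w') * F (x₀ + μ • w') z = ∫ w', H (w - w') * ∫ z, F (x₀ + μ • w') z := by
  have hsm := stronglyMeasurable_mul_comp H hF w x₀ μ
  have hint : Integrable fun p : Euc d × Euc d => H (w - p.1) * F (x₀ + μ • p.1) p.2 := by
    have hi' : ∀ w', Integrable fun z => H (w - w') * F (x₀ + μ • w') z :=
      fun w' => (hi w').const_mul (H (w - w'))
    refine (integrable_prod_iff hsm.aestronglyMeasurable).2 ⟨Eventually.of_forall hi', ?_⟩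
    have hdom : Integrable fun w' => ‖H (w - w')‖ * (1 + ‖w'‖) ^ M := by
      refine ((kernelAt H w).rapidDecay.integrable_mul (kernelAt H w).continuous M).congr
        (Eventually.of_forall fun w' => ?_)
      beta_reduce
      rw [kernelAt_apply]
    refine (hdom.const_mul B).mono' hsm.norm.integral_prod_right.aestronglyMeasurable
      (Eventually.of_forall fun w' => ?_)
    simp_rw [norm_mul]
    rw [integral_const_mul, Real.norm_of_nonneg (mul_nonneg (norm_nonneg _)
      (integral_nonneg fun _ => norm_nonneg _))]
    calc _ ≤ ‖H (w - w')‖ * (B * (1 + ‖w'‖) ^ M) := by gcongr; exact hb w'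
      _ = _ := by ring
  rw [← integral_integral_swap (f := fun w' z => H (w - w') * F (x₀ + μ • w') z) hint]
  simp_rw [integral_const_mul]

/-- Integrate the pointwise formula over `z`; the growth bound on the family, uniform in `w` up to a
polynomial weight, justifies Fubini. -/
theorem block_reproducing {j k H : 𝓢(Euc d, ℂ)}
    (hH : ∀ w z t, rescale j 0 2 (w - z) * k (w - t) =
      ∫ w', H (w - w') * (rescale j 0 2 (w' - z) * k (w' - t)))
    (hv : ∀ φ, Continuous fun z => v z φ) (hμ : 0 < μ) {x₀ : Euc d} {B M : ℝ} (hM : 0 ≤ M)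
    (hb : ∀ w z, ‖v z (rescale (kernelAt k 0) (x₀ + μ • w) μ)‖
      ≤ B * (1 + ‖w‖) ^ M * (1 + ‖x₀ + μ • w - z‖ / μ) ^ M) (w : Euc d) :
    ∫ z, blockIntegrand (kernelAt j 0) (kernelAt k 0) v μ (x₀ + μ • w) z =
      ∫ w', H (w - w') *
        ∫ z, blockIntegrand (kernelAt j 0) (kernelAt k 0) v μ (x₀ + μ • w') z := by
  simp_rw [blockIntegrand_reproducing hH v hμ x₀ w]
  refine integral_integral_mul_swap H (F := blockIntegrand (kernelAt j 0) (kernelAt k 0) v μ)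
    (B := B * blockConst (kernelAt j 0) M) (M := M)
    (stronglyMeasurable_blockIntegrand hv hμ) w x₀ μ
    (fun w' => integrable_blockIntegrand hv hμ hM (hb w')) fun w' => ?_
  refine (integral_norm_blockIntegrand_le hμ hM (hb w')).trans (le_of_eq ?_)
  ring

end Blocks

end

section

open Filter Topology SchwartzMap

/-! ### The generalized paraproduct -/

namespace SchwartzMap

variable {d : ℕ}

theorem integral_norm_iteratedFDeriv_le (d n : ℕ) : ∃ (s : Finset (ℕ × ℕ)) (C : ℝ), 0 ≤ C ∧
    ∀ φ : 𝓢(Euc d, ℂ), ∫ x, ‖iteratedFDeriv ℝ n φ x‖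
      ≤ C * s.sup (schwartzSeminormFamily ℂ (Euc d) ℂ) φ := by
  set m := (volume : Measure (Euc d)).integrablePower
  set A := 2 ^ m * ∫ x : Euc d, (1 + ‖x‖) ^ (-(m : ℝ)) with hA
  have hA0 : 0 ≤ A := by positivity
  refine ⟨{(0, n), (0 + m, n)}, A * 2, by positivity, fun φ => ?_⟩
  have h := φ.integral_pow_mul_iteratedFDeriv_le ℂ (volume : Measure (Euc d)) 0 n
  simp only [pow_zero, one_mul] at h
  refine h.trans ?_
  rw [mul_assoc A]
  refine mul_le_mul_of_nonneg_left ?_ hA0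
  have h1 : ∀ p ∈ ({(0, n), (0 + m, n)} : Finset (ℕ × ℕ)), SchwartzMap.seminorm ℂ p.1 p.2 φ ≤
      (({(0, n), (0 + m, n)} : Finset (ℕ × ℕ)).sup (schwartzSeminormFamily ℂ (Euc d) ℂ)) φ :=
    fun p hp => Seminorm.le_def.1
      (Finset.le_sup (f := schwartzSeminormFamily ℂ (Euc d) ℂ) hp) φ
  have h2 := h1 (0, n) (by simp)
  have h3 := h1 (0 + m, n) (by simp)
  linarith

theorem exists_distribution_of_bound (L : 𝓢(Euc d, ℂ) →ₗ[ℂ] ℂ) (n : ℕ) {C : ℝ} (hC : 0 ≤ C)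
    (h : ∀ φ, ‖L φ‖ ≤ C * ∫ x, ‖iteratedFDeriv ℝ n φ x‖) :
    ∃ u : 𝓢'(Euc d, ℂ), ∀ φ, u φ = L φ := by
  obtain ⟨s, A, hA, hs⟩ := integral_norm_iteratedFDeriv_le d n
  refine ⟨ContinuousLinearMap.toPointwiseConvergenceCLM _ _ _ _
    (SchwartzMap.mkCLMtoNormedSpace (σ := RingHom.id ℂ) (fun φ => L φ) (map_add L) (map_smul L)
      ⟨s, C * A, by positivity, fun φ => (h φ).trans ?_⟩), fun φ => rfl⟩
  rw [mul_assoc]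
  exact mul_le_mul_of_nonneg_left (hs φ) hC

theorem integrable_bounded_mul {g : Euc d → ℂ} (hg : StronglyMeasurable g) {B : ℝ}
    (hb : ∀ x, ‖g x‖ ≤ B) (φ : 𝓢(Euc d, ℂ)) : Integrable fun x => g x * φ x :=
  φ.integrable.bdd_mul hg.aestronglyMeasurable (Eventually.of_forall hb)

/-- Integration against a bounded function. -/
def boundedPairing {g : Euc d → ℂ} (hg : StronglyMeasurable g) {B : ℝ}
    (hb : ∀ x, ‖g x‖ ≤ B) : 𝓢(Euc d, ℂ) →ₗ[ℂ] ℂ where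
  toFun φ := ∫ x, g x * φ x
  map_add' φ ψ := by
    rw [← integral_add (integrable_bounded_mul hg hb φ) (integrable_bounded_mul hg hb ψ)]
    simp_rw [add_apply, mul_add]
  map_smul' c φ := by
    simp_rw [smul_apply, smul_eq_mul, mul_left_comm _ c]
    rw [integral_const_mul]
    rfl

/-- A bounded function defines a tempered distribution. -/
theorem exists_distribution_of_bounded {g : Euc d → ℂ} (hg : StronglyMeasurable g) {B : ℝ}
    (hb : ∀ x, ‖g x‖ ≤ B) : ∃ u : 𝓢'(Euc d, ℂ), ∀ φ, u φ = ∫ x, g x * φ x := by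
  refine exists_distribution_of_bound (boundedPairing hg hb) 0 ((norm_nonneg _).trans (hb 0))
    fun φ => ?_
  refine (norm_integral_le_of_norm_le ((φ.integrable.norm).const_mul B)
    (Eventually.of_forall fun x => ?_)).trans (le_of_eq ?_)
  · rw [norm_mul]
    exact mul_le_mul_of_nonneg_right (hb x) (norm_nonneg _)
  · rw [integral_const_mul]
    simp_rw [norm_iteratedFDeriv_zero]

/-- A series of bounded functions whose pairings are summable defines a tempered distribution. -/
theorem exists_distribution_hasSum {p : ℕ → Euc d → ℂ} (hp : ∀ i, StronglyMeasurable (p i))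
    (hb : ∀ i, ∃ B, ∀ x, ‖p i x‖ ≤ B) (n : ℕ) {c : ℕ → ℝ} (hc : Summable c) (hc0 : ∀ i, 0 ≤ c i)
    (h : ∀ i (φ : 𝓢(Euc d, ℂ)), ‖∫ x, p i x * φ x‖ ≤ c i * ∫ x, ‖iteratedFDeriv ℝ n φ x‖) :
    ∃ u : 𝓢'(Euc d, ℂ), ∀ φ, HasSum (fun i => ∫ x, p i x * φ x) (u φ) := by
  choose B hB using hb
  have hs : ∀ φ : 𝓢(Euc d, ℂ), Summable fun i => ∫ x, p i x * φ x := fun φ =>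
    Summable.of_norm_bounded (hc.mul_right _) fun i => h i φ
  let L : 𝓢(Euc d, ℂ) →ₗ[ℂ] ℂ :=
    { toFun := fun φ => ∑' i, boundedPairing (hp i) (hB i) φ
      map_add' := fun φ ψ => by
        simp_rw [map_add]
        exact (hs φ).tsum_add (hs ψ)
      map_smul' := fun a φ => by
        simp_rw [map_smul, smul_eq_mul]
        exact tsum_mul_left }
  obtain ⟨u, hu⟩ := exists_distribution_of_bound L n (tsum_nonneg hc0) fun φ => by
    rw [← tsum_mul_right]
    exact tsum_of_norm_bounded (hc.mul_right _).hasSum fun i => h i φ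
  exact ⟨u, fun φ => by rw [hu]; exact (hs φ).hasSum⟩

end SchwartzMap

namespace Model

variable {S : RegularityStructure.{u}} {d : ℕ} {r γ : ℝ} {M : Model S d r}

open RegularityStructure

theorem paraIntegrand_zero (D : DyadicPartition d) (f : Euc d → S.Space) (x z : Euc d) :
    M.paraIntegrand D f 0 x z = 0 := by
  rw [paraIntegrand, kernelAt_apply, Nat.cast_zero, zero_sub, D.kernelLt_neg_one]
  simp

/-- The block `i = 0` vanishes since `K_{<-1} = 0`, so the common shape at scales `2μ` and `μ` is
needed only from `i + 1` on. -/
theorem paraIntegrand_succ (D : DyadicPartition d) (f : Euc d → S.Space) (i : ℕ) (x : Euc d) :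
    M.paraIntegrand D f (i + 1) x = blockIntegrand (kernelAt (D.kernel (-1)) 0)
      (kernelAt (D.kernel 0) 0) (fun z => M.Pi z (f z)) (dyadicScale (i + 1)) x := by
  ext z
  have e : dyadicScale i = 2 * dyadicScale (i + 1) := by
    rw [dyadicScale, dyadicScale, pow_succ]; ring
  rw [paraIntegrand, blockIntegrand, ← D.kernelAt_kernel, ← e, ← D.kernelAt_kernelLt]
  simp

theorem one_add_le_one_add_div {t μ : ℝ} (ht : 0 ≤ t) (hμ : 0 < μ) (hμ1 : μ ≤ 1) :
    1 + t ≤ 1 + t / μ := by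
  gcongr
  exact le_div_self ht hμ hμ1

theorem exists_bound_growth_scaled (hr : 0 < r) (ha : S.minA < γ) (f : M.modelled γ)
    (V : 𝓢(Euc d, ℂ)) : ∃ C, 0 ≤ C ∧ ∀ (x z : Euc d) (μ : ℝ), 0 < μ → μ ≤ 1 →
      ‖M.Pi z (f.1 z) (rescale V x μ)‖ ≤
        C * μ ^ S.minA * (1 + ‖x - z‖ / μ) ^ (γ - S.minA) := by
  obtain ⟨C, hC, h⟩ := exists_bound_growth hr f V
  refine ⟨C, hC, fun x z μ hμ hμ1 => (h x z μ hμ hμ1).trans ?_⟩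
  refine mul_le_mul_of_nonneg_left ?_ (by positivity)
  exact Real.rpow_le_rpow (by positivity) (one_add_le_one_add_div (norm_nonneg _) hμ hμ1)
    (by linarith)

theorem integrable_paraIntegrand (hr : 0 < r) (ha : S.minA < γ) (D : DyadicPartition d)
    (f : M.modelled γ) (i : ℕ) (x : Euc d) : Integrable (M.paraIntegrand D f.1 i x) := by
  rcases i with _ | i
  · exact (integrable_zero _ _ _).congr
      (Eventually.of_forall fun z => (paraIntegrand_zero D f.1 x z).symm)
  · obtain ⟨C, hC, h⟩ := exists_bound_growth_scaled hr ha f (kernelAt (D.kernel 0) 0)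
    rw [paraIntegrand_succ]
    exact integrable_blockIntegrand (continuous_pairing hr f) (dyadicScale_pos _)
      (sub_nonneg.2 ha.le) fun z => h x z _ (dyadicScale_pos _) (dyadicScale_le_one _)

theorem stronglyMeasurable_paraBlock (hr : 0 < r) (D : DyadicPartition d)
    (f : M.modelled γ) (i : ℕ) : StronglyMeasurable (M.paraBlock D f.1 i) := by
  unfold paraBlock
  rcases i with _ | i
  · simp_rw [paraIntegrand_zero, integral_zero]
    exact stronglyMeasurable_const
  · simp_rw [paraIntegrand_succ]
    exact stronglyMeasurable_block (continuous_pairing hr f) (dyadicScale_pos _)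

theorem paraBlock_zero (D : DyadicPartition d) (f : Euc d → S.Space) (x : Euc d) :
    M.paraBlock D f 0 x = 0 := by
  simp_rw [paraBlock, paraIntegrand_zero, integral_zero]

/-- No cancellation is used here. The bound may grow with `i`, but only like a fixed power of `2^i`,
which integration by parts can beat. -/
theorem exists_bound_paraBlock (hr : 0 < r) (ha : S.minA < γ) (D : DyadicPartition d)
    (f : M.modelled γ) : ∃ C, 0 ≤ C ∧ ∀ i x,
      ‖M.paraBlock D f.1 i x‖ ≤ C * dyadicScale i ^ S.minA := by
  obtain ⟨C, hC, h⟩ := exists_bound_growth_scaled hr ha f (kernelAt (D.kernel 0) 0)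
  have hB := blockConst_nonneg (kernelAt (D.kernel (-1)) 0) (γ - S.minA)
  refine ⟨C * blockConst (kernelAt (D.kernel (-1)) 0) (γ - S.minA), by positivity, fun i x => ?_⟩
  have hμ := dyadicScale_pos i
  rcases i with _ | i
  · rw [paraBlock_zero, norm_zero]
    positivity
  · rw [paraBlock, paraIntegrand_succ]
    refine (norm_block_le hμ (sub_nonneg.2 ha.le)
      fun z => h x z _ hμ (dyadicScale_le_one _)).trans (le_of_eq ?_)
    ring

theorem exists_paraBlock_reproducing (hr : 0 < r) (ha : S.minA < γ) (D : DyadicPartition d)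
    {H : 𝓢(Euc d, ℂ)}
    (hH : ∀ w z t, rescale (D.kernel (-1)) 0 2 (w - z) * D.kernel 0 (w - t) =
      ∫ w', H (w - w') * (rescale (D.kernel (-1)) 0 2 (w' - z) * D.kernel 0 (w' - t)))
    (f : M.modelled γ) (i : ℕ) (x₀ w : Euc d) :
    M.paraBlock D f.1 i (x₀ + dyadicScale i • w) =
      ∫ w', H (w - w') * M.paraBlock D f.1 i (x₀ + dyadicScale i • w') := by
  rcases i with _ | i
  · simp_rw [paraBlock_zero, mul_zero, integral_zero]
  · obtain ⟨C, hC, h⟩ := exists_bound_growth_scaled hr ha f (kernelAt (D.kernel 0) 0)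
    have hμ := dyadicScale_pos (i + 1)
    simp_rw [paraBlock, paraIntegrand_succ]
    refine block_reproducing hH (continuous_pairing hr f) hμ (sub_nonneg.2 ha.le)
      (B := C * dyadicScale (i + 1) ^ S.minA) (fun w z => ?_) w
    refine (h _ z _ hμ (dyadicScale_le_one _)).trans ?_
    refine mul_le_mul_of_nonneg_right (le_mul_of_one_le_right (by positivity)
      (Real.one_le_rpow ?_ (sub_nonneg.2 ha.le))) (by positivity)
    linarith [norm_nonneg w]

theorem summable_dyadicScale : Summable dyadicScale :=
  summable_geometric_of_lt_one (by norm_num) (by norm_num)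

theorem exists_isParaproduct (hr : 0 < r) (ha : S.minA < γ) (D : DyadicPartition d)
    (f : M.modelled γ) : ∃ u, M.IsParaproduct D f.1 u := by
  obtain ⟨C, hC, hb⟩ := exists_bound_paraBlock hr ha D f
  obtain ⟨H, hHa, -, hH⟩ := D.exists_annular
  -- Enough derivatives to turn the size `2^{-i min A}` of the blocks into the summable `2^{-i}`.
  set n : ℕ := ⌈1 - S.minA⌉₊ with hn
  have hn' : 1 ≤ S.minA + n := by linarith [Nat.le_ceil (1 - S.minA)]
  obtain ⟨C', hC', hd⟩ := hHa.norm_integral_mul_dilate_le n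
  have hm := stronglyMeasurable_paraBlock (M := M) hr D f
  obtain ⟨u, hu⟩ := exists_distribution_hasSum (p := M.paraBlock D f.1) hm
    (fun i => ⟨_, hb i⟩) n (c := fun i => C' * C * dyadicScale i)
    (summable_dyadicScale.mul_left _) (fun i => by have := dyadicScale_pos i; positivity)
    (fun i φ => by
      have hμ := dyadicScale_pos i
      refine (hd _ _ φ _ hμ (hm i) (hb i) fun w => ?_).trans ?_
      · simpa using exists_paraBlock_reproducing hr ha D hH f i 0 w
      · have : dyadicScale i ^ S.minA * dyadicScale i ^ n ≤ dyadicScale i := by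
          rw [← Real.rpow_natCast, ← Real.rpow_add hμ]
          exact (Real.rpow_le_rpow_of_exponent_ge hμ (dyadicScale_le_one i) hn').trans_eq
            (Real.rpow_one _)
        have h0 : 0 ≤ ∫ x, ‖iteratedFDeriv ℝ n φ x‖ := integral_nonneg fun _ => norm_nonneg _
        calc _ = C' * C * (dyadicScale i ^ S.minA * dyadicScale i ^ n) *
              ∫ x, ‖iteratedFDeriv ℝ n φ x‖ := by ring
          _ ≤ _ := by gcongr)
  exact ⟨u, integrable_paraIntegrand hr ha D f,
    fun φ => ⟨fun i => integrable_bounded_mul (hm i) (hb i) φ, hu φ⟩⟩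

theorem IsParaproduct.unique {D : DyadicPartition d} {f : Euc d → S.Space} {u v : 𝓢'(Euc d, ℂ)}
    (hu : M.IsParaproduct D f u) (hv : M.IsParaproduct D f v) : u = v := by
  ext φ
  exact (hu.2 φ).2.unique (hv.2 φ).2

theorem IsParaproduct.add {D : DyadicPartition d} {f g : Euc d → S.Space} {u v : 𝓢'(Euc d, ℂ)}
    (hu : M.IsParaproduct D f u) (hv : M.IsParaproduct D g v) :
    M.IsParaproduct D (f + g) (u + v) := by
  have e : ∀ i x, M.paraIntegrand D (f + g) i x
      = M.paraIntegrand D f i x + M.paraIntegrand D g i x := by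
    intro i x
    ext z
    rw [Pi.add_apply, paraIntegrand, Pi.add_apply, map_add]
    exact mul_add _ _ _
  have e' : ∀ i x, M.paraBlock D (f + g) i x = M.paraBlock D f i x + M.paraBlock D g i x :=
    fun i x => by rw [paraBlock, e]; exact integral_add (hu.1 i x) (hv.1 i x)
  refine ⟨fun i x => by rw [e]; exact (hu.1 i x).add (hv.1 i x), fun φ => ?_⟩
  simp_rw [e', add_mul]
  refine ⟨fun i => ((hu.2 φ).1 i).add ((hv.2 φ).1 i), ?_⟩
  simp_rw [fun i => integral_add ((hu.2 φ).1 i) ((hv.2 φ).1 i)]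
  exact (hu.2 φ).2.add (hv.2 φ).2

theorem IsParaproduct.smul {D : DyadicPartition d} {f : Euc d → S.Space} {u : 𝓢'(Euc d, ℂ)}
    (c : ℝ) (hu : M.IsParaproduct D f u) : M.IsParaproduct D (c • f) (c • u) := by
  have e : ∀ i x, M.paraIntegrand D (c • f) i x = c • M.paraIntegrand D f i x := by
    intro i x
    ext z
    rw [Pi.smul_apply, paraIntegrand, Pi.smul_apply, map_smul]
    exact mul_smul_comm c (kernelAt (D.kernelLt ((i : ℤ) - 1)) x z)
      (M.Pi z (f z) (kernelAt (D.kernel i) x))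
  have e' : ∀ i x, M.paraBlock D (c • f) i x = c • M.paraBlock D f i x :=
    fun i x => by rw [paraBlock, e]; exact integral_smul c (M.paraIntegrand D f i x)
  refine ⟨fun i x => by rw [e]; exact (hu.1 i x).smul c, fun φ => ?_⟩
  simp_rw [e', smul_mul_assoc]
  refine ⟨fun i => ((hu.2 φ).1 i).smul c, ?_⟩
  simp_rw [integral_smul]
  exact (hu.2 φ).2.const_smul c

end Model

end

section

open Filter Topology SchwartzMap

/-! ### Littlewood--Paley blocks of the remainder -/

theorem tendsto_dyadicScale : Tendsto dyadicScale atTop (𝓝[>] 0) :=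
  tendsto_nhdsWithin_iff.2 ⟨tendsto_pow_atTop_nhds_zero_of_lt_one (by norm_num) (by norm_num),
    Eventually.of_forall dyadicScale_pos⟩

theorem kernelAt_add {d : ℕ} (V W : 𝓢(Euc d, ℂ)) (x : Euc d) :
    kernelAt (V + W) x = kernelAt V x + kernelAt W x := by
  ext y
  simp [kernelAt_apply]

theorem rpow_le_rpow_abs {t X γ : ℝ} (hX : 1 ≤ X) (h1 : X⁻¹ ≤ t) (h2 : t ≤ X) :
    t ^ γ ≤ X ^ |γ| := by
  have hX0 : 0 < X := by linarith
  have ht : 0 < t := lt_of_lt_of_le (inv_pos.2 hX0) h1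
  rcases le_total 0 γ with hγ | hγ
  · rw [abs_of_nonneg hγ]
    exact Real.rpow_le_rpow ht.le h2 hγ
  · rw [abs_of_nonpos hγ, Real.rpow_neg hX0.le, ← Real.inv_rpow hX0.le]
    exact Real.rpow_le_rpow_of_nonpos (inv_pos.2 hX0) h1 hγ

theorem dyadicScale_le_mul {i j N : ℕ} (h : i ≤ j + N) : dyadicScale j ≤ 2 ^ N * dyadicScale i := by
  have h1 : dyadicScale (j + N) ≤ dyadicScale i :=
    pow_le_pow_of_le_one (by norm_num) (by norm_num) h
  rw [dyadicScale_add] at h1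
  calc dyadicScale j = 2 ^ N * (dyadicScale j * dyadicScale N) := by
        rw [dyadicScale, dyadicScale, one_div, inv_pow (2 : ℝ) N]; field_simp
    _ ≤ _ := by gcongr

/-- For scales within `N` octaves, powers are comparable whatever the sign of the exponent, hence
the absolute value. -/
theorem dyadicScale_rpow_le {i j N : ℕ} (h1 : i ≤ j + N) (h2 : j ≤ i + N) (γ : ℝ) :
    dyadicScale i ^ γ ≤ (2 ^ N : ℝ) ^ |γ| * dyadicScale j ^ γ := by
  have hi := dyadicScale_pos i
  have hj := dyadicScale_pos j
  have h3 := dyadicScale_le_mul h1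
  have h4 := dyadicScale_le_mul h2
  have h := rpow_le_rpow_abs (t := dyadicScale i / dyadicScale j) (X := 2 ^ N) (γ := γ)
    (one_le_pow₀ (by norm_num)) (by rw [le_div_iff₀ hj, inv_mul_le_iff₀ (by positivity)]; exact h3)
    (by rw [div_le_iff₀ hj]; exact h4)
  rwa [Real.div_rpow hi.le hj.le, div_le_iff₀ (by positivity)] at h

namespace SchwartzMap

variable {d : ℕ}

theorem norm_integral_mul_rescale_le_of_growth (V : 𝓢(Euc d, ℂ)) {g : Euc d → ℂ} {B M ν : ℝ}
    (hν : 0 < ν) {y : Euc d} (hg : ∀ w, ‖g (y + ν • w)‖ ≤ B * (1 + ‖w‖) ^ M) :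
    ‖∫ x, g x * rescale V y ν x‖ ≤ B * ∫ w, ‖V w‖ * (1 + ‖w‖) ^ M := by
  rw [integral_mul_rescale _ _ hν, ← integral_const_mul]
  refine norm_integral_le_of_norm_le
    ((V.rapidDecay.integrable_mul V.continuous M).const_mul B) (Eventually.of_forall fun w => ?_)
  rw [norm_mul]
  calc _ ≤ B * (1 + ‖w‖) ^ M * ‖V w‖ := by gcongr; exact hg w
    _ = _ := by ring

theorem integral_rescale (V : 𝓢(Euc d, ℂ)) (x : Euc d) {lam : ℝ} (h : 0 < lam) :
    ∫ y, rescale V x lam y = ∫ y, V y := by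
  simpa using integral_rescale_mul V x h fun _ => 1

theorem integral_mul_rescale_eq (V : 𝓢(Euc d, ℂ)) (g : Euc d → ℂ) (y : Euc d) {μ ν : ℝ}
    (hμ : 0 < μ) (hν : 0 < ν) :
    ∫ x, g x * rescale V y ν x = ∫ w, g (y + μ • w) * rescale V 0 (ν / μ) w := by
  rw [integral_mul_rescale _ _ hν, integral_mul_rescale V 0 (by positivity : 0 < ν / μ)
    (fun w => g (y + μ • w))]
  congr 1; ext w
  rw [zero_add, smul_smul, mul_div_cancel₀ _ hμ.ne']

theorem coe_fourier_kernelAt_zero (V : 𝓢(Euc d, ℂ)) :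
    ((𝓕 (kernelAt V 0) : 𝓢(Euc d, ℂ)) : Euc d → ℂ) = (𝓕 V : 𝓢(Euc d, ℂ)) ∘ Homeomorph.neg (Euc d) := by
  ext ξ
  rw [fourier_kernelAt]
  simp

theorem hasCompactSupport_fourier_kernelAt {V : 𝓢(Euc d, ℂ)}
    (hV : HasCompactSupport (𝓕 V : 𝓢(Euc d, ℂ))) :
    HasCompactSupport (𝓕 (kernelAt V 0) : 𝓢(Euc d, ℂ)) := by
  rw [coe_fourier_kernelAt_zero]
  exact hV.comp_homeomorph _

theorem IsAnnular.kernelAt {V : 𝓢(Euc d, ℂ)} (hV : IsAnnular V) : IsAnnular (kernelAt V 0) := by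
  refine ⟨hasCompactSupport_fourier_kernelAt hV.1, fun h => hV.2 ?_⟩
  rw [coe_fourier_kernelAt_zero, tsupport_comp_eq_preimage] at h
  simpa using h

theorem integrable_mul_pairing_kernelAt (u : 𝓢'(Euc d, ℂ)) (V φ : 𝓢(Euc d, ℂ)) :
    Integrable fun x => u (kernelAt V x) * φ x := by
  refine (integral_pairing_shift u (kernelAt V 0) φ).1.congr (Eventually.of_forall fun x => ?_)
  beta_reduce
  rw [← kernelAt_eq_shift, mul_comm]

theorem integral_mul_pairing_kernelAt (u : 𝓢'(Euc d, ℂ)) (V φ : 𝓢(Euc d, ℂ)) :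
    ∫ x, u (kernelAt V x) * φ x = u (conv φ (kernelAt V 0)) := by
  rw [← (integral_pairing_shift u (kernelAt V 0) φ).2]
  congr 1; ext x
  rw [← kernelAt_eq_shift, mul_comm]

end SchwartzMap

namespace DyadicPartition

variable {d : ℕ} (D : DyadicPartition d)

theorem kernelLt_succ (N : ℕ) : D.kernelLt (N + 1 : ℕ) = D.kernelLt N + D.kernel N := by
  rw [kernelLt_natCast_eq_add, kernelLt_natCast_eq_add, Finset.sum_range_succ, add_assoc]

theorem sum_integral_pairing_kernelAt (u : 𝓢'(Euc d, ℂ)) (φ : 𝓢(Euc d, ℂ)) {n N : ℕ}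
    (hN : n ≤ N) : ∑ i ∈ Finset.Ico n N, ∫ x, u (kernelAt (D.kernel i) x) * φ x =
      (∫ x, u (kernelAt (D.kernelLt N) x) * φ x) - ∫ x, u (kernelAt (D.kernelLt n) x) * φ x := by
  induction N, hN using Nat.le_induction with
  | base => simp
  | succ N hN ih =>
    rw [Finset.sum_Ico_succ_top hN, ih, kernelLt_succ]
    simp_rw [kernelAt_add, map_add, add_mul]
    rw [integral_add (integrable_mul_pairing_kernelAt _ _ _) (integrable_mul_pairing_kernelAt _ _ _)]
    ring

theorem tendsto_integral_pairing_kernelLt (u : 𝓢'(Euc d, ℂ)) (φ : 𝓢(Euc d, ℂ)) :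
    Tendsto (fun N : ℕ => ∫ x, u (kernelAt (D.kernelLt N) x) * φ x) atTop (𝓝 (u φ)) := by
  simp_rw [kernelAt_kernelLt]
  exact (tendsto_integral_rescale u _ φ D.integral_kernelAt_neg_one).comp tendsto_dyadicScale

theorem integral_pairing_kernelLt_one (u : 𝓢'(Euc d, ℂ)) {j : ℕ} (hj : 2 ≤ j) (y : Euc d) :
    ∫ x, u (kernelAt (D.kernelLt 1) x) * kernelAt (D.kernel j) y x = 0 := by
  rw [integral_mul_pairing_kernelAt]
  have : conv (kernelAt (D.kernel j) y) (kernelAt (D.kernelLt 1) 0) = 0 := by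
    refine fourier_injective fun ξ => ?_
    rw [fourier_conv, fourier_kernelAt, fourier_kernelAt, mul_mul_mul_comm,
      D.fourier_kernel_mul_kernelLt_one hj, mul_zero, FourierTransform.fourier_zero]
    rfl
  rw [this, map_zero]

end DyadicPartition

namespace Model

variable {S : RegularityStructure.{u}} {d : ℕ} {r γ : ℝ} {M : Model S d r}

open RegularityStructure

/-- The local descriptions of `f`, relative to the one at `y`. -/
def relDist (f : M.modelled γ) (y z : Euc d) : 𝓢'(Euc d, ℂ) :=
  M.Pi z (f.1 z) - M.Pi y (f.1 y)

theorem relDist_apply (f : M.modelled γ) (y z : Euc d) (φ : 𝓢(Euc d, ℂ)) :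
    relDist f y z φ = M.Pi z (f.1 z) φ - M.Pi y (f.1 y) φ := rfl

/-- The paraproduct block of `f` relative to the point `y`. -/
def relBlock (D : DyadicPartition d) (f : M.modelled γ) (y : Euc d) (i : ℕ) (x : Euc d) : ℂ :=
  ∫ z, blockIntegrand (kernelAt (D.kernel (-1)) 0) (kernelAt (D.kernel 0) 0) (relDist f y)
    (dyadicScale i) x z

theorem continuous_relDist (hr : 0 < r) (f : M.modelled γ) (y : Euc d) (φ : 𝓢(Euc d, ℂ)) :
    Continuous fun z => relDist f y z φ :=
  (continuous_pairing hr f φ).sub continuous_const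

/-- A sum of two weights, each at least `1`, is at most twice their product; the product form
separates the integration in `z` from the growth in `x - y`. -/
theorem exists_bound_relDist (hr : 0 < r) (ha : S.minA < γ) (f : M.modelled γ) (V : 𝓢(Euc d, ℂ)) :
    ∃ C, 0 ≤ C ∧ ∀ (x y z : Euc d) (μ : ℝ), 0 < μ → μ ≤ 1 →
      ‖relDist f y z (rescale V x μ)‖ ≤ C * μ ^ γ * (1 + ‖x - y‖ / μ) ^ (γ - S.minA) *
        (1 + ‖x - z‖ / μ) ^ (γ - S.minA) := by
  obtain ⟨C, hC, h⟩ := exists_bound_sub hr f V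
  refine ⟨2 * C, by positivity, fun x y z μ hμ hμ1 => (h x y z μ hμ hμ1).trans ?_⟩
  have h1 : 1 ≤ (1 + ‖x - y‖ / μ) ^ (γ - S.minA) := by
    refine Real.one_le_rpow ?_ (sub_nonneg.2 ha.le)
    have : 0 ≤ ‖x - y‖ / μ := by positivity
    linarith
  have h2 : 1 ≤ (1 + ‖x - z‖ / μ) ^ (γ - S.minA) := by
    refine Real.one_le_rpow ?_ (sub_nonneg.2 ha.le)
    have : 0 ≤ ‖x - z‖ / μ := by positivity
    linarith
  have h3 : 0 ≤ C * μ ^ γ := by positivity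
  set X := (1 + ‖x - y‖ / μ) ^ (γ - S.minA)
  set Y := (1 + ‖x - z‖ / μ) ^ (γ - S.minA)
  calc C * μ ^ γ * (Y + X) ≤ C * μ ^ γ * (2 * (X * Y)) :=
        mul_le_mul_of_nonneg_left (by nlinarith) h3
    _ = _ := by ring

theorem stronglyMeasurable_relBlock (hr : 0 < r) (D : DyadicPartition d) (f : M.modelled γ)
    (y : Euc d) (i : ℕ) : StronglyMeasurable (relBlock D f y i) :=
  stronglyMeasurable_block (continuous_relDist hr f y) (dyadicScale_pos i)

theorem exists_bound_relBlock (hr : 0 < r) (ha : S.minA < γ) (D : DyadicPartition d)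
    (f : M.modelled γ) : ∃ C, 0 ≤ C ∧ ∀ i x y, ‖relBlock D f y i x‖ ≤
      C * dyadicScale i ^ γ * (1 + ‖x - y‖ / dyadicScale i) ^ (γ - S.minA) := by
  obtain ⟨C, hC, h⟩ := exists_bound_relDist hr ha f (kernelAt (D.kernel 0) 0)
  have hB := blockConst_nonneg (kernelAt (D.kernel (-1)) 0) (γ - S.minA)
  refine ⟨C * blockConst (kernelAt (D.kernel (-1)) 0) (γ - S.minA), by positivity,
    fun i x y => ?_⟩
  have hμ := dyadicScale_pos i
  refine (norm_block_le hμ (sub_nonneg.2 ha.le)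
    fun z => h x y z _ hμ (dyadicScale_le_one _)).trans (le_of_eq ?_)
  ring

theorem relBlock_reproducing (hr : 0 < r) (ha : S.minA < γ) (D : DyadicPartition d)
    {H : 𝓢(Euc d, ℂ)}
    (hH : ∀ w z t, rescale (D.kernel (-1)) 0 2 (w - z) * D.kernel 0 (w - t) =
      ∫ w', H (w - w') * (rescale (D.kernel (-1)) 0 2 (w' - z) * D.kernel 0 (w' - t)))
    (f : M.modelled γ) (i : ℕ) (y w : Euc d) :
    relBlock D f y i (y + dyadicScale i • w) =
      ∫ w', H (w - w') * relBlock D f y i (y + dyadicScale i • w') := by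
  obtain ⟨C, hC, h⟩ := exists_bound_relDist hr ha f (kernelAt (D.kernel 0) 0)
  have hμ := dyadicScale_pos i
  refine block_reproducing hH (continuous_relDist hr f y) hμ (sub_nonneg.2 ha.le)
    (B := C * dyadicScale i ^ γ) (fun w z => ?_) w
  refine (h _ y z _ hμ (dyadicScale_le_one _)).trans (le_of_eq ?_)
  rw [add_sub_cancel_left, norm_smul, Real.norm_of_nonneg hμ.le, mul_div_cancel_left₀ _ hμ.ne']

/-- `Π_y f_y` does not depend on `z` and the low-frequency kernel has integral one. This fails for
`i = 0`, where the paraproduct block vanishes but `relBlock` is still defined with a genuine kernel.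
-/
theorem relBlock_eq (hr : 0 < r) (ha : S.minA < γ) (D : DyadicPartition d) (f : M.modelled γ)
    (y : Euc d) {i : ℕ} (hi : 1 ≤ i) (x : Euc d) :
    relBlock D f y i x = M.paraBlock D f.1 i x - M.Pi y (f.1 y) (kernelAt (D.kernel i) x) := by
  obtain ⟨i, rfl⟩ := Nat.exists_eq_add_of_le' hi
  have hi1 := integrable_paraIntegrand hr ha D f (i + 1) x
  have h2 : 0 < 2 * dyadicScale (i + 1) := by have := dyadicScale_pos (i + 1); positivity
  have e : ∀ z, blockIntegrand (kernelAt (D.kernel (-1)) 0) (kernelAt (D.kernel 0) 0) (relDist f y)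
      (dyadicScale (i + 1)) x z = M.paraIntegrand D f.1 (i + 1) x z -
      rescale (kernelAt (D.kernel (-1)) 0) x (2 * dyadicScale (i + 1)) z *
        M.Pi y (f.1 y) (kernelAt (D.kernel (i + 1 : ℕ)) x) := by
    intro z
    rw [paraIntegrand_succ, blockIntegrand, blockIntegrand, relDist_apply, mul_sub,
      D.kernelAt_kernel]
  rw [relBlock]
  simp_rw [e]
  rw [integral_sub hi1 ((rescale _ x _).integrable.mul_const _), integral_mul_const,
    integral_rescale _ _ h2, D.integral_kernelAt_neg_one, one_mul]
  rfl

/-- The blocks of `Π_y f_y` telescope to `K_{<N}`, an approximate identity, minus `K_{<1}`. The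
latter remains as a correction since the sum starts at `1`. -/
theorem tendsto_sum_relBlock (hr : 0 < r) (ha : S.minA < γ) {D : DyadicPartition d}
    {f : M.modelled γ} {p : 𝓢'(Euc d, ℂ)} (hp : M.IsParaproduct D f.1 p) (y : Euc d)
    (φ : 𝓢(Euc d, ℂ)) :
    Tendsto (fun N => ∑ i ∈ Finset.Ico 1 N, ∫ x, relBlock D f y i x * φ x) atTop
      (𝓝 (p φ - M.Pi y (f.1 y) φ +
        ∫ x, M.Pi y (f.1 y) (kernelAt (D.kernelLt 1) x) * φ x)) := by
  have h1 := (hp.2 φ).2.tendsto_sum_nat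
  have h2 := D.tendsto_integral_pairing_kernelLt (M.Pi y (f.1 y)) φ
  refine ((h1.sub h2).add_const _).congr' ?_
  filter_upwards [eventually_ge_atTop 1] with N hN
  have e : ∀ i ∈ Finset.Ico 1 N, ∫ x, relBlock D f y i x * φ x =
      (∫ x, M.paraBlock D f.1 i x * φ x) -
        ∫ x, M.Pi y (f.1 y) (kernelAt (D.kernel i) x) * φ x := by
    intro i hi
    rw [← integral_sub ((hp.2 φ).1 i) (integrable_mul_pairing_kernelAt _ _ _)]
    congr 1; ext x
    rw [relBlock_eq hr ha D f y (Finset.mem_Ico.1 hi).1, sub_mul]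
  have e0 : ∫ x, M.paraBlock D f.1 0 x * φ x = 0 := by simp [paraBlock_zero]
  rw [Finset.sum_congr rfl e, Finset.sum_sub_distrib, D.sum_integral_pairing_kernelAt _ _ hN,
    Finset.range_eq_Ico, Finset.sum_eq_sum_Ico_succ_bot (by omega : 0 < N), e0, zero_add,
    Nat.cast_one]
  ring

/-- Spectral orthogonality leaves only the indices within `N₀` of `j`, each of size `2^{-jγ}`.
Blocks far above `j` vanish because `V` has compact spectrum; blocks far below vanish because `V` is
annular, and for `j = 0` there are none, so `K_{-1}` is covered as well. -/
theorem exists_bound_sum_relBlock (hr : 0 < r) (ha : S.minA < γ) (D : DyadicPartition d)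
    (f : M.modelled γ) {V : 𝓢(Euc d, ℂ)} (hV : HasCompactSupport (𝓕 V : 𝓢(Euc d, ℂ))) :
    ∃ C, 0 ≤ C ∧ ∀ (y : Euc d) (j N : ℕ), (IsAnnular V ∨ j = 0) →
      ‖∑ i ∈ Finset.Ico 1 N, ∫ x, relBlock D f y i x * rescale V y (dyadicScale j) x‖
        ≤ C * dyadicScale j ^ γ := by
  obtain ⟨H, hHa, -, hH⟩ := D.exists_annular
  have hM : 0 ≤ γ - S.minA := sub_nonneg.2 ha.le
  obtain ⟨C, hC, hb⟩ := exists_bound_relBlock hr ha D f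
  obtain ⟨R₀, hR₀⟩ := hHa.exists_large hV
  have hsmall : ∃ r₀ : ℝ, 0 < r₀ ∧ ∀ R, R ≤ r₀ → 0 < R → IsAnnular V → ∀ x ξ,
      (𝓕 H : 𝓢(Euc d, ℂ)) (-ξ) * (𝓕 (rescale V x R) : 𝓢(Euc d, ℂ)) ξ = 0 := by
    by_cases hVa : IsAnnular V
    · obtain ⟨r₀, h0, h⟩ := hHa.exists_small hVa
      exact ⟨r₀, h0, fun R h1 h2 _ => h R h1 h2⟩
    · exact ⟨1, one_pos, fun _ _ _ h => absurd h hVa⟩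
  obtain ⟨r₀, hr₀, hsm⟩ := hsmall
  obtain ⟨N₁, hN₁⟩ := pow_unbounded_of_one_lt R₀ (one_lt_two (α := ℝ))
  obtain ⟨N₂, hN₂⟩ := pow_unbounded_of_one_lt r₀⁻¹ (one_lt_two (α := ℝ))
  -- `2^{N₀}` exceeds both `R₀` and `r₀⁻¹`, so any scale ratio beyond `N₀` octaves falls under one
  -- of the two separation statements.
  set N₀ := max N₁ N₂
  have hR₀' : R₀ ≤ 2 ^ N₀ := hN₁.le.trans (pow_le_pow_right₀ one_le_two (le_max_left _ _))
  have hr₀' : r₀⁻¹ ≤ 2 ^ N₀ := hN₂.le.trans (pow_le_pow_right₀ one_le_two (le_max_right _ _))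
  have hIV : 0 ≤ ∫ w, ‖V w‖ * (1 + ‖w‖) ^ (γ - S.minA) :=
    integral_nonneg fun w => by positivity
  set A := C * (2 ^ N₀ : ℝ) ^ |γ| * (2 ^ N₀ : ℝ) ^ (γ - S.minA) *
    ∫ w, ‖V w‖ * (1 + ‖w‖) ^ (γ - S.minA) with hA
  have hA0 : 0 ≤ A := by positivity
  refine ⟨(2 * N₀ + 1 : ℕ) * A, by positivity, fun y j N hj => ?_⟩
  have hμj := dyadicScale_pos j
  have hzero : ∀ i, ¬ (i ≤ j + N₀ ∧ j ≤ i + N₀) →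
      ∫ x, relBlock D f y i x * rescale V y (dyadicScale j) x = 0 := by
    intro i hi
    have hμ := dyadicScale_pos i
    rw [integral_mul_rescale_eq V _ y hμ hμj]
    refine integral_mul_eq_zero_of_reproducing (H := H) (g := fun w => relBlock D f y i
      (y + dyadicScale i • w)) (B := C * dyadicScale i ^ γ) hM
      ((stronglyMeasurable_relBlock hr D f y i).comp_measurable (by fun_prop)) (fun w => ?_)
      (relBlock_reproducing hr ha D hH f i y) (fun ξ => ?_)
    · refine (hb i _ y).trans (le_of_eq ?_)
      rw [add_sub_cancel_left, norm_smul, Real.norm_of_nonneg hμ.le,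
        mul_div_cancel_left₀ _ hμ.ne']
    · rw [not_and_or, not_le, not_le] at hi
      rcases hi with hi | hi
      · refine hR₀ _ (hR₀'.trans ?_) (by positivity) 0 ξ
        rw [le_div_iff₀ hμ]
        have h1 : dyadicScale i ≤ dyadicScale (j + N₀) :=
          pow_le_pow_of_le_one (by norm_num) (by norm_num) hi.le
        have h2 : dyadicScale (j + N₀) * 2 ^ N₀ = dyadicScale j := by
          rw [dyadicScale_add, mul_assoc, dyadicScale, dyadicScale, ← mul_pow]
          norm_num
        calc 2 ^ N₀ * dyadicScale i ≤ 2 ^ N₀ * dyadicScale (j + N₀) := by gcongr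
          _ = dyadicScale j := by rw [mul_comm, h2]
      · refine hsm _ ?_ (by positivity) (hj.resolve_right (by omega)) 0 ξ
        rw [div_le_iff₀ hμ]
        have h1 : dyadicScale j ≤ dyadicScale (i + N₀) :=
          pow_le_pow_of_le_one (by norm_num) (by norm_num) hi.le
        have h2 : dyadicScale N₀ ≤ r₀ := by
          rw [dyadicScale, one_div, inv_pow]
          exact inv_le_of_inv_le₀ hr₀ hr₀'
        rw [dyadicScale_add] at h1
        calc dyadicScale j ≤ dyadicScale i * dyadicScale N₀ := h1
          _ ≤ dyadicScale i * r₀ := by gcongr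
          _ = _ := mul_comm _ _
  have hbound : ∀ i, i ≤ j + N₀ → j ≤ i + N₀ →
      ‖∫ x, relBlock D f y i x * rescale V y (dyadicScale j) x‖ ≤ A * dyadicScale j ^ γ := by
    intro i h1 h2
    have hμ := dyadicScale_pos i
    have h3 := dyadicScale_le_mul h1
    refine (norm_integral_mul_rescale_le_of_growth V hμj
      (B := C * ((2 ^ N₀ : ℝ) ^ |γ| * dyadicScale j ^ γ) * (2 ^ N₀ : ℝ) ^ (γ - S.minA))
      (M := γ - S.minA) fun w => ?_).trans (le_of_eq ?_)
    · refine (hb i _ y).trans ?_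
      rw [mul_assoc _ ((2 ^ N₀ : ℝ) ^ (γ - S.minA)), ← Real.mul_rpow (by positivity) (by positivity)]
      gcongr
      · exact dyadicScale_rpow_le h1 h2 γ
      · rw [add_sub_cancel_left, norm_smul, Real.norm_of_nonneg hμj.le, mul_add, mul_one]
        have h4 : dyadicScale j * ‖w‖ / dyadicScale i ≤ 2 ^ N₀ * ‖w‖ := by
          rw [div_le_iff₀ hμ]
          calc dyadicScale j * ‖w‖ ≤ 2 ^ N₀ * dyadicScale i * ‖w‖ := by gcongr
            _ = _ := by ring
        have h5 : (1 : ℝ) ≤ 2 ^ N₀ := one_le_pow₀ one_le_two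
        linarith
    · rw [hA]; ring
  set I := (Finset.Ico 1 N).filter fun i => i ≤ j + N₀ ∧ j ≤ i + N₀ with hI
  have hsub : ∑ i ∈ Finset.Ico 1 N, ∫ x, relBlock D f y i x * rescale V y (dyadicScale j) x
      = ∑ i ∈ I, ∫ x, relBlock D f y i x * rescale V y (dyadicScale j) x := by
    rw [hI, Finset.sum_filter_of_ne]
    intro i _ hne
    by_contra hcon
    exact hne (hzero i hcon)
  have hcard : I.card ≤ 2 * N₀ + 1 := by
    have : I ⊆ Finset.Icc (j - N₀) (j + N₀) := fun i hi => by
      have := (Finset.mem_filter.1 hi).2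
      exact Finset.mem_Icc.2 ⟨by omega, this.1⟩
    refine (Finset.card_le_card this).trans ?_
    rw [Nat.card_Icc]
    omega
  rw [hsub]
  refine (norm_sum_le _ _).trans ((Finset.sum_le_card_nsmul _ _ (A * dyadicScale j ^ γ)
    fun i hi => ?_).trans ?_)
  · have := (Finset.mem_filter.1 hi).2
    exact hbound i this.1 this.2
  · rw [nsmul_eq_mul, mul_assoc ((2 * N₀ + 1 : ℕ) : ℝ) A]
    exact mul_le_mul_of_nonneg_right (by exact_mod_cast hcard) (by positivity)

theorem exists_bound_integral_kernelLt_one (hr : 0 < r) (ha : S.minA < γ) (D : DyadicPartition d)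
    (f : M.modelled γ) (V : 𝓢(Euc d, ℂ)) : ∃ C, 0 ≤ C ∧ ∀ (y : Euc d) (ν : ℝ), 0 < ν → ν ≤ 1 →
      ‖∫ x, M.Pi y (f.1 y) (kernelAt (D.kernelLt 1) x) * rescale V y ν x‖ ≤ C := by
  obtain ⟨C, hC, h⟩ := exists_bound_growth hr f (kernelAt (D.kernel (-1)) 0)
  have hμ := dyadicScale_pos 1
  have hIV : 0 ≤ ∫ w, ‖V w‖ * (1 + ‖w‖) ^ (γ - S.minA) :=
    integral_nonneg fun w => by positivity
  refine ⟨C * dyadicScale 1 ^ S.minA * ∫ w, ‖V w‖ * (1 + ‖w‖) ^ (γ - S.minA), by positivity,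
    fun y ν hν hν1 => norm_integral_mul_rescale_le_of_growth V hν fun w => ?_⟩
  have e := D.kernelAt_kernelLt 1
  rw [Nat.cast_one] at e
  rw [e]
  refine (h _ y _ hμ (dyadicScale_le_one _)).trans ?_
  rw [add_sub_cancel_left, norm_smul, Real.norm_of_nonneg hν.le]
  refine mul_le_mul_of_nonneg_left (Real.rpow_le_rpow (by positivity) ?_ (sub_nonneg.2 ha.le))
    (by positivity)
  have := mul_le_of_le_one_left (norm_nonneg w) hν1
  linarith

/-- The Littlewood--Paley blocks of `P f - Π_y f_y` at `y`. -/
theorem exists_bound_remBlock (hr : 0 < r) (ha : S.minA < γ) {D : DyadicPartition d}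
    {f : M.modelled γ} {p : 𝓢'(Euc d, ℂ)} (hp : M.IsParaproduct D f.1 p) :
    ∃ C, 0 ≤ C ∧ ∀ y, ‖M.remBlock D f.1 p (-1) y‖ ≤ C ∧
      ∀ j : ℕ, ‖M.remBlock D f.1 p j y‖ ≤ C * dyadicScale j ^ γ := by
  have key : ∀ V : 𝓢(Euc d, ℂ), HasCompactSupport (𝓕 V : 𝓢(Euc d, ℂ)) →
      ∃ C, 0 ≤ C ∧ ∀ (y : Euc d) (j : ℕ), (IsAnnular V ∨ j = 0) →
        (2 ≤ j → ∫ x, M.Pi y (f.1 y) (kernelAt (D.kernelLt 1) x) *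
          rescale V y (dyadicScale j) x = 0) →
        ‖p (rescale V y (dyadicScale j)) - M.Pi y (f.1 y) (rescale V y (dyadicScale j))‖
          ≤ C * dyadicScale j ^ γ := by
    intro V hV
    obtain ⟨C, hC, h⟩ := exists_bound_sum_relBlock hr ha D f hV
    obtain ⟨C', hC', h'⟩ := exists_bound_integral_kernelLt_one hr ha D f V
    have hm1 := dyadicScale_pos 1
    -- The low-frequency correction is merely bounded. For `j = 0, 1` a constant absorbs the missing
    -- `2^{-jγ}`, the inverse of `dyadicScale 1 ^ γ` treating `j = 1`; for `j ≥ 2` the correction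
    -- vanishes.
    refine ⟨C + C' * (1 + (dyadicScale 1 ^ γ)⁻¹), by positivity, fun y j hj h0 => ?_⟩
    have hμ := dyadicScale_pos j
    have h1 := le_of_tendsto
      (tendsto_sum_relBlock hr ha hp y (rescale V y (dyadicScale j))).norm
      (Eventually.of_forall fun N => h y j N hj)
    set X := ∫ x, M.Pi y (f.1 y) (kernelAt (D.kernelLt 1) x) * rescale V y (dyadicScale j) x
    have h2 : ‖X‖ ≤ C' * (1 + (dyadicScale 1 ^ γ)⁻¹) * dyadicScale j ^ γ := by
      rcases Nat.lt_or_ge j 2 with hj2 | hj2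
      · refine (h' y _ hμ (dyadicScale_le_one j)).trans ?_
        rw [mul_assoc]
        refine le_mul_of_one_le_right hC' ?_
        interval_cases j
        · have : dyadicScale 0 = 1 := by simp [dyadicScale]
          rw [this, Real.one_rpow, mul_one]
          have : 0 ≤ (dyadicScale 1 ^ γ)⁻¹ := by positivity
          linarith
        · rw [add_mul, inv_mul_cancel₀ (by positivity)]
          have : 0 ≤ dyadicScale 1 ^ γ := by positivity
          linarith
      · rw [h0 hj2, norm_zero]
        positivity
    rw [add_mul]
    refine le_trans ?_ (add_le_add h1 h2)
    have := norm_sub_le (p (rescale V y (dyadicScale j)) -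
      M.Pi y (f.1 y) (rescale V y (dyadicScale j)) + X) X
    rwa [add_sub_cancel_right] at this
  -- The block `-1` has no annular spectrum and is handled at `j = 0` only; all the others are
  -- rescalings of one annular kernel.
  obtain ⟨C, hC, h⟩ := key _ (hasCompactSupport_fourier_kernelAt
    D.hasCompactSupport_fourier_kernel_neg_one)
  obtain ⟨C', hC', h'⟩ := key _ D.isAnnular_kernel_zero.kernelAt.1
  have e0 : dyadicScale 0 = 1 := by simp [dyadicScale]
  refine ⟨C + C', by positivity, fun y => ⟨?_, fun j => ?_⟩⟩
  · have h1 := h y 0 (Or.inr rfl) (by omega)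
    rw [e0, Real.one_rpow, mul_one, rescale_one, ← kernelAt_eq_shift] at h1
    exact h1.trans (by linarith)
  · have hμ := dyadicScale_pos j
    have h1 := h' y j (Or.inl D.isAnnular_kernel_zero.kernelAt) (fun hj => by
      rw [← D.kernelAt_kernel]
      exact D.integral_pairing_kernelLt_one _ hj y)
    rw [← D.kernelAt_kernel] at h1
    refine h1.trans ?_
    gcongr
    linarith

end Model

end

section

open Filter Topology SchwartzMap

/-! ### Reconstruction -/

theorem summable_dyadicScale_rpow {e : ℝ} (he : 0 < e) : Summable fun k => dyadicScale k ^ e := by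
  simp_rw [dyadicScale_rpow]
  exact summable_geometric_of_lt_one (by positivity)
    (Real.rpow_lt_one (by norm_num) (by norm_num) he)

theorem exists_dyadicScale_near {lam : ℝ} (h0 : 0 < lam) (h1 : lam ≤ 1) :
    ∃ i : ℕ, dyadicScale (i + 1) ≤ lam ∧ lam ≤ dyadicScale i := by
  obtain ⟨n, h2, h3⟩ := exists_nat_pow_near_of_lt_one h0 h1 (by norm_num : (0 : ℝ) < 1 / 2)
    (by norm_num)
  exact ⟨n, h2.le, h3⟩

theorem dyadicScale_antitone : Antitone dyadicScale := fun _ _ h =>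
  pow_le_pow_of_le_one (by norm_num) (by norm_num) h

theorem dyadicScale_succ (i : ℕ) : dyadicScale i = 2 * dyadicScale (i + 1) := by
  rw [dyadicScale, dyadicScale, pow_succ]; ring

theorem dyadicScale_succ_rpow_le {lam : ℝ} (h0 : 0 < lam) {i : ℕ} (h1 : dyadicScale (i + 1) ≤ lam)
    (h2 : lam ≤ dyadicScale i) (γ : ℝ) : dyadicScale (i + 1) ^ γ ≤ 2 ^ |γ| * lam ^ γ := by
  have hi := dyadicScale_pos (i + 1)
  rw [dyadicScale_succ] at h2
  have h := rpow_le_rpow_abs (t := dyadicScale (i + 1) / lam) (X := 2) (γ := γ) one_le_two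
    (by rw [le_div_iff₀ h0]; linarith) (by rw [div_le_iff₀ h0]; linarith)
  rwa [Real.div_rpow hi.le h0.le, div_le_iff₀ (by positivity)] at h

theorem IsUnitTest.integral_weight_le {d : ℕ} {s : ℝ} {φ : 𝓢(Euc d, ℂ)} (h : IsUnitTest s φ)
    {M : ℝ} (hM : 0 ≤ M) : ∫ w, ‖φ w‖ * (1 + ‖w‖) ^ M ≤
      2 ^ M * volume.real (Metric.closedBall (0 : Euc d) 1) := by
  have hfin : volume (Metric.closedBall (0 : Euc d) 1) < ⊤ := measure_closedBall_lt_top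
  have e : ∫ w, ‖φ w‖ * (1 + ‖w‖) ^ M
      = ∫ w in Metric.closedBall (0 : Euc d) 1, ‖φ w‖ * (1 + ‖w‖) ^ M := by
    refine (setIntegral_eq_integral_of_forall_compl_eq_zero fun w hw => ?_).symm
    rw [image_eq_zero_of_notMem_tsupport fun hw' => hw (h.1 hw'), norm_zero, zero_mul]
  rw [e]
  refine (le_abs_self _).trans ?_
  rw [← Real.norm_eq_abs]
  refine norm_setIntegral_le_of_norm_le_const hfin fun w hw => ?_
  rw [mem_closedBall_zero_iff] at hw
  rw [Real.norm_of_nonneg (by positivity)]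
  have h0 := h.norm_iteratedFDeriv_le (Nat.zero_le _) w
  rw [norm_iteratedFDeriv_zero] at h0
  calc ‖φ w‖ * (1 + ‖w‖) ^ M ≤ 1 * 2 ^ M := by
        gcongr
        linarith
    _ = _ := one_mul _

theorem IsUnitTest.norm_integral_mul_rescale_le {d : ℕ} {s : ℝ} {φ : 𝓢(Euc d, ℂ)}
    (h : IsUnitTest s φ) {g : Euc d → ℂ} {B M lam : ℝ} (hM : 0 ≤ M) (hlam : 0 < lam) {x : Euc d}
    (hg : ∀ w, ‖g (x + lam • w)‖ ≤ B * (1 + ‖w‖) ^ M) :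
    ‖∫ y, g y * rescale φ x lam y‖
      ≤ 2 ^ M * volume.real (Metric.closedBall (0 : Euc d) 1) * B := by
  have hB : 0 ≤ B := by simpa using (norm_nonneg _).trans (hg 0)
  refine (norm_integral_mul_rescale_le_of_growth φ hlam hg).trans ?_
  rw [mul_comm]
  exact mul_le_mul_of_nonneg_right (h.integral_weight_le hM) hB

/-- Littlewood–Paley blocks of any tempered distribution are spectrally localized; only the factor
`K_j` is involved, so the first reproducing formula of `H` suffices. -/
theorem pairing_kernelAt_reproducing {d : ℕ} (D : DyadicPartition d) {H : 𝓢(Euc d, ℂ)}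
    (hH : ∀ w t, D.kernel 0 (w - t) = ∫ w', H (w - w') * D.kernel 0 (w' - t))
    (v : 𝓢'(Euc d, ℂ)) (j : ℕ) (x w : Euc d) :
    v (kernelAt (D.kernel j) (x + dyadicScale j • w)) =
      ∫ w', H (w - w') * v (kernelAt (D.kernel j) (x + dyadicScale j • w')) := by
  have hμ := dyadicScale_pos j
  set u := compDist v (rescaleCLM x (dyadicScale j)) with hu
  have e : ∀ w, v (kernelAt (D.kernel j) (x + dyadicScale j • w))
      = u ((kernelAt (D.kernel 0) 0).compSubConstCLM ℂ w) := by
    intro w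
    rw [hu, compDist_apply, rescaleCLM_apply _ _ hμ, rescale_shift _ _ _ hμ, D.kernelAt_kernel]
  have hp := pairing_shift u (c := fun w' => H (w - w')) (by fun_prop) (by
      have := (kernelAt H w).rapidDecay
      convert this using 2
      rw [kernelAt_apply])
    (kernelAt (D.kernel 0) 0) ((kernelAt (D.kernel 0) 0).compSubConstCLM ℂ w) (fun t => by
      rw [compSubConstCLM_apply, kernelAt_apply, zero_sub, neg_sub, hH]
      congr 1
      ext w'
      rw [kernelAt_apply, zero_sub, neg_sub])
  simp_rw [e]
  exact hp.2.symm

namespace Model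

variable {S : RegularityStructure.{u}} {d : ℕ} {r γ : ℝ} {M : Model S d r}

open RegularityStructure

theorem exists_bound_relDist_self (hr : 0 < r) (ha : S.minA < γ) (f : M.modelled γ)
    (V : 𝓢(Euc d, ℂ)) : ∃ C, 0 ≤ C ∧ ∀ (x y : Euc d) (μ : ℝ), 0 < μ → μ ≤ 1 →
      ‖relDist f x y (rescale V y μ)‖ ≤ C * μ ^ γ * (1 + ‖y - x‖ / μ) ^ (γ - S.minA) := by
  obtain ⟨C, hC, h⟩ := exists_bound_relDist hr ha f V
  refine ⟨C, hC, fun x y μ hμ hμ1 => (h y x y μ hμ hμ1).trans (le_of_eq ?_)⟩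
  simp

/-- Insert `Π_y f_y`: the blocks at `y` of `P f - Π_y f_y` are already controlled, and the change of
base point is controlled by the definition of `𝒟^γ`. -/
theorem sub_pairing_eq (f : M.modelled γ) (D : DyadicPartition d) (p : 𝓢'(Euc d, ℂ)) (j : ℤ)
    (x y : Euc d) : (p - M.Pi x (f.1 x)) (kernelAt (D.kernel j) y) =
      M.remBlock D f.1 p j y + relDist f x y (kernelAt (D.kernel j) y) := by
  rw [remBlock, relDist_apply, sub_add_sub_cancel]
  rfl

/-- The Littlewood--Paley blocks of `P f - Π_x f_x`. -/
theorem exists_bound_sub_pairing (hr : 0 < r) (ha : S.minA < γ) {D : DyadicPartition d}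
    {f : M.modelled γ} {p : 𝓢'(Euc d, ℂ)} (hp : M.IsParaproduct D f.1 p) :
    ∃ C, 0 ≤ C ∧ ∀ x y,
      ‖(p - M.Pi x (f.1 x)) (kernelAt (D.kernel (-1)) y)‖
        ≤ C * (1 + ‖y - x‖) ^ (γ - S.minA) ∧
      ∀ j : ℕ, ‖(p - M.Pi x (f.1 x)) (kernelAt (D.kernel j) y)‖
        ≤ C * dyadicScale j ^ γ * (1 + ‖y - x‖ / dyadicScale j) ^ (γ - S.minA) := by
  obtain ⟨C, hC, h⟩ := exists_bound_remBlock hr ha hp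
  obtain ⟨C₁, hC₁, h₁⟩ := exists_bound_relDist_self hr ha f (kernelAt (D.kernel (-1)) 0)
  obtain ⟨C₂, hC₂, h₂⟩ := exists_bound_relDist_self hr ha f (kernelAt (D.kernel 0) 0)
  have hone : ∀ t : ℝ, 0 ≤ t → 1 ≤ (1 + t) ^ (γ - S.minA) := fun t ht =>
    Real.one_le_rpow (by linarith) (sub_nonneg.2 ha.le)
  refine ⟨C + C₁ + C₂, by positivity, fun x y => ⟨?_, fun j => ?_⟩⟩
  · have hX := hone ‖y - x‖ (norm_nonneg _)
    have h3 := h₁ x y 1 one_pos le_rfl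
    rw [Real.one_rpow, mul_one, div_one, rescale_one, ← kernelAt_eq_shift] at h3
    rw [sub_pairing_eq]
    refine (norm_add_le_of_le (h y).1 h3).trans ?_
    set X := (1 + ‖y - x‖) ^ (γ - S.minA)
    nlinarith [mul_nonneg hC (sub_nonneg.2 hX), mul_nonneg hC₂ (zero_le_one.trans hX)]
  · have hμ := dyadicScale_pos j
    have hX := hone (‖y - x‖ / dyadicScale j) (by positivity)
    have h3 := h₂ x y _ hμ (dyadicScale_le_one j)
    rw [← D.kernelAt_kernel] at h3
    rw [sub_pairing_eq]
    refine (norm_add_le_of_le ((h y).2 j) h3).trans ?_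
    set X := (1 + ‖y - x‖ / dyadicScale j) ^ (γ - S.minA)
    have hY : 0 ≤ dyadicScale j ^ γ := by positivity
    set Y := dyadicScale j ^ γ
    have hCY := mul_nonneg hC hY
    nlinarith [mul_nonneg hCY (sub_nonneg.2 hX),
      mul_nonneg (mul_nonneg hC₁ hY) (zero_le_one.trans hX)]

/-- The contribution of the high frequencies to `P f - Π_x f_x`. -/
theorem exists_bound_high (hr : 0 < r) (ha : S.minA < γ) {D : DyadicPartition d}
    {f : M.modelled γ} {p : 𝓢'(Euc d, ℂ)} (hp : M.IsParaproduct D f.1 p) {s : ℝ} (hs : 0 < s)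
    (hsa : 0 < s + S.minA) :
    ∃ C, 0 ≤ C ∧ ∀ φ : 𝓢(Euc d, ℂ), IsUnitTest s φ → ∀ (x : Euc d) (lam : ℝ) (i N : ℕ),
      dyadicScale i ≤ lam →
      ‖∑ j ∈ Finset.Ico i N, ∫ y, (p - M.Pi x (f.1 x)) (kernelAt (D.kernel j) y) *
        rescale φ x lam y‖ ≤ C * lam ^ γ := by
  obtain ⟨H, hHa, hH, -⟩ := D.exists_annular
  have hM : 0 ≤ γ - S.minA := sub_nonneg.2 ha.le
  obtain ⟨C, hC, hb⟩ := exists_bound_sub_pairing hr ha hp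
  obtain ⟨C', hC', h'⟩ := hHa.norm_integral_mul_rescale_le hM hs
  have hsum := summable_dyadicScale_rpow hsa
  have hG0 : 0 ≤ ∑' k, dyadicScale k ^ (s + S.minA) :=
    tsum_nonneg fun k => by have := dyadicScale_pos k; positivity
  refine ⟨C' * C * ∑' k, dyadicScale k ^ (s + S.minA), by positivity,
    fun φ hφ x lam i N hi => ?_⟩
  have hlam : 0 < lam := (dyadicScale_pos i).trans_le hi
  have hterm : ∀ j ∈ Finset.Ico i N, ‖∫ y, (p - M.Pi x (f.1 x)) (kernelAt (D.kernel j) y) *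
      rescale φ x lam y‖ ≤ C' * C * lam ^ γ * dyadicScale (j - i) ^ (s + S.minA) := by
    intro j hj
    obtain ⟨k, rfl⟩ := Nat.exists_eq_add_of_le (Finset.mem_Ico.1 hj).1
    have hμ := dyadicScale_pos (i + k)
    have hk := dyadicScale_pos k
    have hjl : dyadicScale (i + k) ≤ lam := (dyadicScale_antitone (by omega)).trans hi
    refine (h' (C * dyadicScale (i + k) ^ γ) _ φ x _ lam hμ hjl hφ
      ?_ (fun w => ?_) (pairing_kernelAt_reproducing D hH _ (i + k) x)).trans ?_
    · refine ((continuous_pairing_shift (p - M.Pi x (f.1 x)) (kernelAt (D.kernel (i + k : ℕ))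
        0)).congr fun y => ?_).stronglyMeasurable
      rw [← kernelAt_eq_shift]
    · refine ((hb x _).2 _).trans (le_of_eq ?_)
      rw [add_sub_cancel_left, norm_smul, Real.norm_of_nonneg hμ.le, mul_div_cancel_left₀ _ hμ.ne']
    -- The gain `s - (γ - min A)` combines with the block size `2^{-(i+k)γ}` into `λ^γ` times the
    -- ratio of scales to the power `s + min A`. This exponent is positive, so the high frequencies
    -- are summable.
    · have e : dyadicScale (i + k) ^ γ * (dyadicScale (i + k) / lam) ^ (s - (γ - S.minA))
          = lam ^ γ * (dyadicScale (i + k) / lam) ^ (s + S.minA) := by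
        have h0 : 0 < dyadicScale (i + k) / lam := by positivity
        conv_lhs => rw [show dyadicScale (i + k) ^ γ = (lam * (dyadicScale (i + k) / lam)) ^ γ by
          rw [mul_div_cancel₀ _ hlam.ne'], Real.mul_rpow hlam.le h0.le, mul_assoc,
          ← Real.rpow_add h0]
        congr 2; ring
      have h1 : dyadicScale (i + k) / lam ≤ dyadicScale k := by
        rw [div_le_iff₀ hlam, dyadicScale_add, mul_comm]
        gcongr
      calc C' * (C * dyadicScale (i + k) ^ γ) * (dyadicScale (i + k) / lam) ^ (s - (γ - S.minA))
          = C' * C * (dyadicScale (i + k) ^ γ *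
            (dyadicScale (i + k) / lam) ^ (s - (γ - S.minA))) := by ring
        _ = C' * C * (lam ^ γ * (dyadicScale (i + k) / lam) ^ (s + S.minA)) := by rw [e]
        _ ≤ C' * C * (lam ^ γ * dyadicScale k ^ (s + S.minA)) := by gcongr
        _ = _ := by rw [add_tsub_cancel_left]; ring
  refine (norm_sum_le_of_le _ hterm).trans ?_
  rw [← Finset.mul_sum, Finset.sum_Ico_eq_sum_range]
  simp_rw [add_tsub_cancel_left]
  calc _ ≤ C' * C * lam ^ γ * ∑' k, dyadicScale k ^ (s + S.minA) := by
        gcongr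
        exact hsum.sum_le_tsum _ fun k _ => by have := dyadicScale_pos k; positivity
    _ = _ := by ring

/-- Splitting at frequency `2^i`. The value `L` is what the low frequencies converge to: zero for `γ
< 0`, the pairing with `T f` for `γ > 0`. -/
theorem norm_sub_pairing_le_of_low {D : DyadicPartition d} (v : 𝓢'(Euc d, ℂ)) (ψ : 𝓢(Euc d, ℂ))
    {i : ℕ} {L : ℂ} {X Y : ℝ}
    (hX : ∀ N, ‖∑ j ∈ Finset.Ico i N, ∫ y, v (kernelAt (D.kernel j) y) * ψ y‖ ≤ X)
    (hY : ‖(∫ y, v (kernelAt (D.kernelLt i) y) * ψ y) - L‖ ≤ Y) : ‖v ψ - L‖ ≤ X + Y := by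
  have h := (D.tendsto_integral_pairing_kernelLt v ψ).sub_const L
  refine le_of_tendsto h.norm ?_
  filter_upwards [eventually_ge_atTop i] with N hN
  have e := D.sum_integral_pairing_kernelAt v ψ hN
  have e2 : (∫ y, v (kernelAt (D.kernelLt N) y) * ψ y) - L =
      (∑ j ∈ Finset.Ico i N, ∫ y, v (kernelAt (D.kernel j) y) * ψ y) +
        ((∫ y, v (kernelAt (D.kernelLt i) y) * ψ y) - L) := by
    rw [e]; ring
  rw [e2]
  exact norm_add_le_of_le (hX N) hY

theorem integral_pairing_kernelLt_eq_sum (D : DyadicPartition d) (v : 𝓢'(Euc d, ℂ))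
    (ψ : 𝓢(Euc d, ℂ)) (i : ℕ) : ∫ y, v (kernelAt (D.kernelLt i) y) * ψ y =
      (∫ y, v (kernelAt (D.kernel (-1)) y) * ψ y) +
        ∑ j ∈ Finset.range i, ∫ y, v (kernelAt (D.kernel j) y) * ψ y := by
  have h0 : D.kernelLt (0 : ℕ) = D.kernel (-1) := by
    rw [D.kernelLt_natCast_eq_add]; simp
  rw [Finset.range_eq_Ico, D.sum_integral_pairing_kernelAt v ψ (Nat.zero_le i), h0]
  ring

/-- For negative `γ` the geometric sum grows, hence it is comparable to its last term; reversing the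
order of summation shows this. -/
theorem sum_dyadicScale_rpow_le {γ : ℝ} (hγ : γ < 0) (i : ℕ) :
    ∑ j ∈ Finset.range i, dyadicScale j ^ γ
      ≤ dyadicScale i ^ γ * ∑' k, dyadicScale k ^ (-γ) := by
  have hs := summable_dyadicScale_rpow (neg_pos.2 hγ)
  have e : ∀ j ∈ Finset.range i, dyadicScale j ^ γ = dyadicScale i ^ γ * dyadicScale (i - j) ^ (-γ) := by
    intro j hj
    have h1 := dyadicScale_pos j
    have h2 := dyadicScale_pos (i - j)
    have h3 : dyadicScale i = dyadicScale j * dyadicScale (i - j) := by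
      rw [← dyadicScale_add, Nat.add_sub_cancel' (Finset.mem_range.1 hj).le]
    rw [h3, Real.mul_rpow h1.le h2.le, mul_assoc, ← Real.rpow_add h2, add_neg_cancel,
      Real.rpow_zero, mul_one]
  have hi := dyadicScale_pos i
  rw [Finset.sum_congr rfl e, ← Finset.mul_sum]
  gcongr
  have h1 : ∑ j ∈ Finset.range i, dyadicScale (i - j) ^ (-γ)
      = ∑ k ∈ Finset.range i, dyadicScale (k + 1) ^ (-γ) := by
    rw [← Finset.sum_range_reflect]
    refine Finset.sum_congr rfl fun j hj => ?_
    have := Finset.mem_range.1 hj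
    congr 2
    omega
  rw [h1]
  calc _ ≤ ∑ k ∈ Finset.range (i + 1), dyadicScale k ^ (-γ) := by
        rw [Finset.sum_range_succ' (fun k => dyadicScale k ^ (-γ))]
        have := dyadicScale_pos 0
        have : 0 ≤ dyadicScale 0 ^ (-γ) := by positivity
        linarith
    _ ≤ _ := hs.sum_le_tsum _ fun k _ => by have := dyadicScale_pos k; positivity

/-- The generalized paraproduct is a reconstruction for `γ < 0`. -/
theorem IsParaproduct.isReconstruction (hr : 0 < r) (ha : S.minA < γ) (hγ : γ < 0)
    {D : DyadicPartition d} {f : M.modelled γ} {p : 𝓢'(Euc d, ℂ)} (hp : M.IsParaproduct D f.1 p)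
    {q : ℝ} (hs : 0 < q + γ) (hsa : 0 < q + γ + S.minA) : M.IsReconstruction q f p := by
  obtain ⟨C, hC, h⟩ := exists_bound_high hr ha hp hs hsa
  obtain ⟨C', hC', hb⟩ := exists_bound_sub_pairing hr ha hp
  have hM : 0 ≤ γ - S.minA := sub_nonneg.2 ha.le
  set A := 2 ^ (γ - S.minA) * volume.real (Metric.closedBall (0 : Euc d) 1) with hA
  have hA0 : 0 ≤ A := by positivity
  set G := ∑' k, dyadicScale k ^ (-γ)
  have hG : 0 ≤ G := tsum_nonneg fun k => by have := dyadicScale_pos k; positivity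
  refine ⟨C + A * C' * (1 + G) * 2 ^ |γ|, fun φ hφ x lam h0 h1 => ?_⟩
  -- Splitting at `i + 1` makes every high-frequency scale at most `lam`, while every scale `j ≤ i`
  -- is at least `lam`; the growth weight is then harmless on the support of `φ`.
  obtain ⟨i, hi1, hi2⟩ := exists_dyadicScale_near h0 h1
  have hμ := dyadicScale_pos (i + 1)
  have hlow : ‖(∫ y, (p - M.Pi x (f.1 x)) (kernelAt (D.kernelLt (i + 1 : ℕ)) y) *
      rescale φ x lam y) - 0‖ ≤ A * C' * (1 + G) * 2 ^ |γ| * lam ^ γ := by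
    rw [sub_zero, integral_pairing_kernelLt_eq_sum]
    have l1 : ‖∫ y, (p - M.Pi x (f.1 x)) (kernelAt (D.kernel (-1)) y) * rescale φ x lam y‖
        ≤ A * C' := by
      refine hφ.norm_integral_mul_rescale_le hM h0 fun w => ((hb x _).1).trans ?_
      rw [add_sub_cancel_left, norm_smul, Real.norm_of_nonneg h0.le]
      gcongr
      exact mul_le_of_le_one_left (norm_nonneg w) h1
    have l2 : ∀ j ∈ Finset.range (i + 1), ‖∫ y, (p - M.Pi x (f.1 x)) (kernelAt (D.kernel j) y) *
        rescale φ x lam y‖ ≤ A * C' * dyadicScale j ^ γ := by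
      intro j hj
      have hj0 := dyadicScale_pos j
      rw [mul_assoc]
      refine hφ.norm_integral_mul_rescale_le hM h0 fun w => ((hb x _).2 j).trans ?_
      rw [add_sub_cancel_left, norm_smul, Real.norm_of_nonneg h0.le]
      gcongr
      rw [div_le_iff₀ hj0, mul_comm]
      gcongr
      exact hi2.trans (dyadicScale_antitone (Nat.lt_succ_iff.1 (Finset.mem_range.1 hj)))
    refine (norm_add_le_of_le l1 (norm_sum_le_of_le _ l2)).trans ?_
    rw [← Finset.mul_sum]
    have l3 := sum_dyadicScale_rpow_le hγ (i + 1)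
    have l4 : 1 ≤ dyadicScale (i + 1) ^ γ :=
      Real.one_le_rpow_of_pos_of_le_one_of_nonpos hμ (dyadicScale_le_one _) hγ.le
    calc A * C' + A * C' * ∑ j ∈ Finset.range (i + 1), dyadicScale j ^ γ
        ≤ A * C' * dyadicScale (i + 1) ^ γ + A * C' * (dyadicScale (i + 1) ^ γ * G) := by
          exact add_le_add (le_mul_of_one_le_right (by positivity) l4)
            (mul_le_mul_of_nonneg_left l3 (by positivity))
      _ = A * C' * (1 + G) * dyadicScale (i + 1) ^ γ := by ring
      _ ≤ A * C' * (1 + G) * (2 ^ |γ| * lam ^ γ) := by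
          gcongr
          exact dyadicScale_succ_rpow_le h0 hi1 hi2 γ
      _ = _ := by ring
  have := norm_sub_pairing_le_of_low (p - M.Pi x (f.1 x)) (rescale φ x lam)
    (fun N => h φ hφ x lam (i + 1) N hi1) hlow
  rw [sub_zero, ← add_mul] at this
  exact this

end Model

end

section

open Filter Topology SchwartzMap

namespace Model

variable {S : RegularityStructure.{u}} {d : ℕ} {r γ : ℝ} {M : Model S d r}

open RegularityStructure

/-! ### The remainder for positive `γ` -/

theorem stronglyMeasurable_remBlock (hr : 0 < r) (D : DyadicPartition d) (f : M.modelled γ)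
    (p : 𝓢'(Euc d, ℂ)) (j : ℤ) : StronglyMeasurable (M.remBlock D f.1 p j) := by
  have h1 : Continuous fun y => p (kernelAt (D.kernel j) y) := by
    refine (continuous_pairing_shift p (kernelAt (D.kernel j) 0)).congr fun y => ?_
    rw [← kernelAt_eq_shift]
  have hd : Measurable fun y : Euc d => (y, y) := by fun_prop
  have h2 := (stronglyMeasurable_pairing hr f (kernelAt (D.kernel j) 0) one_pos).comp_measurable hd
  refine h1.stronglyMeasurable.sub ?_
  convert h2 using 2 with y
  rw [Function.comp_apply, rescale_one, ← kernelAt_eq_shift]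

/-- Reindexing by `n = j + 1` shifts the scale by one octave, which costs the factor `2 ^ γ`; the
block `-1` then fits the same geometric bound. -/
theorem exists_bound_remBlock_pred (hr : 0 < r) (ha : S.minA < γ) (hγ : 0 < γ)
    {D : DyadicPartition d} {f : M.modelled γ} {p : 𝓢'(Euc d, ℂ)} (hp : M.IsParaproduct D f.1 p) :
    ∃ C, 0 ≤ C ∧ ∀ (n : ℕ) y,
      ‖M.remBlock D f.1 p ((n : ℤ) - 1) y‖ ≤ C * dyadicScale n ^ γ := by
  obtain ⟨C, hC, h⟩ := exists_bound_remBlock hr ha hp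
  have h2 : (1 : ℝ) ≤ 2 ^ γ := Real.one_le_rpow one_le_two hγ.le
  refine ⟨C * 2 ^ γ, by positivity, fun n y => ?_⟩
  rcases n with _ | n
  · have e0 : dyadicScale 0 = 1 := by simp [dyadicScale]
    rw [e0, Real.one_rpow, mul_one, Nat.cast_zero, zero_sub]
    exact (h y).1.trans (le_mul_of_one_le_right hC h2)
  · rw [Nat.cast_succ, add_sub_cancel_right]
    refine ((h y).2 n).trans (le_of_eq ?_)
    rw [mul_assoc, dyadicScale_succ n, Real.mul_rpow two_pos.le (dyadicScale_pos _).le]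

/-- For `γ > 0` the blocks decay geometrically, uniformly in the point, so the series converges to a
bounded measurable function. -/
theorem exists_isRemainder (hr : 0 < r) (ha : S.minA < γ) (hγ : 0 < γ)
    {D : DyadicPartition d} {f : M.modelled γ} {p : 𝓢'(Euc d, ℂ)} (hp : M.IsParaproduct D f.1 p) :
    ∃ v, M.IsRemainder D f.1 p v := by
  obtain ⟨C, hC, h⟩ := exists_bound_remBlock_pred hr ha hγ hp
  have hsum := (summable_dyadicScale_rpow hγ).mul_left C
  have hs : ∀ x, Summable fun n : ℕ => M.remBlock D f.1 p ((n : ℤ) - 1) x := fun x =>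
    Summable.of_norm_bounded hsum fun n => h n x
  have hm : StronglyMeasurable fun x => ∑' n : ℕ, M.remBlock D f.1 p ((n : ℤ) - 1) x := by
    refine stronglyMeasurable_of_tendsto atTop
      (f := fun N x => ∑ n ∈ Finset.range N, M.remBlock D f.1 p ((n : ℤ) - 1) x)
      (fun N => Finset.stronglyMeasurable_fun_sum _ fun n _ =>
        stronglyMeasurable_remBlock hr D f p _) ?_
    exact tendsto_pi_nhds.2 fun x => (hs x).hasSum.tendsto_sum_nat
  have hb : ∀ x, ‖∑' n : ℕ, M.remBlock D f.1 p ((n : ℤ) - 1) x‖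
      ≤ ∑' n, C * dyadicScale n ^ γ := fun x => tsum_of_norm_bounded hsum.hasSum fun n => h n x
  obtain ⟨v, hv⟩ := exists_distribution_of_bounded hm hb
  exact ⟨v, _, fun x => (hs x).hasSum, fun φ => ⟨integrable_bounded_mul hm hb φ, hv φ⟩⟩

theorem IsRemainder.unique {D : DyadicPartition d} {f : Euc d → S.Space} {p u v : 𝓢'(Euc d, ℂ)}
    (hu : M.IsRemainder D f p u) (hv : M.IsRemainder D f p v) : u = v := by
  obtain ⟨g, hg, hu⟩ := hu
  obtain ⟨g', hg', hv⟩ := hv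
  obtain rfl : g = g' := funext fun x => (hg x).unique (hg' x)
  ext φ
  rw [(hu φ).2, (hv φ).2]

theorem IsRemainder.add {D : DyadicPartition d} {f f' : Euc d → S.Space} {p p' u u' : 𝓢'(Euc d, ℂ)}
    (hu : M.IsRemainder D f p u) (hu' : M.IsRemainder D f' p' u') :
    M.IsRemainder D (f + f') (p + p') (u + u') := by
  obtain ⟨g, hg, hu⟩ := hu
  obtain ⟨g', hg', hu'⟩ := hu'
  refine ⟨fun x => g x + g' x, fun x => ?_, fun φ => ?_⟩
  · convert (hg x).add (hg' x) using 2 with n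
    rw [remBlock, Pi.add_apply, map_add]
    exact add_sub_add_comm _ _ _ _
  · simp_rw [add_mul]
    refine ⟨(hu φ).1.add (hu' φ).1, ?_⟩
    rw [integral_add (hu φ).1 (hu' φ).1, ← (hu φ).2, ← (hu' φ).2]
    rfl

theorem IsRemainder.smul {D : DyadicPartition d} {f : Euc d → S.Space} {p u : 𝓢'(Euc d, ℂ)}
    (c : ℝ) (hu : M.IsRemainder D f p u) : M.IsRemainder D (c • f) (c • p) (c • u) := by
  obtain ⟨g, hg, hu⟩ := hu
  refine ⟨fun x => c • g x, fun x => ?_, fun φ => ?_⟩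
  · convert (hg x).const_smul c using 2 with n
    rw [remBlock, Pi.smul_apply, map_smul]
    exact (smul_sub c _ _).symm
  · simp_rw [smul_mul_assoc]
    refine ⟨(hu φ).1.smul c, ?_⟩
    rw [integral_smul, ← (hu φ).2]
    rfl

theorem sum_remBlock (D : DyadicPartition d) (f : Euc d → S.Space) (p : 𝓢'(Euc d, ℂ)) (i : ℕ)
    (y : Euc d) : ∑ n ∈ Finset.range (i + 1), M.remBlock D f p ((n : ℤ) - 1) y =
      p (kernelAt (D.kernelLt i) y) - M.Pi y (f y) (kernelAt (D.kernelLt i) y) := by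
  induction i with
  | zero =>
    have h0 : D.kernelLt (0 : ℕ) = D.kernel (-1) := by
      rw [D.kernelLt_natCast_eq_add]; simp
    rw [h0]
    simp [remBlock]
  | succ i ih =>
    rw [Finset.sum_range_succ, ih, D.kernelLt_succ, kernelAt_add, map_add, map_add, Nat.cast_succ,
      add_sub_cancel_right, remBlock]
    ring

/-- `P f - T f` is a reconstruction for `γ > 0`. -/
theorem IsRemainder.isReconstruction (hr : 0 < r) (ha : S.minA < γ) (hγ : 0 < γ)
    {D : DyadicPartition d} {f : M.modelled γ} {p v : 𝓢'(Euc d, ℂ)}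
    (hp : M.IsParaproduct D f.1 p) (hv : M.IsRemainder D f.1 p v)
    {q : ℝ} (hs : 0 < q + γ) (hsa : 0 < q + γ + S.minA) : M.IsReconstruction q f (p - v) := by
  obtain ⟨C, hC, h⟩ := exists_bound_high hr ha hp hs hsa
  obtain ⟨C₁, hC₁, h₁⟩ := exists_bound_remBlock_pred hr ha hγ hp
  obtain ⟨C₂, hC₂, h₂⟩ := exists_bound_relDist_self hr ha f (kernelAt (D.kernel (-1)) 0)
  obtain ⟨g, hg, hv⟩ := hv
  have hM : 0 ≤ γ - S.minA := sub_nonneg.2 ha.le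
  set A := 2 ^ (γ - S.minA) * volume.real (Metric.closedBall (0 : Euc d) 1) with hA
  have hA0 : 0 ≤ A := by positivity
  have hsum := summable_dyadicScale_rpow hγ
  set G := ∑' k, dyadicScale k ^ γ with hGdef
  have hG : 0 ≤ G := tsum_nonneg fun k => by have := dyadicScale_pos k; positivity
  -- The first `i + 1` terms of the series are the blocks below frequency `2^i`, which telescope to
  -- `K_{<i}`; what remains is the tail of `T f`.
  have htail : ∀ i y, ‖p (kernelAt (D.kernelLt (i : ℕ)) y) -
      M.Pi y (f.1 y) (kernelAt (D.kernelLt (i : ℕ)) y) - g y‖ ≤ C₁ * G * dyadicScale i ^ γ := by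
    intro i y
    rw [← sum_remBlock, norm_sub_rev]
    have hsub := (hasSum_nat_add_iff' (i + 1)).2 (hg y)
    rw [← hsub.tsum_eq]
    have hi := dyadicScale_pos i
    have hd := (hsum.hasSum.mul_left (C₁ * dyadicScale i ^ γ))
    refine (tsum_of_norm_bounded hd fun k => (h₁ _ y).trans ?_).trans (le_of_eq (by ring))
    have hk := dyadicScale_pos k
    have hle : dyadicScale (k + (i + 1)) ≤ dyadicScale i * dyadicScale k := by
      rw [← dyadicScale_add]
      exact dyadicScale_antitone (by omega)
    have hk1 := dyadicScale_pos (k + (i + 1))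
    calc C₁ * dyadicScale (k + (i + 1)) ^ γ ≤ C₁ * (dyadicScale i * dyadicScale k) ^ γ := by
          gcongr
      _ = _ := by rw [Real.mul_rpow hi.le hk.le]; ring
  refine ⟨C + A * ((C₁ * G + C₂ * 2 ^ (γ - S.minA)) * 2 ^ |γ|), fun φ hφ x lam h0 h1 => ?_⟩
  obtain ⟨i, hi1, hi2⟩ := exists_dyadicScale_near h0 h1
  have hμ := dyadicScale_pos (i + 1)
  have hlow : ‖(∫ y, (p - M.Pi x (f.1 x)) (kernelAt (D.kernelLt (i + 1 : ℕ)) y) *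
      rescale φ x lam y) - v (rescale φ x lam)‖
        ≤ A * ((C₁ * G + C₂ * 2 ^ (γ - S.minA)) * (2 ^ |γ| * lam ^ γ)) := by
    rw [(hv _).2, ← integral_sub (integrable_mul_pairing_kernelAt _ _ _) (hv _).1]
    simp_rw [← sub_mul]
    refine hφ.norm_integral_mul_rescale_le hM h0 fun w => ?_
    have hone : 1 ≤ (1 + ‖w‖) ^ (γ - S.minA) :=
      Real.one_le_rpow (by linarith [norm_nonneg w]) hM
    set y := x + lam • w with hy
    -- Here `P f - Π_x f_x - T f` splits at low frequency into the tail of the remainder at `y` and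
    -- a change of base point from `y` to `x`; each is `O(λ^γ)` for `|y - x|` of order `λ`.
    have e : (p - M.Pi x (f.1 x)) (kernelAt (D.kernelLt (i + 1 : ℕ)) y) - g y =
        (p (kernelAt (D.kernelLt (i + 1 : ℕ)) y) -
          M.Pi y (f.1 y) (kernelAt (D.kernelLt (i + 1 : ℕ)) y) - g y) +
        relDist f x y (kernelAt (D.kernelLt (i + 1 : ℕ)) y) := by
      rw [relDist_apply]
      have : (p - M.Pi x (f.1 x)) (kernelAt (D.kernelLt (i + 1 : ℕ)) y) =
        p (kernelAt (D.kernelLt (i + 1 : ℕ)) y) -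
          M.Pi x (f.1 x) (kernelAt (D.kernelLt (i + 1 : ℕ)) y) := rfl
      rw [this]
      ring
    have h3 := h₂ x y _ hμ (dyadicScale_le_one (i + 1))
    rw [← D.kernelAt_kernelLt] at h3
    have h4 : (1 + ‖y - x‖ / dyadicScale (i + 1)) ^ (γ - S.minA)
        ≤ 2 ^ (γ - S.minA) * (1 + ‖w‖) ^ (γ - S.minA) := by
      rw [← Real.mul_rpow two_pos.le (by positivity)]
      refine Real.rpow_le_rpow (by positivity) ?_ hM
      have h5 : ‖y - x‖ / dyadicScale (i + 1) ≤ 2 * ‖w‖ := by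
        rw [hy, add_sub_cancel_left, norm_smul, Real.norm_of_nonneg h0.le, div_le_iff₀ hμ]
        rw [dyadicScale_succ] at hi2
        calc lam * ‖w‖ ≤ 2 * dyadicScale (i + 1) * ‖w‖ := by gcongr
          _ = _ := by ring
      linarith
    rw [e]
    refine (norm_add_le_of_le (htail (i + 1) y) h3).trans ?_
    calc C₁ * G * dyadicScale (i + 1) ^ γ + C₂ * dyadicScale (i + 1) ^ γ *
          (1 + ‖y - x‖ / dyadicScale (i + 1)) ^ (γ - S.minA)
        ≤ C₁ * G * dyadicScale (i + 1) ^ γ * (1 + ‖w‖) ^ (γ - S.minA) +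
          C₂ * dyadicScale (i + 1) ^ γ * (2 ^ (γ - S.minA) * (1 + ‖w‖) ^ (γ - S.minA)) := by
          exact add_le_add (le_mul_of_one_le_right (by positivity) hone)
            (mul_le_mul_of_nonneg_left h4 (by positivity))
      _ = (C₁ * G + C₂ * 2 ^ (γ - S.minA)) * dyadicScale (i + 1) ^ γ *
          (1 + ‖w‖) ^ (γ - S.minA) := by ring
      _ ≤ _ := by
          gcongr
          exact dyadicScale_succ_rpow_le h0 hi1 hi2 γ
  have := norm_sub_pairing_le_of_low (p - M.Pi x (f.1 x)) (rescale φ x lam)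
    (fun N => h φ hφ x lam (i + 1) N hi1) hlow
  have e : (p - v) (rescale φ x lam) - M.Pi x (f.1 x) (rescale φ x lam) =
      (p - M.Pi x (f.1 x)) (rescale φ x lam) - v (rescale φ x lam) := by
    exact sub_right_comm (p (rescale φ x lam)) (v (rescale φ x lam)) _
  rw [e]
  refine this.trans (le_of_eq ?_)
  ring

/-- For `γ > 0`, reconstructions are unique. -/
theorem IsReconstruction.unique (hγ : 0 < γ) {q : ℝ} (hs : 0 < q + γ) {f : M.modelled γ}
    {u v : 𝓢'(Euc d, ℂ)} (hu : M.IsReconstruction q f u) (hv : M.IsReconstruction q f v) :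
    u = v := by
  obtain ⟨C, hu⟩ := hu
  obtain ⟨C', hv⟩ := hv
  obtain ⟨η, hη, hη1⟩ := exists_unit_bump d
  choose b hb0 hb using fun k => decay_rpow η 0 k
  set B := 1 + ∑ k ∈ Finset.range (⌊q + γ⌋₊ + 2), b k with hB
  have hB0 : 0 < B := by
    have := Finset.sum_nonneg fun k (_ : k ∈ Finset.range (⌊q + γ⌋₊ + 2)) => hb0 k
    positivity
  have hηb : ∀ k ≤ ⌊q + γ⌋₊ + 1, ∀ x, ‖iteratedFDeriv ℝ k η x‖ ≤ B := by
    intro k hk x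
    have h1 := hb k x
    rw [neg_zero, Real.rpow_zero, mul_one] at h1
    have := Finset.single_le_sum (f := b) (fun i _ => hb0 i)
      (Finset.mem_range.2 (by omega : k < ⌊q + γ⌋₊ + 2))
    linarith
  set K := ((⌊q + γ⌋₊ : ℝ) + 3) * B * (C + C') with hK
  have hle : ∀ x lam, 0 < lam → lam ≤ 1 → ‖(u - v) (rescale η x lam)‖ ≤ K * lam ^ γ := by
    intro x lam h0 h1
    refine (norm_pairing_le_of_unitTest hs hB0 hη hηb (u - v) (X := (C + C') * lam ^ γ) h0
      fun ψ hψ => ?_).trans (le_of_eq (by rw [hK]; ring))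
    have e : (u - v) (rescale ψ x lam) =
        (u (rescale ψ x lam) - M.Pi x (f.1 x) (rescale ψ x lam)) -
          (v (rescale ψ x lam) - M.Pi x (f.1 x) (rescale ψ x lam)) := by
      rw [sub_sub_sub_cancel_right]
      rfl
    rw [e, add_mul]
    exact norm_sub_le_of_le (hu ψ hψ x lam h0 h1) (hv ψ hψ x lam h0 h1)
  rw [← sub_eq_zero]
  ext ψ
  -- The bound `K λ^γ` is uniform in the centre, so averages of `u - v` at scale `λ` vanish in the
  -- limit; these averages also converge to `u - v`.
  have h1 := tendsto_integral_rescale (u - v) η ψ hη1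
  have h2 : Tendsto (fun lam : ℝ => K * lam ^ γ * ∫ y, ‖ψ y‖) (𝓝[>] 0) (𝓝 0) := by
    have : ContinuousAt (fun lam : ℝ => K * lam ^ γ * ∫ y, ‖ψ y‖) 0 :=
      ((Real.continuousAt_rpow_const _ _ (Or.inr hγ.le)).const_mul K).mul_const _
    have h3 := this.tendsto.mono_left (nhdsWithin_le_nhds (s := Set.Ioi 0))
    simpa [Real.zero_rpow hγ.ne'] using h3
  refine tendsto_nhds_unique h1 (squeeze_zero_norm' ?_ h2)
  filter_upwards [Ioc_mem_nhdsGT (zero_lt_one (α := ℝ))] with lam hlam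
  rw [← integral_const_mul]
  refine norm_integral_le_of_norm_le (ψ.integrable.norm.const_mul _) (Eventually.of_forall fun y => ?_)
  rw [norm_mul]
  exact mul_le_mul_of_nonneg_right (hle y lam hlam.1 hlam.2) (norm_nonneg _)

/-! ### Linearity -/

/-- Existence and uniqueness make the relation the graph of a map, and stability of the relation
under sums and multiples makes that map linear. -/
theorem exists_linear {E : Type*} [AddCommGroup E] [Module ℝ E] {R : E → 𝓢'(Euc d, ℂ) → Prop}
    (hex : ∀ f, ∃ u, R f u) (huniq : ∀ f u v, R f u → R f v → u = v)
    (hadd : ∀ f g u v, R f u → R g v → R (f + g) (u + v))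
    (hsmul : ∀ (c : ℝ) f u, R f u → R (c • f) (c • u)) :
    ∃ P : E →ₗ[ℝ] 𝓢'(Euc d, ℂ), ∀ f, R f (P f) := by
  choose P hP using hex
  exact ⟨{ toFun := P
           map_add' := fun f g => huniq _ _ _ (hP _) (hadd _ _ _ _ (hP f) (hP g))
           map_smul' := fun c f => huniq _ _ _ (hP _) (hsmul c _ _ (hP f)) }, hP⟩

theorem isParaproduct_zero (D : DyadicPartition d) : M.IsParaproduct D 0 0 := by
  have e : ∀ i x, M.paraIntegrand D 0 i x = 0 := by
    intro i x
    ext z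
    rw [paraIntegrand, Pi.zero_apply, map_zero]
    exact mul_zero _
  have e' : ∀ i x, M.paraBlock D 0 i x = 0 := fun i x => by
    rw [paraBlock, e]; exact integral_zero _ _
  refine ⟨fun i x => by rw [e]; exact integrable_zero _ _ _, fun φ => ?_⟩
  simp_rw [e', zero_mul, integral_zero]
  exact ⟨fun _ => integrable_zero _ _ _, hasSum_zero⟩

theorem modelled_eq_zero (h : γ ≤ S.minA) (f : M.modelled γ) : f.1 = 0 := by
  ext x α
  exact f.2.1 x α (h.trans (minA_le α))

end Model

end

end

theorem mainTheorem12 {d : ℕ} (hd : 1 ≤ d) (D : DyadicPartition d)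
    (S : RegularityStructure.{u}) (r : ℝ) (hr : |S.minA| < r) (M : Model S d r)
    (γ : ℝ) (hγ : γ ≠ 0) (q : ℝ) (hq : |S.minA| < q) (hqγ : |S.minA| < q + γ) :
    ∃ P : M.modelled γ →ₗ[ℝ] 𝓢'(Euc d, ℂ),
      (∀ f, M.IsParaproduct D f.1 (P f)) ∧
      (γ < 0 → ∀ f, M.IsReconstruction q f (P f)) ∧
      (0 < γ → ∃ T : M.modelled γ →ₗ[ℝ] 𝓢'(Euc d, ℂ),
        (∀ f, M.IsRemainder D f.1 (P f) (T f)) ∧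
        (∀ f, M.IsReconstruction q f ((P - T) f)) ∧
        ∀ (f : M.modelled γ) (u : 𝓢'(Euc d, ℂ)),
          M.IsReconstruction q f u → u = (P - T) f) := by
  have hr0 : 0 < r := (abs_nonneg _).trans_lt hr
  have hs : 0 < q + γ := (abs_nonneg _).trans_lt hqγ
  -- The exponent of the geometric series of high frequencies.
  have hsa : 0 < q + γ + S.minA := by linarith [neg_abs_le S.minA]
  rcases lt_or_ge S.minA γ with ha | ha
  · obtain ⟨P, hP⟩ := Model.exists_linear (R := fun f : M.modelled γ => M.IsParaproduct D f.1)
      (fun f => Model.exists_isParaproduct hr0 ha D f) (fun _ _ _ hu hv => hu.unique hv)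
      (fun _ _ _ _ hu hv => hu.add hv) (fun c _ _ hu => hu.smul c)
    refine ⟨P, hP, fun hγ0 f => (hP f).isReconstruction hr0 ha hγ0 hs hsa, fun hγ0 => ?_⟩
    obtain ⟨T, hT⟩ := Model.exists_linear
      (R := fun f : M.modelled γ => M.IsRemainder D f.1 (P f))
      (fun f => Model.exists_isRemainder hr0 ha hγ0 (hP f)) (fun _ _ _ hu hv => hu.unique hv)
      (fun f g _ _ hu hv => by rw [map_add]; exact hu.add hv)
      (fun c f _ hu => by rw [map_smul]; exact hu.smul c)
    have hrec : ∀ f, M.IsReconstruction q f ((P - T) f) := fun f =>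
      (hT f).isReconstruction hr0 ha hγ0 (hP f) hs hsa
    exact ⟨T, hT, hrec, fun f u hu => hu.unique hγ0 hs (hrec f)⟩
  -- No homogeneity lies below `γ`, so `𝒟^γ` is trivial and `P = 0` works. Since `min A ≤ 0`, this
  -- case excludes `γ > 0`.
  · have hf := Model.modelled_eq_zero (M := M) ha
    refine ⟨0, fun f => by rw [hf f]; exact Model.isParaproduct_zero D, fun _ f => ⟨0, ?_⟩,
      fun hγ0 => absurd (hγ0.trans_le ha) (not_lt.2 RegularityStructure.minA_nonpos)⟩
    intro φ _ x lam _ _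
    rw [hf f, Pi.zero_apply, map_zero]
    change ‖(0 : ℂ) - 0‖ ≤ _
    simp
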